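/- **Setting.** Let $\phi:\mathbb R\to\mathbb R$, let $\gamma_w,\sigma_w>0$ and $\gamma_b,\sigma_b\ge 0$, and let $l\ge 1$. Consider the fully connected network with $l-1$ hidden layers of widths $m_1,\dots,m_{l-1}$ and scalar linear output $g^{(l)}(\mathbf x)$, where for $\mathbf x\in\mathbb R^d$ $$g^{(1)}(\mathbf x)=\gamma_w\mathbf W^{(1)}\mathbf x+\gamma_b\mathbf b^{(1)},\qquad g^{(k)}(\mathbf x)=\frac{\sigma_w}{\sqrt{m_{k-1}}}\mathbf W^{(k)}\phi\big(g^{(k-1)}(\mathbf x)\big)+\sigma_b\mathbf b^{(k)}\quad(2\le k\le l),$$ with $m_l=1$ and $\phi$ applied entrywise. Let $\tilde\Theta^{(l)}(\mathbf x,\mathbf y)=\langle\nabla_{\theta_l} g^{(l)}(\mathbf x),\nabla_{\theta_l} g^{(l)}(\mathbf y)\rangle$, where $\theta_l$ collects all weights and biases of layers $1,\dots,l$. **Assumptions.** (1) All parameters are independent $\mathcal N(0,1)$ random variables. (2) $\phi\in L^2(\mathbb R,\gamma)$ with $\gamma$ the standard Gaussian measure, $\phi$ is differentiable almost everywhere,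 and $\phi'\in L^2(\mathbb R,\gamma)$. (3) The widths are sent to infinity in sequence, $m_1\to\infty$, then $m_2\to\infty$, $\dots$, then $m_{l-1}\to\infty$; that is, a random variable $T_m$ depending on the widths converges in probability to $c$ in this limit if for all $\varepsilon,\delta>0$: for all large $m_{l-1}$, for all large $m_{l-2}$ (depending on $m_{l-1}$), $\dots$, for all large $m_1$ (depending on $m_2,\dots,m_{l-1}$), $\mathbb P(|T_m-c|\ge\varepsilon)\le\delta$. (4) $\gamma_w^2+\gamma_b^2=1$ and $\sigma_b^2=1-\sigma_w^2\,\mathbb E_{Z\sim\mathcal N(0,1)}[\phi(Z)^2]$. (5) $\mathbf X\in\mathbb R^{n\times d}$ has rows $\mathbf x_1,\dots,\mathbf x_n$ with $\|\mathbf x_i\|=1$. **Coefficients.** Let $\mu_k(f)=\mathbb E_{Z\sim\mathcal N(0,1)}[f(Z)h_k(Z)]$, where $h_k$ is the $k$-th normalized probabilist's Hermite polynomial. For a real sequence $\bar a=(a_p)_{p\ge0}$ let $F(p,k,\bar a)=\sum_{j_1+\dots+j_k=p}\prod_{i=1}^k a_{j_i}$, the sum being over all $j_1,\dots,j_k\in\mathbb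 Z_{\ge0}$ with sum $p$ (so $F(0,0,\bar a)=1$ and $F(p,0,\bar a)=0$ for $p\ge1$). Put $a_k=\sigma_w^2\mu_k(\phi)^2+\delta_{k=0}\sigma_b^2$ and $b_k=\sigma_w^2\mu_k(\phi')^2$, and for $p\ge 0$, with $\bar\alpha_r=(\alpha_{p,r})_{p\ge0}$, $$\alpha_{p,1}=\delta_{p=0}\gamma_b^2+\delta_{p=1}\gamma_w^2,\qquad \alpha_{p,r}=\sum_{k=0}^\infty a_kF(p,k,\bar\alpha_{r-1}),\qquad \upsilon_{p,r}=\sum_{k=0}^\infty b_kF(p,k,\bar\alpha_{r-1})\qquad(r\ge2),$$ $$\kappa_{p,1}=\delta_{p=0}\gamma_b^2+\delta_{p=1}\gamma_w^2,\qquad \kappa_{p,r}=\alpha_{p,r}+\sum_{q=0}^p\kappa_{q,r-1}\,\upsilon_{p-q,r}\qquad(r\ge2).$$ **Theorem.** For every $l\ge1$ and every $i$, the probability that the gradient $\nabla_{\theta_l}g^{(l)}(\mathbf x_i)$ exists tends to one in the sequential infinite-width limit. There is a unique matrix $\mathbf K_l\in\mathbb R^{n\times n}$ such that, in this limit, $\tilde\Theta^{(l)}(\mathbf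 x_i,\mathbf x_j)$ converges in probability to $n[\mathbf K_l]_{ij}$ for all $i,j$, and $$n\mathbf K_l=\sum_{p=0}^\infty\kappa_{p,l}\,(\mathbf X\mathbf X^T)^{\odot p},$$ where $\odot p$ denotes the entrywise $p$-th power and the series converges absolutely in each entry. The coefficients $\kappa_{p,l}$ and $\alpha_{p,l}$ $(l\ge1)$ and $\upsilon_{p,l}$ $(l\ge2)$ are nonnegative, and the series defining $\alpha_{p,l}$ and $\upsilon_{p,l}$ $(l\ge2)$ converge. If $\gamma_b=0$, then $\alpha_{p,2}=a_p=\sigma_w^2\mu_p(\phi)^2+\delta_{p=0}\sigma_b^2$ and $\upsilon_{p,2}=b_p=\sigma_w^2\mu_p(\phi')^2$ for all $p$, so that $\alpha_{p,l}=\sum_k\alpha_{k,2}F(p,k,\bar\alpha_{l-1})$ and $\upsilon_{p,l}=\sum_k\upsilon_{k,2}F(p,k,\bar\alpha_{l-1})$ for $l\ge3$. -/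

import Mathlib

open MeasureTheory ProbabilityTheory Filter Topology

noncomputable section

/-- A fully connected architecture without its widths: the activation function and the weight and
bias hyperparameters of the first layer (`gammaW`, `gammaB`) and of the later layers
(`sigmaW`, `sigmaB`). -/
structure Net where
  phi : ℝ → ℝ
  gammaW : ℝ
  gammaB : ℝ
  sigmaW : ℝ
  sigmaB : ℝ

/-- Names of the scalar parameters: `Sum.inl (k, i, j)` is the weight `W⁽ᵏ⁾ᵢⱼ` and `Sum.inr (k, i)`
is the bias `b⁽ᵏ⁾ᵢ`. Layers are numbered from 1, neurons from 0. A network of given widths uses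
only finitely many of them. -/
abbrev Param : Type := (ℕ × ℕ × ℕ) ⊕ (ℕ × ℕ)

namespace Net

/-- The preactivation `g⁽ˡ⁾ᵢ(x)` of neuron `i` in layer `l ≥ 1`, where `m k` is the width of the
hidden layer `k ≥ 1` and the input has dimension `d`. (The value at `l = 0` is not used.) -/
def preact (N : Net) {d : ℕ} (m : ℕ → ℕ) (θ : Param → ℝ) (x : Fin d → ℝ) : ℕ → ℕ → ℝ
  | 0, _ => 0
  | 1, i => N.gammaW * ∑ j : Fin d, θ (Sum.inl (1, i, (j : ℕ))) * x j
      + N.gammaB * θ (Sum.inr (1, i))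
  | k + 2, i =>
      N.sigmaW / Real.sqrt (m (k + 1)) *
        ∑ j ∈ Finset.range (m (k + 1)),
          θ (Sum.inl (k + 2, i, j)) * N.phi (preact N m θ x (k + 1) j)
      + N.sigmaB * θ (Sum.inr (k + 2, i))

/-- The scalar output of the depth `l` network (`l - 1` hidden layers and a linear output layer
with one neuron). -/
def output (N : Net) {d : ℕ} (m : ℕ → ℕ) (l : ℕ) (θ : Param → ℝ) (x : Fin d → ℝ) : ℝ :=
  N.preact m θ x l 0

/-- The partial derivative of the output with respect to the parameter `p`. -/
def outputDeriv (N : Net) {d : ℕ} (m : ℕ → ℕ) (l : ℕ) (θ : Param → ℝ) (x : Fin d → ℝ)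
    (p : Param) : ℝ :=
  deriv (fun t : ℝ => N.output m l (Function.update θ p t) x) (θ p)

/-- All partial derivatives of the output with respect to the parameters exist. -/
def GradExists (N : Net) {d : ℕ} (m : ℕ → ℕ) (l : ℕ) (θ : Param → ℝ) (x : Fin d → ℝ) : Prop :=
  ∀ p : Param, DifferentiableAt ℝ (fun t : ℝ => N.output m l (Function.update θ p t) x) (θ p)

/-- Number of neurons in layer `k` of the depth `l` network. -/
def numNeurons (m : ℕ → ℕ) (l k : ℕ) : ℕ := if k = l then 1 else m k

/-- Number of inputs of each neuron in layer `k`. -/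
def fanIn (d : ℕ) (m : ℕ → ℕ) (k : ℕ) : ℕ := if k = 1 then d else m (k - 1)

/-- The finite-width neural tangent kernel of the depth `l` network: the inner product of the
gradients, with respect to all weights and biases in layers `1, …, l`, of the outputs at
`x` and `y`. -/
def empiricalNTK (N : Net) {d : ℕ} (m : ℕ → ℕ) (l : ℕ) (θ : Param → ℝ) (x y : Fin d → ℝ) : ℝ :=
  ∑ k ∈ Finset.Icc 1 l, ∑ i ∈ Finset.range (numNeurons m l k),
    ((∑ j ∈ Finset.range (fanIn d m k),
        N.outputDeriv m l θ x (Sum.inl (k, i, j)) * N.outputDeriv m l θ y (Sum.inl (k, i, j)))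
      + N.outputDeriv m l θ x (Sum.inr (k, i)) * N.outputDeriv m l θ y (Sum.inr (k, i)))

end Net

/-- The sequential infinite-width limit `m₁ → ∞, m₂ → ∞, …, m_L → ∞`: a property of the widths
holds eventually along this filter iff for all large `m_L`, for all large `m_{L-1}` (depending on
`m_L`), …, for all large `m₁` (depending on `m₂, …, m_L`), it holds. Widths of layers outside
`1, …, L` are arbitrary. -/
def seqWidths : ℕ → Filter (ℕ → ℕ)
  | 0 => ⊤
  | L + 1 => (atTop : Filter ℕ).bind
      fun w => (seqWidths L).map fun m => Function.update m (L + 1) w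

/-- `K` is the infinite-width NTK matrix at layer `l` of the data `X`: along the sequential
infinite-width limit, the finite-width NTK at every pair of rows of `X` converges in
probability to the constant `n * K i j`. -/
def IsNTKMatrix {Ω : Type*} [MeasurableSpace Ω] (P : Measure Ω) (θ : Param → Ω → ℝ) (N : Net)
    {n d : ℕ} (X : Matrix (Fin n) (Fin d) ℝ) (l : ℕ) (K : Matrix (Fin n) (Fin n) ℝ) : Prop :=
  ∀ i j : Fin n,
    TendstoInMeasure P
      (fun (m : ℕ → ℕ) (ω : Ω) => N.empiricalNTK m l (fun p => θ p ω) (X i) (X j))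
      (seqWidths (l - 1)) (fun _ => (n : ℝ) * K i j)

/-- The `k`-th normalized probabilist's Hermite coefficient `μ_k(f) = E[f(Z) h_k(Z)]`,
`Z ∼ N(0,1)`. -/
def hermiteCoeff (f : ℝ → ℝ) (k : ℕ) : ℝ :=
  ∫ z, f z * (Polynomial.aeval z (Polynomial.hermite k) / Real.sqrt (Nat.factorial k))
    ∂(gaussianReal 0 1)

/-- `F(p, k, a)`: the sum of `a_{j₁} ⋯ a_{j_k}` over all `k`-tuples of natural numbers with sum `p`
(for `k = 0` it is `1` if `p = 0` and `0` otherwise). -/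
def tupleSum (p k : ℕ) (a : ℕ → ℝ) : ℝ :=
  ∑ j ∈ Finset.Nat.antidiagonalTuple k p, ∏ i : Fin k, a (j i)

/-- The Hadamard power `A^{⊙ p}`. -/
def hadamardPow {ι : Type*} (A : Matrix ι ι ℝ) (p : ℕ) : Matrix ι ι ℝ :=
  Matrix.of fun i j => A i j ^ p

namespace Net

/-- `a_k = σ_w² μ_k(φ)² + δ_{k=0} σ_b²`. -/
def aCoeff (N : Net) (k : ℕ) : ℝ :=
  N.sigmaW ^ 2 * hermiteCoeff N.phi k ^ 2 + if k = 0 then N.sigmaB ^ 2 else 0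

/-- `b_k = σ_w² μ_k(φ')²`. -/
def bCoeff (N : Net) (k : ℕ) : ℝ :=
  N.sigmaW ^ 2 * hermiteCoeff (deriv N.phi) k ^ 2

/-- `δ_{p=0} γ_b² + δ_{p=1} γ_w²`. -/
def firstCoeff (N : Net) (p : ℕ) : ℝ :=
  (if p = 0 then N.gammaB ^ 2 else 0) + if p = 1 then N.gammaW ^ 2 else 0

/-- The coefficients `α_{p,l}`, `l ≥ 1`, with arguments in the order `l`, `p`. -/
def alpha (N : Net) : ℕ → ℕ → ℝ
  | 0, _ => 0
  | 1, p => N.firstCoeff p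
  | l + 2, p => ∑' k : ℕ, N.aCoeff k * tupleSum p k (alpha N (l + 1))

/-- The coefficients `υ_{p,l}`, `l ≥ 2`, with arguments in the order `l`, `p`. -/
def upsilon (N : Net) (l p : ℕ) : ℝ :=
  ∑' k : ℕ, N.bCoeff k * tupleSum p k (N.alpha (l - 1))

/-- The NTK coefficients `κ_{p,l}`, `l ≥ 1`, with arguments in the order `l`, `p`. -/
def kappa (N : Net) : ℕ → ℕ → ℝ
  | 0, _ => 0
  | 1, p => N.firstCoeff p
  | l + 2, p => N.alpha (l + 2) p
      + ∑ q ∈ Finset.range (p + 1), kappa N (l + 1) q * N.upsilon (l + 2) (p - q)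

end Net

end

/-! Put t = ⟨x, y⟩. The scalar recursions `corr` and `limitNTK` describe the limiting covariance and
kernel as functions of t in [-1, 1]. The theorem splits into an identity (the power series of
`limitNTK` has coefficients κ) and a limit (the empirical kernel tends to `limitNTK` in
probability).

Identity. Mehler's formula (`hasSum_hermiteCoeff_sq`) expands E[f(U)f(V)] in powers of the
correlation with coefficients μ_k(f)² ≥ 0. Nonnegative series that converge on [-1, 1] are closed
under sums, Cauchy products and, when the inner function is at most 1 at t = 1, composition
(`HasNonnegSeries.comp`). The unit variance condition makes the inner functions equal to 1 there
(`corr_one`), and the closure operations are exactly the recursions for α, υ and κ.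

Limit. The lower widths go to infinity first, so at each layer one fixes its width w and lets
everything below converge. The w preactivations at two inputs converge in total variation to
independent correlated Gaussian pairs (`eventually_map_pairMap`). Total variation is needed because
φ and φ' are only square integrable: an event on the network is exchanged for the same event on
exact i.i.d. Gaussian pairs, where the weak law applies. For the induction, the next layer is
Gaussian conditionally on the previous one, its random Gram matrix concentrates, and Gaussian pairs
with close Gram matrices are close in total variation (`exists_gram_tvLe`). If the limiting
correlation is ±1 the limit law is singular and this could fail; `degenerate_corr` shows that the
random Gram matrix is then almost surely of the exact degenerate form.

Backpropagation writes the kernel of a layer as a double sum over pairs of neurons below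
(`sum_layerSum_eq_ntkRec`). For fixed w the kernels below converge to a multiple of the identity,
with errors multiplied by tight factors; the surviving diagonal sum obeys the weak law
(`tendsto_ntkRec`).

Finally φ is only almost everywhere measurable and differentiable. A measurable version is used for
the limit, and the Gaussian null set where it differs from φ or where φ is not differentiable is hit
with probability tending to zero (`tendsto_hiddenHits`). -/

noncomputable section

open scoped ENNReal

/-! ### Total variation closeness -/

/-- One-sided closeness of measures in total variation. -/
def TVLe {α : Type*} [MeasurableSpace α] (δ : ℝ≥0∞) (μ ν : Measure α) : Prop :=
  ∀ B, MeasurableSet B → μ B ≤ ν B + δ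

namespace TVLe

variable {α β : Type*} [MeasurableSpace α] [MeasurableSpace β] {δ δ' : ℝ≥0∞}

/-- A measurable hull for ν removes the measurability assumption; events built from arbitrary null
sets are treated this way later. -/
lemma apply_le {μ ν : Measure α} (h : TVLe δ μ ν) (B : Set α) : μ B ≤ ν B + δ := by
  calc μ B ≤ μ (toMeasurable ν B) := measure_mono (subset_toMeasurable ν B)
    _ ≤ ν (toMeasurable ν B) + δ := h _ (measurableSet_toMeasurable ν B)
    _ = ν B + δ := by rw [measure_toMeasurable]

lemma mono {μ ν : Measure α} (h : TVLe δ μ ν) (hδ : δ ≤ δ') : TVLe δ' μ ν :=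
  fun B hB => (h B hB).trans (by gcongr)

lemma trans {μ ν ξ : Measure α} (h : TVLe δ μ ν) (h' : TVLe δ' ν ξ) : TVLe (δ + δ') μ ξ :=
  fun B hB => (h B hB).trans (by
    calc ν B + δ ≤ ξ B + δ' + δ := by gcongr; exact h' B hB
      _ = ξ B + (δ + δ') := by ring)

lemma refl (μ : Measure α) : TVLe δ μ μ := fun _ _ => le_self_add

lemma map {μ ν : Measure α} (h : TVLe δ μ ν) {f : α → β} (hf : Measurable f) :
    TVLe δ (μ.map f) (ν.map f) := fun B hB => by
  rw [Measure.map_apply hf hB, Measure.map_apply hf hB]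
  exact h _ (hf hB)

/-- One factor is exchanged at a time, passing through μ × ν' and integrating over the unchanged
factor. -/
lemma prod {μ ν : Measure α} {μ' ν' : Measure β} [IsProbabilityMeasure μ]
    [IsProbabilityMeasure ν] [IsProbabilityMeasure μ'] [IsProbabilityMeasure ν']
    (h : TVLe δ μ ν) (h' : TVLe δ' μ' ν') : TVLe (δ + δ') (μ.prod μ') (ν.prod ν') := by
  refine TVLe.mono (δ := δ' + δ) ?_ (by rw [add_comm])
  refine TVLe.trans (ν := μ.prod ν') ?_ ?_
  · intro B hB
    rw [Measure.prod_apply hB, Measure.prod_apply hB]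
    calc ∫⁻ x, μ' (Prod.mk x ⁻¹' B) ∂μ ≤ ∫⁻ x, (ν' (Prod.mk x ⁻¹' B) + δ') ∂μ :=
          lintegral_mono fun x => h' _ (measurable_prodMk_left hB)
      _ = _ := by
        rw [lintegral_add_right _ measurable_const]; simp
  · intro B hB
    rw [Measure.prod_apply_symm hB, Measure.prod_apply_symm hB]
    calc ∫⁻ y, μ ((fun x => (x, y)) ⁻¹' B) ∂ν' ≤ ∫⁻ y, (ν ((fun x => (x, y)) ⁻¹' B) + δ) ∂ν' :=
          lintegral_mono fun y => h _ (measurable_prodMk_right hB)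
      _ = _ := by
        rw [lintegral_add_right _ measurable_const]; simp

lemma pi {μ ν : Measure α} [IsProbabilityMeasure μ] [IsProbabilityMeasure ν]
    (h : TVLe δ μ ν) (M : ℕ) :
    TVLe (M * δ) (Measure.pi fun _ : Fin M => μ) (Measure.pi fun _ : Fin M => ν) := by
  induction M with
  | zero =>
    intro B hB
    rw [Measure.pi_of_empty (fun _ : Fin 0 => μ), Measure.pi_of_empty (fun _ : Fin 0 => ν)]
    exact le_self_add
  | succ M ih =>
    have e1 := (measurePreserving_piFinSuccAbove (fun _ : Fin (M + 1) => μ) 0).symm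
    have e2 := (measurePreserving_piFinSuccAbove (fun _ : Fin (M + 1) => ν) 0).symm
    have := (h.prod ih).map e1.measurable
    rw [e1.map_eq] at this
    erw [e2.map_eq] at this
    exact this.mono (by push_cast; rw [add_mul, one_mul, add_comm])

end TVLe

/-! ### The sequential limit and the weak law of large numbers -/

lemma seqWidths_neBot (L : ℕ) : (seqWidths L).NeBot := by
  induction L with
  | zero => exact (inferInstance : (⊤ : Filter (ℕ → ℕ)).NeBot)
  | succ L ih =>
    rw [seqWidths, neBot_iff]
    intro h
    have h2 : ∀ᶠ m in ((atTop : Filter ℕ).bind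
      fun w => (seqWidths L).map fun m => Function.update m (L + 1) w), False := by
      rw [h]; exact eventually_bot
    rw [eventually_bind] at h2
    obtain ⟨w, hw⟩ := h2.exists
    rw [eventually_map] at hw
    simpa using hw.exists

/-- The last width is quantified outermost. Inductions over layers therefore fix it first and apply
the induction hypothesis to the widths below. -/
lemma eventually_seqWidths_succ {L : ℕ} {p : (ℕ → ℕ) → Prop} :
    (∀ᶠ m in seqWidths (L + 1), p m) ↔
      ∀ᶠ w in atTop, ∀ᶠ m in seqWidths L, p (Function.update m (L + 1) w) := by
  rw [seqWidths, eventually_bind]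
  simp only [eventually_map]

/-- The weak law of large numbers on finite product spaces. -/
lemma weak_law_pi {E : Type*} [MeasurableSpace E] (μ : Measure E) [IsProbabilityMeasure μ]
    {f : E → ℝ} (hf : Measurable f) (hfi : Integrable f μ) {ε : ℝ} (hε : 0 < ε) :
    Tendsto (fun w : ℕ => Measure.pi (fun _ : Fin w => μ)
      {e | ε ≤ |(w : ℝ)⁻¹ * ∑ i, f (e i) - ∫ x, f x ∂μ|}) atTop (𝓝 0) := by
  set Q := Measure.infinitePi (fun _ : ℕ => μ) with hQ
  have hmap : ∀ i : ℕ, Q.map (fun e => e i) = μ := fun i => Measure.infinitePi_map_eval _ i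
  have hmp : ∀ i : ℕ, MeasurePreserving (fun e : ℕ → E => e i) Q μ :=
    fun i => ⟨measurable_pi_apply i, hmap i⟩
  have hind : iIndepFun (fun (i : ℕ) (e : ℕ → E) => f (e i)) Q :=
    iIndepFun_infinitePi (X := fun _ : ℕ => f) (fun _ => hf)
  have hint : Integrable (fun e : ℕ → E => f (e 0)) Q :=
    (hmp 0).integrable_comp_of_integrable hfi
  have hlaw := strong_law_ae_real (μ := Q) (fun (i : ℕ) (e : ℕ → E) => f (e i)) hint
    (fun i j hij => hind.indepFun hij)
    (fun i => ⟨(hf.comp (measurable_pi_apply i)).aemeasurable,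
      (hf.comp (measurable_pi_apply 0)).aemeasurable, by
        have h1 := Measure.map_map (μ := Q) hf (measurable_pi_apply (X := fun _ => E) i)
        have h2 := Measure.map_map (μ := Q) hf (measurable_pi_apply (X := fun _ => E) 0)
        change Measure.map (f ∘ fun e => e i) Q = Measure.map (f ∘ fun e => e 0) Q
        erw [← h1, ← h2, hmap, hmap]⟩)
  have hI : ∫ e, f (e 0) ∂Q = ∫ x, f x ∂μ := by
    rw [← hmap 0, integral_map (measurable_pi_apply 0).aemeasurable
      (hf.aestronglyMeasurable)]
  rw [hI] at hlaw
  have hm : TendstoInMeasure Q (fun (n : ℕ) (e : ℕ → E) => (∑ i ∈ Finset.range n, f (e i)) / n)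
      atTop (fun _ => ∫ x, f x ∂μ) := by
    refine tendstoInMeasure_of_tendsto_ae (fun n => ?_) hlaw
    refine (Measurable.aestronglyMeasurable ?_)
    refine Measurable.div_const ?_ _
    exact Finset.measurable_sum _ fun i _ => hf.comp (measurable_pi_apply i)
  have := hm (ENNReal.ofReal ε) (by simpa using hε)
  refine this.congr fun w => ?_
  -- The averages involve only the first w coordinates, so the strong law on one infinite product
  -- passes to all the finite products.
  have hr : Q.map (fun e : ℕ → E => fun i : Fin w => e i) = Measure.pi (fun _ : Fin w => μ) := by
    rw [← Measure.infinitePi_eq_pi]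
    exact Measure.map_infinitePi_infinitePi_of_inj (P := fun _ : ℕ => μ) Fin.val_injective
  rw [← hr, Measure.map_apply (by fun_prop)]
  · congr 1
    ext e
    simp only [Set.mem_ofPred_eq, Set.mem_preimage, edist_dist, Real.dist_eq]
    rw [ENNReal.ofReal_le_ofReal_iff (abs_nonneg _), div_eq_inv_mul, ← Finset.sum_range (fun i => f (e i))]
  · refine measurableSet_le measurable_const ?_
    refine Measurable.abs (Measurable.sub_const ?_ _)
    refine Measurable.const_mul ?_ _
    exact Finset.measurable_sum _ fun i _ => hf.comp (measurable_pi_apply i)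

/-! ### Correlated Gaussian pairs -/

/-- The standard Gaussian measure on the plane. -/
def stdG2 : Measure (ℝ × ℝ) := (gaussianReal 0 1).prod (gaussianReal 0 1)

instance : IsProbabilityMeasure stdG2 := by unfold stdG2; infer_instance

/-- A lower triangular linear map of the plane. -/
def tri (a b c : ℝ) (z : ℝ × ℝ) : ℝ × ℝ := (a * z.1, b * z.1 + c * z.2)

@[fun_prop]
lemma measurable_tri (a b c : ℝ) : Measurable (tri a b c) := by unfold tri; fun_prop

/-- The law of a standard Gaussian pair with correlation `ρ`. -/
def corrG (ρ : ℝ) : Measure (ℝ × ℝ) := stdG2.map (tri 1 ρ (Real.sqrt (1 - ρ ^ 2)))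

instance (ρ : ℝ) : IsProbabilityMeasure (corrG ρ) :=
  Measure.isProbabilityMeasure_map (by fun_prop)

lemma integral_cexp_gaussian (t : ℝ) :
    ∫ x, Complex.exp (t * x * Complex.I) ∂(gaussianReal 0 1) = Complex.exp (-(t : ℂ) ^ 2 / 2) := by
  have := charFun_gaussianReal (μ := 0) (v := 1) t
  rw [charFun_apply_real] at this
  rw [this]
  congr 1
  simp
  ring

/-- A linear image in the plane of a standard Gaussian vector depends only on the Gram matrix. -/
lemma map_pi_gaussian_pair {ι : Type*} [Fintype ι] (p q : ι → ℝ) {a b c : ℝ}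
    (h1 : a ^ 2 = ∑ i, p i ^ 2) (h2 : a * b = ∑ i, p i * q i)
    (h3 : b ^ 2 + c ^ 2 = ∑ i, q i ^ 2) :
    (Measure.pi fun _ : ι => gaussianReal 0 1).map
      (fun r => (∑ i, p i * r i, ∑ i, q i * r i)) = stdG2.map (tri a b c) := by
  have hm : Measurable (fun r : ι → ℝ => (∑ i, p i * r i, ∑ i, q i * r i)) := by fun_prop
  have := Measure.isProbabilityMeasure_map (μ := Measure.pi fun _ : ι => gaussianReal 0 1)
    hm.aemeasurable
  have := Measure.isProbabilityMeasure_map (μ := stdG2) (measurable_tri a b c).aemeasurable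
  apply Measure.ext_of_charFunDual
  ext L
  set s := L (1, 0) with hs
  set t := L (0, 1) with ht
  have hL : ∀ z : ℝ × ℝ, L z = s * z.1 + t * z.2 := fun z => by
    have : z = z.1 • ((1 : ℝ), (0 : ℝ)) + z.2 • ((0 : ℝ), (1 : ℝ)) := by ext <;> simp
    conv_lhs => rw [this, map_add, map_smul, map_smul]
    simp [hs, ht]; ring
  rw [charFunDual_apply, charFunDual_apply, integral_map hm.aemeasurable
    (Measurable.aestronglyMeasurable (by fun_prop)),
    integral_map (measurable_tri a b c).aemeasurable
    (Measurable.aestronglyMeasurable (by fun_prop))]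
  have e1 : ∀ r : ι → ℝ, Complex.exp ((L (∑ i, p i * r i, ∑ i, q i * r i) : ℝ) * Complex.I)
      = ∏ i, Complex.exp (((s * p i + t * q i : ℝ) : ℂ) * (r i : ℝ) * Complex.I) := fun r => by
    rw [hL, ← Complex.exp_sum, ← Finset.sum_mul]
    congr 2
    push_cast
    simp only [Finset.mul_sum, ← Finset.sum_add_distrib]
    exact Finset.sum_congr rfl fun i _ => by ring
  have e2 : ∀ z : ℝ × ℝ, Complex.exp ((L (tri a b c z) : ℝ) * Complex.I)
      = Complex.exp (((s * a + t * b : ℝ) : ℂ) * (z.1 : ℝ) * Complex.I) *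
        Complex.exp (((t * c : ℝ) : ℂ) * (z.2 : ℝ) * Complex.I) := fun z => by
    rw [hL, ← Complex.exp_add]
    congr 1
    simp only [tri]
    push_cast
    ring
  simp_rw [e1, e2]
  rw [integral_fintype_prod_eq_prod (f := fun i (x : ℝ) =>
    Complex.exp (((s * p i + t * q i : ℝ) : ℂ) * (x : ℝ) * Complex.I)), stdG2,
    integral_prod_mul (fun x : ℝ => Complex.exp (((s * a + t * b : ℝ) : ℂ) * (x : ℝ) * Complex.I))
      (fun x : ℝ => Complex.exp (((t * c : ℝ) : ℂ) * (x : ℝ) * Complex.I))]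
  simp_rw [integral_cexp_gaussian]
  rw [← Complex.exp_sum, ← Complex.exp_add]
  congr 1
  norm_cast
  -- The characteristic functional sees `p` and `q` only through the three entries of their Gram
  -- matrix.
  have : ∑ i, -(s * p i + t * q i) ^ 2 / 2
      = -(s ^ 2 * ∑ i, p i ^ 2 + 2 * s * t * ∑ i, p i * q i + t ^ 2 * ∑ i, q i ^ 2) / 2 := by
    simp only [Finset.mul_sum, ← Finset.sum_add_distrib, ← Finset.sum_neg_distrib,
      ← Finset.sum_div]
    congr 1
    exact Finset.sum_congr rfl fun i _ => by ring
  rw [this, ← h1, ← h2, ← h3]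
  ring

lemma sq_sqrt_one_sub {ρ : ℝ} (hρ : |ρ| ≤ 1) : Real.sqrt (1 - ρ ^ 2) ^ 2 = 1 - ρ ^ 2 :=
  Real.sq_sqrt (by nlinarith [(sq_le_one_iff_abs_le_one ρ).2 hρ])

lemma map_pi_gaussian_corrG {ι : Type*} [Fintype ι] (p q : ι → ℝ) {ρ : ℝ} (hρ : |ρ| ≤ 1)
    (h1 : ∑ i, p i ^ 2 = 1) (h2 : ∑ i, p i * q i = ρ) (h3 : ∑ i, q i ^ 2 = 1) :
    (Measure.pi fun _ : ι => gaussianReal 0 1).map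
      (fun r => (∑ i, p i * r i, ∑ i, q i * r i)) = corrG ρ :=
  map_pi_gaussian_pair p q (by rw [h1]; norm_num) (by rw [h2, one_mul])
    (by rw [h3, sq_sqrt_one_sub hρ]; ring)

lemma corrG_fst (ρ : ℝ) : MeasurePreserving Prod.fst (corrG ρ) (gaussianReal 0 1) := by
  refine ⟨measurable_fst, ?_⟩
  rw [corrG, Measure.map_map measurable_fst (by fun_prop)]
  have : Prod.fst ∘ tri 1 ρ (Real.sqrt (1 - ρ ^ 2)) = Prod.fst := by ext z; simp [tri]
  rw [this, stdG2]
  exact measurePreserving_fst.map_eq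

/-- The second coordinate is a linear form of unit norm; pairing it with the zero form lets
`map_pi_gaussian_pair` identify its law. -/
lemma corrG_snd {ρ : ℝ} (hρ : |ρ| ≤ 1) :
    MeasurePreserving Prod.snd (corrG ρ) (gaussianReal 0 1) := by
  refine ⟨measurable_snd, ?_⟩
  rw [corrG, Measure.map_map measurable_snd (by fun_prop)]
  have h : stdG2 = (Measure.pi fun _ : Fin 2 => gaussianReal 0 1).map
      (fun r => (r 0, r 1)) := by
    have := map_pi_gaussian_pair (ι := Fin 2) (p := ![1, 0]) (q := ![0, 1])
      (a := 1) (b := 0) (c := 1) (by simp) (by simp) (by simp)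
    simp only [Fin.sum_univ_two] at this
    have ht : tri 1 0 1 = id := by ext z <;> simp [tri]
    rw [ht, Measure.map_id] at this
    rw [← this]
    simp
  have h2 := map_pi_gaussian_pair (ι := Fin 2) (p := ![ρ, Real.sqrt (1 - ρ ^ 2)])
    (q := ![0, 0]) (a := 1) (b := 0) (c := 0)
    (by simp [sq_sqrt_one_sub hρ]) (by simp) (by simp)
  have h3 := congrArg (Measure.map Prod.fst) h2
  rw [Measure.map_map measurable_fst (by fun_prop), Measure.map_map measurable_fst (by fun_prop)]
    at h3
  rw [h, Measure.map_map (by fun_prop) (by fun_prop)]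
  have e3 : ((Prod.snd ∘ tri 1 ρ √(1 - ρ ^ 2)) ∘ fun r : Fin 2 → ℝ => (r 0, r 1)) =
      Prod.fst ∘ fun r : Fin 2 → ℝ => (∑ i, ![ρ, √(1 - ρ ^ 2)] i * r i, ∑ i, ![0, 0] i * r i) := by
    ext r; simp [tri]
  rw [e3, h3]
  have e4 : Prod.fst ∘ tri 1 0 0 = Prod.fst := by ext z; simp [tri]
  rw [e4, stdG2]
  exact measurePreserving_fst.map_eq

/-! ### Continuity of Gaussian pairs in total variation -/

/-- Pointwise convergence of probability densities implies convergence in total variation. -/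
lemma eventually_tvLe_withDensity {α ι : Type*} [MeasurableSpace α] {μ : Measure α}
    {l : Filter ι} [l.IsCountablyGenerated] {f : ι → α → ℝ≥0∞} {g : α → ℝ≥0∞}
    (hf : ∀ i, Measurable (f i)) (hg : Measurable g)
    (hf1 : ∀ᶠ i in l, ∫⁻ x, f i x ∂μ = 1) (hg1 : ∫⁻ x, g x ∂μ = 1) (hgt : ∀ x, g x ≠ ∞)
    (hlim : ∀ x, Tendsto (fun i => f i x) l (𝓝 (g x))) {δ : ℝ≥0∞} (hδ : δ ≠ 0) :
    ∀ᶠ i in l, TVLe δ (μ.withDensity (f i)) (μ.withDensity g) := by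
  -- Scheffé's argument: the truncated difference is dominated by `g`, so no domination of the `f i`
  -- is needed.
  have h0 : Tendsto (fun i => ∫⁻ x, (g x - f i x) ∂μ) l (𝓝 (∫⁻ _, 0 ∂μ)) := by
    refine tendsto_lintegral_filter_of_dominated_convergence g
      (Eventually.of_forall fun i => hg.sub (hf i))
      (Eventually.of_forall fun i => Eventually.of_forall fun x => tsub_le_self)
      (by rw [hg1]; exact ENNReal.one_ne_top) (Eventually.of_forall fun x => ?_)
    have := ENNReal.Tendsto.sub (tendsto_const_nhds (x := g x)) (hlim x) (Or.inl (hgt x))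
    simpa using this
  rw [lintegral_zero] at h0
  filter_upwards [hf1, (ENNReal.tendsto_nhds_zero.1 h0) δ (pos_iff_ne_zero.2 hδ)] with i hi1 hi2 B hB
  have hp1 : IsProbabilityMeasure (μ.withDensity (f i)) :=
    ⟨by rw [withDensity_apply _ MeasurableSet.univ, setLIntegral_univ, hi1]⟩
  have hp2 : IsProbabilityMeasure (μ.withDensity g) :=
    ⟨by rw [withDensity_apply _ MeasurableSet.univ, setLIntegral_univ, hg1]⟩
  -- This bounds `g` by `f i`, the opposite of the goal; applied to the complement and combined with
  -- equal total mass it gives the wanted direction.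
  have hc : μ.withDensity g Bᶜ ≤ μ.withDensity (f i) Bᶜ + δ := by
    rw [withDensity_apply _ hB.compl, withDensity_apply _ hB.compl]
    calc ∫⁻ x in Bᶜ, g x ∂μ ≤ ∫⁻ x in Bᶜ, (f i x + (g x - f i x)) ∂μ :=
          lintegral_mono fun x => le_add_tsub
      _ = ∫⁻ x in Bᶜ, f i x ∂μ + ∫⁻ x in Bᶜ, (g x - f i x) ∂μ := lintegral_add_left (hf i) _
      _ ≤ _ := by gcongr; exact (setLIntegral_le_lintegral _ _).trans hi2
  have e1 := prob_add_prob_compl (μ := μ.withDensity (f i)) hB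
  have e2 := prob_add_prob_compl (μ := μ.withDensity g) hB
  have : μ.withDensity (f i) Bᶜ + μ.withDensity (f i) B ≤
      μ.withDensity (f i) Bᶜ + (μ.withDensity g B + δ) := by
    calc _ = μ.withDensity g B + μ.withDensity g Bᶜ := by rw [add_comm, e1, e2]
      _ ≤ μ.withDensity g B + (μ.withDensity (f i) Bᶜ + δ) := by gcongr
      _ = _ := by ring
  exact (ENNReal.add_le_add_iff_left (measure_ne_top _ _)).1 this

/-- The density of the image of the standard Gaussian measure under `tri a b c`. -/
def triPDF (s : ℝ × ℝ × ℝ) (z : ℝ × ℝ) : ℝ≥0∞ :=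
  gaussianPDF 0 (.mk (s.1 ^ 2) (sq_nonneg _)) z.1 *
    gaussianPDF (s.2.1 / s.1 * z.1) (.mk (s.2.2 ^ 2) (sq_nonneg _)) z.2

lemma measurable_triPDF (s : ℝ × ℝ × ℝ) : Measurable (triPDF s) := by
  unfold triPDF
  refine ((measurable_gaussianPDF _ _).comp measurable_fst).mul ?_
  have := measurable_uncurry_gaussianPDF.comp (f := fun z : ℝ × ℝ =>
    (s.2.1 / s.1 * z.1, (NNReal.mk (s.2.2 ^ 2) (sq_nonneg _)), z.2)) (by fun_prop)
  exact this

lemma map_tri_stdG2 {a b c : ℝ} (ha : a ≠ 0) (hc : c ≠ 0) :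
    stdG2.map (tri a b c) = (volume : Measure (ℝ × ℝ)).withDensity (triPDF (a, b, c)) := by
  have hva : NNReal.mk (a ^ 2) (sq_nonneg _) ≠ 0 := by
    intro h; exact ha (by simpa using congrArg NNReal.toReal h)
  have hvc : NNReal.mk (c ^ 2) (sq_nonneg _) ≠ 0 := by
    intro h; exact hc (by simpa using congrArg NNReal.toReal h)
  ext B hB
  have hmk : Measurable fun x => ∫⁻ y, B.indicator 1 (x, y) *
      gaussianPDF (b / a * x) (.mk (c ^ 2) (sq_nonneg _)) y := by
    refine Measurable.lintegral_prod_right ?_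
    refine ((measurable_one.indicator hB)).mul ?_
    have := measurable_uncurry_gaussianPDF.comp (f := fun z : ℝ × ℝ =>
      (b / a * z.1, (NNReal.mk (c ^ 2) (sq_nonneg _)), z.2)) (by fun_prop)
    exact this
  -- Given the first coordinate, the second is Gaussian with mean b x. The mean is written as (b /
  -- a)(a x) so that the expression depends on x only through a x, which permits the change of
  -- variables.
  have hin : ∀ x : ℝ, gaussianReal 0 1 (Prod.mk x ⁻¹' (tri a b c ⁻¹' B)) =
      ∫⁻ y, B.indicator 1 (a * x, y) *
        gaussianPDF (b / a * (a * x)) (.mk (c ^ 2) (sq_nonneg _)) y := fun x => by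
    have h1 := gaussianReal_map_const_mul (μ := 0) (v := 1) c
    have h2 := gaussianReal_map_const_add (μ := c * 0) (v := .mk (c ^ 2) (sq_nonneg _) * 1) (b * x)
    rw [← h1, Measure.map_map (by fun_prop) (by fun_prop)] at h2
    have hB' : MeasurableSet {y | (a * x, y) ∈ B} := measurable_prodMk_left hB
    have h3 : gaussianReal 0 1 (Prod.mk x ⁻¹' (tri a b c ⁻¹' B)) =
        gaussianReal (b * x) (.mk (c ^ 2) (sq_nonneg _)) {y | (a * x, y) ∈ B} := by
      have := congrArg (fun m => m {y | (a * x, y) ∈ B}) h2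
      rw [Measure.map_apply (by fun_prop) hB'] at this
      rw [mul_zero, zero_add, mul_one] at this
      exact this
    rw [h3, gaussianReal_apply _ hvc, ← lintegral_indicator hB']
    refine lintegral_congr fun y => ?_
    have hx : b / a * (a * x) = b * x := by field_simp
    rw [hx]
    by_cases hy : (a * x, y) ∈ B <;> simp [Set.indicator, hy]
  rw [Measure.map_apply (by fun_prop) hB, stdG2,
    Measure.prod_apply (measurable_tri a b c hB), withDensity_apply _ hB]
  simp_rw [hin]
  rw [← lintegral_map (μ := gaussianReal 0 1) (g := fun x => a * x) hmk (by fun_prop),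
    gaussianReal_map_const_mul, mul_zero, mul_one, gaussianReal_of_var_ne_zero _ hva,
    lintegral_withDensity_eq_lintegral_mul _ (measurable_gaussianPDF _ _) hmk,
    ← lintegral_indicator hB, Measure.volume_eq_prod,
    lintegral_prod _ ((measurable_triPDF _).indicator hB).aemeasurable]
  refine lintegral_congr fun x => ?_
  rw [Pi.mul_apply, ← lintegral_const_mul']
  · refine lintegral_congr fun y => ?_
    by_cases hy : (x, y) ∈ B <;> simp [Set.indicator, hy, triPDF]
  · exact gaussianPDF_ne_top

lemma tendsto_triPDF (z : ℝ × ℝ) :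
    Tendsto (fun s => triPDF s z) (𝓝 (1, 0, 1)) (𝓝 (triPDF (1, 0, 1) z)) := by
  have h1 : ContinuousAt (fun s : ℝ × ℝ × ℝ =>
      gaussianPDF 0 (.mk (s.1 ^ 2) (sq_nonneg _)) z.1) (1, 0, 1) := by
    unfold gaussianPDF gaussianPDFReal
    refine ENNReal.continuous_ofReal.continuousAt.comp ?_
    simp only [NNReal.coe_mk]
    refine ContinuousAt.mul (ContinuousAt.inv₀ (by fun_prop) ?_)
      (Real.continuous_exp.continuousAt.comp (ContinuousAt.div (by fun_prop) (by fun_prop) ?_))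
    · simpa using (Real.sqrt_pos.2 Real.pi_pos).ne'
    · simp
  have h2 : ContinuousAt (fun s : ℝ × ℝ × ℝ =>
      gaussianPDF (s.2.1 / s.1 * z.1) (.mk (s.2.2 ^ 2) (sq_nonneg _)) z.2) (1, 0, 1) := by
    unfold gaussianPDF gaussianPDFReal
    refine ENNReal.continuous_ofReal.continuousAt.comp ?_
    simp only [NNReal.coe_mk]
    have h3 : ContinuousAt (fun s : ℝ × ℝ × ℝ => s.2.1 / s.1) (1, 0, 1) :=
      ContinuousAt.div (by fun_prop) (by fun_prop) (by simp)
    refine ContinuousAt.mul (ContinuousAt.inv₀ (by fun_prop) ?_)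
      (Real.continuous_exp.continuousAt.comp (ContinuousAt.div (by fun_prop) (by fun_prop) ?_))
    · simpa using (Real.sqrt_pos.2 Real.pi_pos).ne'
    · simp
  exact ENNReal.Tendsto.mul h1 (Or.inr gaussianPDF_ne_top) h2 (Or.inr gaussianPDF_ne_top)

lemma eventually_tvLe_tri {δ : ℝ≥0∞} (hδ : δ ≠ 0) :
    ∀ᶠ s : ℝ × ℝ × ℝ in 𝓝 (1, 0, 1), TVLe δ (stdG2.map (tri s.1 s.2.1 s.2.2)) stdG2 := by
  have hone : ∀ s : ℝ × ℝ × ℝ, s.1 ≠ 0 → s.2.2 ≠ 0 → ∫⁻ z, triPDF s z = 1 := fun s h1 h2 => by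
    have := congrArg (fun m => m Set.univ) (map_tri_stdG2 (b := s.2.1) h1 h2)
    rw [withDensity_apply _ MeasurableSet.univ, setLIntegral_univ,
      Measure.map_apply (by fun_prop) MeasurableSet.univ] at this
    simpa using this.symm
  have hne : ∀ᶠ s : ℝ × ℝ × ℝ in 𝓝 (1, 0, 1), s.1 ≠ 0 ∧ s.2.2 ≠ 0 :=
    (ContinuousAt.eventually_ne (by fun_prop) (by simp)).and
      (ContinuousAt.eventually_ne (by fun_prop) (by simp))
  have h := eventually_tvLe_withDensity (μ := (volume : Measure (ℝ × ℝ)))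
    (l := 𝓝 ((1, 0, 1) : ℝ × ℝ × ℝ)) measurable_triPDF
    (measurable_triPDF (1, 0, 1)) (hne.mono fun s hs => hone s hs.1 hs.2)
    (hone _ (by simp) (by simp))
    (fun z => ENNReal.mul_ne_top gaussianPDF_ne_top gaussianPDF_ne_top) tendsto_triPDF hδ
  have hid : stdG2 = (volume : Measure (ℝ × ℝ)).withDensity (triPDF (1, 0, 1)) := by
    rw [← map_tri_stdG2 one_ne_zero one_ne_zero]
    have ht : tri 1 0 1 = id := by ext z <;> simp [tri]
    rw [ht, Measure.map_id]
  filter_upwards [h, hne] with s hs hs2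
  rw [map_tri_stdG2 hs2.1 hs2.2, hid]
  exact hs

/-- If the Gram matrix is close to the correlation matrix (and exactly proportional to it in the
degenerate case), then the law of the Gaussian pair is close to `corrG ρ`. -/
lemma exists_gram_tvLe {ρ : ℝ} (hρ : |ρ| ≤ 1) (M : ℕ) {δ : ℝ≥0∞} (hδ : δ ≠ 0) :
    ∃ η > 0, ∀ {ι : Type} [Fintype ι] (p q : ι → ℝ), |∑ i, p i ^ 2 - 1| < η →
      |∑ i, p i * q i - ρ| < η → |∑ i, q i ^ 2 - 1| < η →
      (ρ ^ 2 = 1 → ∑ i, p i * q i = ρ * ∑ i, p i ^ 2 ∧ ∑ i, q i ^ 2 = ∑ i, p i ^ 2) →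
      TVLe δ (Measure.pi fun _ : Fin M => (Measure.pi fun _ : ι => gaussianReal 0 1).map
        fun r => (∑ i, p i * r i, ∑ i, q i * r i)) (Measure.pi fun _ : Fin M => corrG ρ) := by
  -- Each of the M coordinates may cost δ'; M + 1 avoids division by zero when M = 0.
  set δ' := δ / (M + 1) with hδ'
  have hδ0 : δ' ≠ 0 := by
    rw [hδ']; exact (ENNReal.div_pos hδ (by finiteness)).ne'
  have hδle : M * δ' ≤ δ := by
    calc M * δ' ≤ (M + 1) * δ' := by gcongr; exact le_self_add
      _ ≤ δ := ENNReal.mul_div_le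
  set τ := Real.sqrt (1 - ρ ^ 2) with hτ
  have hτ2 : τ ^ 2 = 1 - ρ ^ 2 := sq_sqrt_one_sub hρ
  have hev := eventually_tvLe_tri hδ0
  -- The nearby law is factored as the fixed map `tri 1 ρ τ` after a perturbation `tri α β κ` near
  -- the identity. Only the perturbation must be close to `stdG2`, since pushing forward by a fixed
  -- map does not increase the distance; this covers τ = 0 as well.
  suffices H : ∀ᶠ S : ℝ × ℝ × ℝ in 𝓝 (1, ρ, 1), (ρ ^ 2 = 1 → S.2.1 = ρ * S.1 ∧ S.2.2 = S.1) →
      ∃ α β κ, TVLe δ' (stdG2.map (tri α β κ)) stdG2 ∧ α ^ 2 = S.1 ∧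
        α * (ρ * α + τ * β) = S.2.1 ∧ (ρ * α + τ * β) ^ 2 + (τ * κ) ^ 2 = S.2.2 by
    obtain ⟨η, hη, H⟩ := Metric.eventually_nhds_iff.1 H
    refine ⟨η, hη, fun {ι} _ p q h1 h2 h3 h4 => ?_⟩
    obtain ⟨α, β, κ, ht, e1, e2, e3⟩ := H (y := (∑ i, p i ^ 2, ∑ i, p i * q i, ∑ i, q i ^ 2))
      (by simp only [Prod.dist_eq, Real.dist_eq]; exact max_lt h1 (max_lt h2 h3)) h4
    refine TVLe.mono ?_ hδle
    have := Measure.isProbabilityMeasure_map (μ := Measure.pi fun _ : ι => gaussianReal 0 1)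
      (f := fun r => (∑ i, p i * r i, ∑ i, q i * r i)) (by fun_prop)
    refine TVLe.pi ?_ M
    rw [map_pi_gaussian_pair p q e1 e2 e3, corrG]
    have hcomp : tri α (ρ * α + τ * β) (τ * κ) = tri 1 ρ τ ∘ tri α β κ := by
      ext z <;> simp [tri]; ring
    rw [hcomp, ← Measure.map_map (by fun_prop) (by fun_prop)]
    exact ht.map (by fun_prop)
  have hsq : Tendsto (fun S : ℝ × ℝ × ℝ => √S.1) (𝓝 (1, ρ, 1)) (𝓝 1) := by
    have : ContinuousAt (fun S : ℝ × ℝ × ℝ => √S.1) (1, ρ, 1) := by fun_prop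
    simpa [ContinuousAt] using this
  have hpos : ∀ᶠ S : ℝ × ℝ × ℝ in 𝓝 (1, ρ, 1), 0 < S.1 :=
    continuousAt_const.eventually_lt (f := fun _ : ℝ × ℝ × ℝ => (0 : ℝ))
      (g := fun S : ℝ × ℝ × ℝ => S.1) (by fun_prop) (by simp)
  by_cases hdeg : ρ ^ 2 = 1
  · have hτ0 : τ = 0 := by rw [hτ, hdeg]; simp
    -- With τ = 0 the last two parameters do not affect the image and need only be near 0 and 1.
    have hlim : Tendsto (fun S : ℝ × ℝ × ℝ => (√S.1, (0 : ℝ), √S.1)) (𝓝 (1, ρ, 1))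
        (𝓝 (1, 0, 1)) := hsq.prodMk_nhds (tendsto_const_nhds.prodMk_nhds hsq)
    filter_upwards [hlim.eventually hev, hpos] with S hS hp hex
    refine ⟨_, _, _, hS, Real.sq_sqrt hp.le, ?_, ?_⟩
    · rw [(hex hdeg).1, hτ0]
      linear_combination ρ * Real.sq_sqrt hp.le
    · rw [(hex hdeg).2, hτ0]
      linear_combination √S.1 ^ 2 * hdeg + Real.sq_sqrt hp.le
  · have hlt : 0 < 1 - ρ ^ 2 := by
      have := (sq_le_one_iff_abs_le_one ρ).2 hρ
      rcases this.lt_or_eq with h | h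
      · linarith
      · exact absurd h hdeg
    have hτ0 : 0 < τ := Real.sqrt_pos.2 hlt
    have h0 : ContinuousAt (fun S : ℝ × ℝ × ℝ => S.2.1 / √S.1) (1, ρ, 1) :=
      ContinuousAt.div (by fun_prop) (by fun_prop) (by simp)
    have hb : Tendsto (fun S : ℝ × ℝ × ℝ => (S.2.1 / √S.1 - ρ * √S.1) / τ) (𝓝 (1, ρ, 1))
        (𝓝 0) := by
      have : ContinuousAt (fun S : ℝ × ℝ × ℝ => (S.2.1 / √S.1 - ρ * √S.1) / τ) (1, ρ, 1) := by
        fun_prop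
      simpa [ContinuousAt] using this
    have hc0 : Tendsto (fun S : ℝ × ℝ × ℝ => S.2.2 - (S.2.1 / √S.1) ^ 2) (𝓝 (1, ρ, 1))
        (𝓝 (1 - ρ ^ 2)) := by
      have : ContinuousAt (fun S : ℝ × ℝ × ℝ => S.2.2 - (S.2.1 / √S.1) ^ 2) (1, ρ, 1) := by
        fun_prop
      simpa [ContinuousAt] using this
    have hc : Tendsto (fun S : ℝ × ℝ × ℝ => √(S.2.2 - (S.2.1 / √S.1) ^ 2) / τ) (𝓝 (1, ρ, 1))
        (𝓝 1) := by
      have := (hc0.sqrt).div_const τ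
      rwa [← hτ, div_self hτ0.ne'] at this
    have hlim := hsq.prodMk_nhds (hb.prodMk_nhds hc)
    filter_upwards [hlim.eventually hev, hpos, hc0.eventually (lt_mem_nhds hlt)] with S hS hp hq _
    have hs := Real.sq_sqrt hp.le
    have hs0 : √S.1 ≠ 0 := (Real.sqrt_pos.2 hp).ne'
    have e : ρ * √S.1 + τ * ((S.2.1 / √S.1 - ρ * √S.1) / τ) = S.2.1 / √S.1 := by
      field_simp; ring
    refine ⟨_, _, _, hS, hs, ?_, ?_⟩
    · rw [e]; field_simp
    · rw [e, mul_div_cancel₀ _ hτ0.ne', Real.sq_sqrt hq.le]; ring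

/-! ### Hermite polynomials and Gaussian integration by parts -/

open Polynomial in
lemma derivative_hermite_succ (n : ℕ) :
    derivative (hermite (n + 1)) = (n + 1 : ℤ[X]) * hermite n := by
  induction n with
  | zero => simp
  | succ n ih =>
    rw [hermite_succ (n + 1), derivative_sub, derivative_mul, derivative_X, ih, derivative_mul]
    have : derivative ((n : ℤ[X]) + 1) = 0 := by simp
    rw [this, hermite_succ n]
    push_cast
    ring

/-- The probabilist's Hermite polynomial with real coefficients. -/
def hermiteR (n : ℕ) : Polynomial ℝ := (Polynomial.hermite n).map (algebraMap ℤ ℝ)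

lemma aeval_hermite (n : ℕ) (x : ℝ) :
    Polynomial.aeval x (Polynomial.hermite n) = (hermiteR n).eval x := by
  rw [hermiteR, Polynomial.eval_map_algebraMap]

open Polynomial in
lemma hermiteR_succ (n : ℕ) :
    hermiteR (n + 1) = X * hermiteR n - derivative (hermiteR n) := by
  simp [hermiteR, hermite_succ, Polynomial.derivative_map]

open Polynomial in
lemma derivative_hermiteR_succ (n : ℕ) :
    derivative (hermiteR (n + 1)) = C (n + 1 : ℝ) * hermiteR n := by
  rw [hermiteR, Polynomial.derivative_map, derivative_hermite_succ]
  simp [hermiteR]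

lemma hermiteR_zero : hermiteR 0 = 1 := by simp [hermiteR]

lemma memLp_eval_gaussian (p : Polynomial ℝ) :
    MemLp (fun x => p.eval x) 2 (gaussianReal 0 1) := by
  induction p using Polynomial.induction_on' with
  | add p q hp hq => simp only [Polynomial.eval_add]; exact hp.add hq
  | monomial n a =>
    simp only [Polynomial.eval_monomial]
    refine MemLp.const_mul ?_ a
    rw [memLp_two_iff_integrable_sq (by fun_prop)]
    rcases Nat.eq_zero_or_pos n with rfl | hn
    · simp
    have := (memLp_id_gaussianReal' (μ := 0) (v := 1) ((2 * n : ℕ) : ℝ≥0∞)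
      (by finiteness)).integrable_norm_pow (by omega)
    refine this.congr (Eventually.of_forall fun x => ?_)
    simp only [id, Real.norm_eq_abs, pow_mul, sq_abs]
    ring

lemma integrable_eval_gaussian (p : Polynomial ℝ) :
    Integrable (fun x => p.eval x) (gaussianReal 0 1) :=
  (memLp_eval_gaussian p).integrable (by norm_num)

/-- Gaussian integration by parts for polynomials. -/
lemma integral_mul_eval_gaussian (p : Polynomial ℝ) :
    ∫ x, x * p.eval x ∂(gaussianReal 0 1) = ∫ x, p.derivative.eval x ∂(gaussianReal 0 1) := by
  have hconv : ∀ q : Polynomial ℝ,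
      Integrable (fun x => gaussianPDFReal 0 1 x * q.eval x) := fun q => by
    have := integrable_eval_gaussian q
    rw [gaussianReal_of_var_ne_zero _ one_ne_zero, integrable_withDensity_iff
      (measurable_gaussianPDF _ _) (Eventually.of_forall fun x => gaussianPDF_lt_top)] at this
    refine this.congr (Eventually.of_forall fun x => ?_)
    simp only [toReal_gaussianPDF]
    ring
  have hd : ∀ x, HasDerivAt (fun x => gaussianPDFReal 0 1 x * p.eval x)
      (gaussianPDFReal 0 1 x * (p.derivative - Polynomial.X * p).eval x) x := fun x => by
    have h1 : HasDerivAt (gaussianPDFReal 0 1) (-x * gaussianPDFReal 0 1 x) x := by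
      unfold gaussianPDFReal
      have : HasDerivAt (fun y : ℝ => -(y - 0) ^ 2 / (2 * ((1 : NNReal) : ℝ))) (-x) x := by
        have := ((((hasDerivAt_id x).sub_const 0).pow 2).neg).div_const (2 * ((1 : NNReal) : ℝ))
        refine this.congr_deriv ?_
        simp
        ring
      refine ((this.exp).const_mul (√(2 * Real.pi * (1 : NNReal)))⁻¹).congr_deriv ?_
      ring
    refine (h1.mul (p.hasDerivAt x)).congr_deriv ?_
    simp only [Polynomial.eval_sub, Polynomial.eval_mul, Polynomial.eval_X]
    ring
  have h0 := integral_eq_zero_of_hasDerivAt_of_integrable hd (hconv _) (hconv _)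
  have h1 : ∫ x, (p.derivative - Polynomial.X * p).eval x ∂(gaussianReal 0 1) = 0 := by
    rw [integral_gaussianReal_eq_integral_smul one_ne_zero]
    simpa only [smul_eq_mul] using h0
  simp only [Polynomial.eval_sub] at h1
  rw [integral_sub (integrable_eval_gaussian _) (integrable_eval_gaussian _)] at h1
  simp only [Polynomial.eval_mul, Polynomial.eval_X] at h1
  linarith

section Correlated

variable {ρ : ℝ} (hρ : |ρ| ≤ 1)

lemma MeasureTheory.MemLp.comp_corrG_fst {f : ℝ → ℝ} (hf : MemLp f 2 (gaussianReal 0 1)) :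
    MemLp (fun z : ℝ × ℝ => f z.1) 2 (corrG ρ) :=
  hf.comp_measurePreserving (corrG_fst ρ)

include hρ in
lemma MeasureTheory.MemLp.comp_corrG_snd {f : ℝ → ℝ} (hf : MemLp f 2 (gaussianReal 0 1)) :
    MemLp (fun z : ℝ × ℝ => f z.2) 2 (corrG ρ) :=
  hf.comp_measurePreserving (corrG_snd hρ)

end Correlated

lemma integrable_mul_corrG {ρ : ℝ} (hρ : |ρ| ≤ 1) {f g : ℝ → ℝ}
    (hf : MemLp f 2 (gaussianReal 0 1)) (hg : MemLp g 2 (gaussianReal 0 1)) :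
    Integrable (fun z : ℝ × ℝ => f z.1 * g z.2) (corrG ρ) :=
  (hf.comp_corrG_fst).integrable_mul (hg.comp_corrG_snd hρ)

/-- Integration by parts for a pair of correlated Gaussians. -/
lemma integral_corrG_mul {ρ : ℝ} (hρ : |ρ| ≤ 1) (p q : Polynomial ℝ) :
    ∫ z, z.1 * p.eval z.1 * q.eval z.2 ∂(corrG ρ) =
      ∫ z, p.derivative.eval z.1 * q.eval z.2 ∂(corrG ρ) +
        ρ * ∫ z, p.eval z.1 * q.derivative.eval z.2 ∂(corrG ρ) := by
  set τ := √(1 - ρ ^ 2) with hτ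
  have hI : ∀ p q : Polynomial ℝ,
      Integrable (fun z : ℝ × ℝ => p.eval z.1 * q.eval (ρ * z.1 + τ * z.2)) stdG2 := fun p q => by
    have := integrable_mul_corrG hρ (memLp_eval_gaussian p) (memLp_eval_gaussian q)
    rw [corrG, integrable_map_measure (by fun_prop) (by fun_prop)] at this
    simpa [Function.comp_def, tri] using this
  have hE : ∀ p q : Polynomial ℝ, ∫ z, p.eval z.1 * q.eval z.2 ∂(corrG ρ) =
      ∫ y, ∫ x, (p * q.comp (Polynomial.C ρ * Polynomial.X + Polynomial.C (τ * y))).eval x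
        ∂(gaussianReal 0 1) ∂(gaussianReal 0 1) := fun p q => by
    rw [corrG, integral_map (by fun_prop) (by fun_prop)]
    have := hI p q
    unfold stdG2 at this ⊢
    simp only [tri, one_mul, ← hτ]
    rw [integral_prod_symm _ this]
    simp [Polynomial.eval_comp]
  have hIy : ∀ p q : Polynomial ℝ, Integrable (fun y => ∫ x,
      (p * q.comp (Polynomial.C ρ * Polynomial.X + Polynomial.C (τ * y))).eval x
        ∂(gaussianReal 0 1)) (gaussianReal 0 1) := fun p q => by
    have := hI p q
    unfold stdG2 at this
    have := this.integral_prod_right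
    simpa [Polynomial.eval_comp] using this
  have e1 : ∫ z, z.1 * p.eval z.1 * q.eval z.2 ∂(corrG ρ) =
      ∫ z, (Polynomial.X * p).eval z.1 * q.eval z.2 ∂(corrG ρ) := by simp
  rw [e1, hE, hE, hE, ← integral_const_mul, ← integral_add (hIy _ _) ((hIy _ _).const_mul ρ)]
  refine integral_congr_ae (Eventually.of_forall fun y => ?_)
  simp only
  -- For fixed y the integrand is a polynomial in x, so the one-dimensional formula applies; the
  -- chain rule on q(ρx + τy) produces the factor ρ.
  have := integral_mul_eval_gaussian
    (p * q.comp (Polynomial.C ρ * Polynomial.X + Polynomial.C (τ * y)))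
  rw [← integral_const_mul, ← integral_add (integrable_eval_gaussian _)
    ((integrable_eval_gaussian _).const_mul ρ)]
  convert this using 3
  · simp; ring
  · simp [Polynomial.derivative_comp]; ring

/-- Since He_{j+1} = x He_j − He_j', integration by parts cancels the derivative of the first factor
and moves one derivative onto He_k, at the price of ρ. Iterating lowers both degrees together. -/
lemma integral_hermite_corrG {ρ : ℝ} (hρ : |ρ| ≤ 1) (j k : ℕ) :
    ∫ z, (hermiteR j).eval z.1 * (hermiteR k).eval z.2 ∂(corrG ρ) =
      if j = k then (k.factorial : ℝ) * ρ ^ k else 0 := by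
  have hI : ∀ p q : Polynomial ℝ,
      Integrable (fun z : ℝ × ℝ => p.eval z.1 * q.eval z.2) (corrG ρ) := fun p q =>
    integrable_mul_corrG hρ (memLp_eval_gaussian p) (memLp_eval_gaussian q)
  have step : ∀ j k : ℕ, ∫ z, (hermiteR (j + 1)).eval z.1 * (hermiteR k).eval z.2 ∂(corrG ρ) =
      ρ * ∫ z, (hermiteR j).eval z.1 * (hermiteR k).derivative.eval z.2 ∂(corrG ρ) := by
    intro j k
    have h1 := integral_corrG_mul hρ (hermiteR j) (hermiteR k)
    have h2 : ∫ z, (hermiteR (j + 1)).eval z.1 * (hermiteR k).eval z.2 ∂(corrG ρ) =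
        ∫ z, (Polynomial.X * hermiteR j).eval z.1 * (hermiteR k).eval z.2 ∂(corrG ρ) -
        ∫ z, (hermiteR j).derivative.eval z.1 * (hermiteR k).eval z.2 ∂(corrG ρ) := by
      rw [← integral_sub (hI _ _) (hI _ _)]
      simp only [hermiteR_succ, Polynomial.eval_sub, sub_mul]
    simp only [Polynomial.eval_mul, Polynomial.eval_X] at h2
    linarith
  have hzero : ∀ k : ℕ, ∫ z, (hermiteR (k + 1)).eval z.2 ∂(corrG ρ) = 0 := fun k => by
    have h3 : ∫ z : ℝ × ℝ, (hermiteR (k + 1)).eval z.2 ∂(corrG ρ) =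
        ∫ x, (hermiteR (k + 1)).eval x ∂(gaussianReal 0 1) := by
      rw [← (corrG_snd hρ).map_eq, integral_map (by fun_prop) (by fun_prop)]
    rw [h3]
    have h4 := integral_mul_eval_gaussian (hermiteR k)
    simp only [hermiteR_succ, Polynomial.eval_sub]
    rw [integral_sub (integrable_eval_gaussian _) (integrable_eval_gaussian _)]
    simp only [Polynomial.eval_mul, Polynomial.eval_X]
    linarith
  induction j generalizing k with
  | zero =>
    rcases k with _ | k
    · simp [hermiteR_zero]
    · simp [hermiteR_zero, hzero k]
  | succ j ih =>
    rw [step]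
    rcases k with _ | k
    · simp [hermiteR_zero]
    · simp only [derivative_hermiteR_succ, Polynomial.eval_mul, Polynomial.eval_C]
      have e : ∀ z : ℝ × ℝ, (hermiteR j).eval z.1 * ((k + 1 : ℝ) * (hermiteR k).eval z.2) =
        (k + 1 : ℝ) * ((hermiteR j).eval z.1 * (hermiteR k).eval z.2) := fun z => by ring
      simp_rw [e]
      rw [integral_const_mul, ih]
      by_cases h : j = k
      · simp [h, Nat.factorial_succ]; ring
      · simp [h]

lemma corrG_one_ae : ∀ᵐ z ∂(corrG 1), z.2 = z.1 := by
  rw [corrG, ae_map_iff (by fun_prop) (measurableSet_eq_fun measurable_snd measurable_fst)]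
  exact Eventually.of_forall fun z => by simp [tri]

lemma integral_mul_hermiteR (j k : ℕ) :
    ∫ x, (hermiteR j).eval x * (hermiteR k).eval x ∂(gaussianReal 0 1) =
      if j = k then (k.factorial : ℝ) else 0 := by
  have h := integral_hermite_corrG (ρ := 1) (by simp) j k
  rw [one_pow, mul_one] at h
  rw [← h, ← (corrG_fst 1).map_eq, integral_map (by fun_prop) (by fun_prop)]
  refine integral_congr_ae (corrG_one_ae.mono fun z hz => ?_)
  simp only [hz]

/-! ### Completeness of the Hermite polynomials and Mehler's formula -/

/-- A square integrable function orthogonal to all monomials vanishes. -/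
lemma ae_eq_zero_of_integral_mul_pow {f : ℝ → ℝ} (hf : MemLp f 2 (gaussianReal 0 1))
    (h : ∀ n : ℕ, ∫ x, f x * x ^ n ∂(gaussianReal 0 1) = 0) : f =ᵐ[gaussianReal 0 1] 0 := by
  have hfi : Integrable f (gaussianReal 0 1) := hf.integrable (by norm_num)
  have hexp : ∀ t : ℝ, Integrable (fun x => |f x| * Real.exp |t * x|) (gaussianReal 0 1) := by
    intro t
    have h2 : MemLp (fun x : ℝ => Real.exp |t * x|) 2 (gaussianReal 0 1) := by
      rw [memLp_two_iff_integrable_sq (by fun_prop)]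
      refine Integrable.mono' ((integrable_exp_mul_gaussianReal (μ := 0) (v := 1) (2 * t)).add
        (integrable_exp_mul_gaussianReal (μ := 0) (v := 1) (-(2 * t)))) (by fun_prop)
        (Eventually.of_forall fun x => ?_)
      rw [Real.norm_of_nonneg (by positivity), ← Real.exp_nat_mul]
      simp only [Pi.add_apply]
      rcases abs_cases (t * x) with ⟨hc, _⟩ | ⟨hc, _⟩ <;> rw [hc]
      · have : ((2 : ℕ) : ℝ) * (t * x) = 2 * t * x := by push_cast; ring
        rw [this]; linarith [Real.exp_pos (-(2 * t) * x)]
      · have : ((2 : ℕ) : ℝ) * (-(t * x)) = -(2 * t) * x := by push_cast; ring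
        rw [this]; linarith [Real.exp_pos (2 * t * x)]
    exact hf.abs.integrable_mul h2
  -- The Fourier transform of f times the Gaussian measure vanishes: the exponential is expanded
  -- termwise, with dominating function |f| exp|tx|.
  have hzero : ∀ t : ℝ, ∫ x, (f x : ℂ) * Complex.exp (t * x * Complex.I) ∂(gaussianReal 0 1) = 0 := by
    intro t
    have hs := hasSum_integral_of_dominated_convergence (μ := gaussianReal 0 1)
      (F := fun (n : ℕ) (x : ℝ) => (f x : ℂ) * ((t * x * Complex.I) ^ n / n.factorial))
      (f := fun x => (f x : ℂ) * Complex.exp (t * x * Complex.I))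
      (fun n x => |f x| * (|t * x| ^ n / n.factorial))
      (fun n => by
        refine AEStronglyMeasurable.mul
          (Complex.continuous_ofReal.comp_aestronglyMeasurable hf.1) (by fun_prop))
      (fun n => Eventually.of_forall fun x => by simp [mul_pow, abs_mul])
      (Eventually.of_forall fun x => (Real.summable_pow_div_factorial _).mul_left _)
      (by
        refine (hexp t).congr (Eventually.of_forall fun x => ?_)
        simp only
        rw [tsum_mul_left, Real.exp_eq_exp_ℝ, NormedSpace.exp_eq_tsum_div])
      (Eventually.of_forall fun x => by
        refine HasSum.mul_left _ ?_
        rw [Complex.exp_eq_exp_ℂ]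
        exact NormedSpace.expSeries_div_hasSum_exp _)
    refine hs.unique ?_
    have : ∀ n : ℕ, ∫ x, (f x : ℂ) * ((t * x * Complex.I) ^ n / n.factorial) ∂(gaussianReal 0 1)
        = 0 := fun n => by
      have e : ∀ x : ℝ, (f x : ℂ) * ((t * x * Complex.I) ^ n / n.factorial) =
          ((t * Complex.I) ^ n / n.factorial) * ((f x * x ^ n : ℝ) : ℂ) := fun x => by
        push_cast; ring
      simp_rw [e]
      rw [integral_const_mul, integral_complex_ofReal, h n]
      simp
    simp_rw [this]
    exact hasSum_zero
  set γ := gaussianReal 0 1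
  set μp := γ.withDensity (fun x => ENNReal.ofReal (f x)) with hμp
  set μm := γ.withDensity (fun x => ENNReal.ofReal (-f x)) with hμm
  have hfin1 : IsFiniteMeasure μp := isFiniteMeasure_withDensity_ofReal hfi.2
  have hfin2 : IsFiniteMeasure μm := isFiniteMeasure_withDensity_ofReal hfi.neg.2
  have hmeas : AEMeasurable f γ := hf.1.aemeasurable
  have hmneg : AEMeasurable (fun x => -f x) γ := hmeas.neg
  -- The positive and negative parts of f give finite measures with equal characteristic functions.
  have heq : μp = μm := by
    apply Measure.ext_of_charFun
    ext t
    rw [charFun_apply_real, charFun_apply_real, hμp, hμm,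
      integral_withDensity_eq_integral_toReal_smul₀ hmeas.ennreal_ofReal (by simp),
      integral_withDensity_eq_integral_toReal_smul₀ hmneg.ennreal_ofReal (by simp),
      ← sub_eq_zero, ← integral_sub, ← hzero t]
    · refine integral_congr_ae (Eventually.of_forall fun x => ?_)
      simp only [Complex.real_smul, ENNReal.toReal_ofReal', ← sub_mul]
      congr 1
      norm_cast
      rcases le_total 0 (f x) with h | h
      · rw [max_eq_left h, max_eq_right (by linarith)]; ring
      · rw [max_eq_right h, max_eq_left (by linarith)]; ring
    all_goals
      refine Integrable.mono' (g := fun x => |f x|) hfi.abs ?_ (Eventually.of_forall fun x => ?_)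
    · exact (hmeas.ennreal_ofReal.ennreal_toReal.aestronglyMeasurable).smul (by fun_prop)
    · rw [norm_smul, mul_assoc, ← mul_assoc, ← Complex.ofReal_mul, Complex.norm_exp_ofReal_mul_I,
        ENNReal.toReal_ofReal', mul_one, Real.norm_of_nonneg (le_max_right _ _)]
      exact max_le (le_abs_self _) (abs_nonneg _)
    · exact (hmneg.ennreal_ofReal.ennreal_toReal.aestronglyMeasurable).smul (by fun_prop)
    · rw [norm_smul, mul_assoc, ← mul_assoc, ← Complex.ofReal_mul, Complex.norm_exp_ofReal_mul_I,
        ENNReal.toReal_ofReal', mul_one, Real.norm_of_nonneg (le_max_right _ _)]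
      exact max_le (neg_le_abs _) (abs_nonneg _)
  have hae := (withDensity_eq_iff_of_sigmaFinite hmeas.ennreal_ofReal
    hmneg.ennreal_ofReal).1 heq
  filter_upwards [hae] with x hx
  rcases lt_trichotomy (f x) 0 with h | h | h
  · rw [ENNReal.ofReal_of_nonpos h.le] at hx
    have := ENNReal.ofReal_eq_zero.1 hx.symm
    linarith
  · exact h
  · rw [ENNReal.ofReal_of_nonpos (by linarith : -f x ≤ 0)] at hx
    have := ENNReal.ofReal_eq_zero.1 hx
    linarith

lemma ae_eq_zero_of_integral_mul_hermite {f : ℝ → ℝ} (hf : MemLp f 2 (gaussianReal 0 1))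
    (h : ∀ n : ℕ, ∫ x, f x * (hermiteR n).eval x ∂(gaussianReal 0 1) = 0) :
    f =ᵐ[gaussianReal 0 1] 0 := by
  have hI : ∀ p : Polynomial ℝ, Integrable (fun x => f x * p.eval x) (gaussianReal 0 1) :=
    fun p => hf.integrable_mul (memLp_eval_gaussian p)
  have key : ∀ (n : ℕ) (p : Polynomial ℝ), p.degree < n →
      ∫ x, f x * p.eval x ∂(gaussianReal 0 1) = 0 := by
    intro n
    induction n with
    | zero =>
      intro p hp
      have : p = 0 := by simpa using hp
      simp [this]
    | succ n ih =>
      intro p hp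
      -- The Hermite polynomials are monic, so this removes the term of degree n.
      set r := p - Polynomial.C (p.coeff n) * hermiteR n with hr
      have hrd : r.degree < n := by
        rw [Polynomial.degree_lt_iff_coeff_zero] at hp ⊢
        intro m hm
        rcases hm.eq_or_lt with rfl | hm
        · simp [hr, hermiteR]
        · have h1 := hp m (by omega)
          simp [hr, hermiteR, h1, Polynomial.coeff_hermite_of_lt hm]
      have e : ∀ x, f x * p.eval x =
          p.coeff n * (f x * (hermiteR n).eval x) + f x * r.eval x := fun x => by
        simp [hr]; ring
      simp_rw [e]
      rw [integral_add ((hI _).const_mul _) (hI _), integral_const_mul, h, ih r hrd]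
      simp
  refine ae_eq_zero_of_integral_mul_pow hf fun n => ?_
  have := key (n + 1) (Polynomial.X ^ n) (by
    rw [Polynomial.degree_X_pow]; exact_mod_cast Nat.lt_succ_self n)
  simpa using this

/-- The normalized Hermite polynomial as an element of `L²`. -/
def hermiteLp (k : ℕ) : Lp ℝ 2 (gaussianReal 0 1) :=
  (memLp_eval_gaussian (Polynomial.C (√(k.factorial))⁻¹ * hermiteR k)).toLp

lemma sqrt_factorial_ne_zero (k : ℕ) : √(k.factorial : ℝ) ≠ 0 :=
  (Real.sqrt_pos.2 (by positivity)).ne'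

lemma inner_toLp_toLp {α : Type*} [MeasurableSpace α] {μ : Measure α} {f g : α → ℝ}
    (hf : MemLp f 2 μ) (hg : MemLp g 2 μ) :
    inner ℝ hf.toLp hg.toLp = ∫ x, f x * g x ∂μ := by
  rw [L2.inner_def]
  refine integral_congr_ae ?_
  filter_upwards [hf.coeFn_toLp, hg.coeFn_toLp] with x h1 h2
  rw [h1, h2, real_inner_eq_re_inner]
  simp [mul_comm]

lemma orthonormal_hermiteLp : Orthonormal ℝ hermiteLp := by
  rw [orthonormal_iff_ite]
  intro i j
  rw [hermiteLp, hermiteLp, inner_toLp_toLp]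
  have e : ∀ x, (Polynomial.C (√(i.factorial))⁻¹ * hermiteR i).eval x *
      (Polynomial.C (√(j.factorial))⁻¹ * hermiteR j).eval x =
      (√(i.factorial))⁻¹ * (√(j.factorial))⁻¹ * ((hermiteR i).eval x * (hermiteR j).eval x) :=
    fun x => by simp; ring
  simp_rw [e]
  rw [integral_const_mul, integral_mul_hermiteR]
  split_ifs with h
  · subst h
    have := sqrt_factorial_ne_zero i
    rw [← mul_inv, Real.mul_self_sqrt (by positivity), inv_mul_cancel₀ (by positivity)]
  · simp

lemma inner_hermiteLp {f : ℝ → ℝ} (hf : MemLp f 2 (gaussianReal 0 1)) (k : ℕ) :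
    inner ℝ (hermiteLp k) hf.toLp = hermiteCoeff f k := by
  rw [hermiteLp, inner_toLp_toLp, hermiteCoeff]
  refine integral_congr_ae (Eventually.of_forall fun x => ?_)
  simp only [aeval_hermite, Polynomial.eval_mul, Polynomial.eval_C]
  ring

/-- The Hilbert basis of normalized Hermite polynomials. -/
def hermiteBasis : HilbertBasis ℕ ℝ (Lp ℝ 2 (gaussianReal 0 1)) :=
  HilbertBasis.mkOfOrthogonalEqBot orthonormal_hermiteLp <| by
    rw [Submodule.eq_bot_iff]
    intro f hf
    have hz : ∀ n, inner ℝ (hermiteLp n) f = 0 := fun n =>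
      hf _ (Submodule.subset_span (Set.mem_range_self n))
    have hm : MemLp f 2 (gaussianReal 0 1) := Lp.memLp f
    have hf' : hm.toLp = f := Lp.toLp_coeFn f hm
    have h0 : (f : ℝ → ℝ) =ᵐ[gaussianReal 0 1] 0 := by
      refine ae_eq_zero_of_integral_mul_hermite hm fun n => ?_
      have := hz n
      rw [← hf', inner_hermiteLp hm, hermiteCoeff] at this
      simp_rw [aeval_hermite, ← mul_div_assoc] at this
      rw [integral_div, div_eq_zero_iff] at this
      exact this.resolve_right (sqrt_factorial_ne_zero n)
    exact (Lp.eq_zero_iff_ae_eq_zero).2 h0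

lemma hasSum_hermiteLp {f : ℝ → ℝ} (hf : MemLp f 2 (gaussianReal 0 1)) :
    HasSum (fun k => hermiteCoeff f k • hermiteLp k) hf.toLp := by
  have := hermiteBasis.hasSum_repr hf.toLp
  have hb : ∀ k, hermiteBasis k = hermiteLp k := fun k => by
    rw [hermiteBasis, HilbertBasis.coe_mkOfOrthogonalEqBot]
  simpa only [hermiteBasis.repr_apply_apply, hb, inner_hermiteLp] using this

/-- Mehler's formula: the covariance of `f` at two standard Gaussians with correlation `ρ`. -/
lemma hasSum_hermiteCoeff_sq {ρ : ℝ} (hρ : |ρ| ≤ 1) {f : ℝ → ℝ}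
    (hf : MemLp f 2 (gaussianReal 0 1)) :
    HasSum (fun k => hermiteCoeff f k ^ 2 * ρ ^ k) (∫ z, f z.1 * f z.2 ∂(corrG ρ)) := by
  set T1 := (Lp.compMeasurePreservingₗᵢ ℝ (E := ℝ) (p := 2) Prod.fst
    (corrG_fst ρ)).toContinuousLinearMap with hT1
  set T2 := (Lp.compMeasurePreservingₗᵢ ℝ (E := ℝ) (p := 2) Prod.snd
    (corrG_snd hρ)).toContinuousLinearMap with hT2
  have hT1a : ∀ {g : ℝ → ℝ} (hg : MemLp g 2 (gaussianReal 0 1)), T1 hg.toLp =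
      (hg.comp_corrG_fst (ρ := ρ)).toLp := fun hg => rfl
  have hT2a : ∀ {g : ℝ → ℝ} (hg : MemLp g 2 (gaussianReal 0 1)), T2 hg.toLp =
      (hg.comp_corrG_snd hρ).toLp := fun hg => rfl
  -- Pulling back along the two coordinates embeds L² of the line isometrically in two ways; the
  -- Hermite basis diagonalizes the pairing of the two embeddings, with eigenvalues ρ^k.
  have hee : ∀ j k, inner ℝ (T1 (hermiteLp j)) (T2 (hermiteLp k)) = if j = k then ρ ^ k else 0 := by
    intro j k
    rw [hermiteLp, hermiteLp, hT1a, hT2a, inner_toLp_toLp]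
    have e : ∀ z : ℝ × ℝ, (Polynomial.C (√(j.factorial))⁻¹ * hermiteR j).eval z.1 *
        (Polynomial.C (√(k.factorial))⁻¹ * hermiteR k).eval z.2 =
        (√(j.factorial))⁻¹ * (√(k.factorial))⁻¹ *
          ((hermiteR j).eval z.1 * (hermiteR k).eval z.2) :=
      fun z => by simp; ring
    simp_rw [e]
    rw [integral_const_mul, integral_hermite_corrG hρ]
    split_ifs with h
    · subst h
      rw [← mul_inv, Real.mul_self_sqrt (by positivity), ← mul_assoc,
        inv_mul_cancel₀ (by positivity), one_mul]
    · simp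
  have h1 : HasSum (fun k => inner ℝ (T1 (hermiteCoeff f k • hermiteLp k)) (T2 hf.toLp))
      (inner ℝ (T1 hf.toLp) (T2 hf.toLp)) := by
    have := ((hasSum_hermiteLp hf).mapL T1).mapL (innerSL ℝ (T2 hf.toLp))
    simpa only [innerSL_apply_apply, real_inner_comm] using this
  rw [hT1a, hT2a, inner_toLp_toLp] at h1
  refine h1.congr_fun fun k => ?_
  have h2 : HasSum (fun j => inner ℝ (T1 (hermiteLp k)) (T2 (hermiteCoeff f j • hermiteLp j)))
      (inner ℝ (T1 (hermiteLp k)) (T2 hf.toLp)) :=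
    ((hasSum_hermiteLp hf).mapL T2).mapL (innerSL ℝ (T1 (hermiteLp k)))
  simp only [map_smul, inner_smul_right, hee] at h2
  have h3 : inner ℝ (T1 (hermiteLp k)) (T2 hf.toLp) = hermiteCoeff f k * ρ ^ k := by
    refine h2.unique ?_
    convert hasSum_ite_eq k (hermiteCoeff f k * ρ ^ k) using 2 with j
    by_cases h : j = k
    · simp [h]
    · simp [h, Ne.symm h]
  rw [map_smul, inner_smul_left, ← hT2a hf, h3]
  simp
  ring

/-! ### Power series with nonnegative coefficients on [-1, 1] -/

lemma tupleSum_zero (p : ℕ) (a : ℕ → ℝ) : tupleSum p 0 a = if p = 0 then 1 else 0 := by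
  rcases p with _ | p <;> simp [tupleSum]

/-- Splitting off the first index exhibits F(·, k, a) as a k-fold Cauchy product, hence as the
coefficients of a k-th power. -/
lemma tupleSum_succ (p k : ℕ) (a : ℕ → ℝ) :
    tupleSum p (k + 1) a = ∑ q ∈ Finset.range (p + 1), a q * tupleSum (p - q) k a := by
  simp only [tupleSum, Finset.mul_sum]
  rw [Finset.sum_sigma']
  refine Finset.sum_nbij' (fun j => ⟨j 0, Fin.tail j⟩) (fun s => Fin.cons s.1 s.2) ?_ ?_ ?_ ?_ ?_
  · intro j hj
    rw [Finset.Nat.mem_antidiagonalTuple, Fin.sum_univ_succ] at hj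
    simp only [Finset.mem_sigma, Finset.mem_range, Finset.Nat.mem_antidiagonalTuple, Fin.tail]
    omega
  · rintro ⟨q, j⟩ hj
    simp only [Finset.mem_sigma, Finset.mem_range, Finset.Nat.mem_antidiagonalTuple] at hj
    rw [Finset.Nat.mem_antidiagonalTuple, Fin.sum_univ_succ]
    simp only [Fin.cons_zero, Fin.cons_succ]
    omega
  · intro j _
    simp
  · intro s _
    simp
  · intro j _
    rw [Fin.prod_univ_succ]
    rfl

/-- `f` is on `[-1, 1]` the sum of the power series with nonnegative coefficients `a`. -/
def HasNonnegSeries (a : ℕ → ℝ) (f : ℝ → ℝ) : Prop :=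
  (∀ p, 0 ≤ a p) ∧ ∀ t, |t| ≤ 1 → HasSum (fun p => a p * t ^ p) (f t)

namespace HasNonnegSeries

variable {a b : ℕ → ℝ} {f g : ℝ → ℝ}

lemma summable_abs (h : HasNonnegSeries a f) {t : ℝ} (ht : |t| ≤ 1) :
    Summable fun p => |a p * t ^ p| := by
  have := (h.2 1 (by simp)).summable
  simp only [one_pow, mul_one] at this
  refine this.of_nonneg_of_le (fun _ => abs_nonneg _) fun p => ?_
  rw [abs_mul, abs_of_nonneg (h.1 p), abs_pow]
  exact mul_le_of_le_one_right (h.1 p) (pow_le_one₀ (abs_nonneg _) ht)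

lemma summable_norm (h : HasNonnegSeries a f) {t : ℝ} (ht : |t| ≤ 1) :
    Summable fun p => ‖a p * t ^ p‖ := by
  simpa only [Real.norm_eq_abs] using h.summable_abs ht

lemma tsum_abs_le (h : HasNonnegSeries a f) {t : ℝ} (ht : |t| ≤ 1) :
    ∑' p, |a p * t ^ p| ≤ f 1 := by
  rw [← (h.2 1 (by simp)).tsum_eq]
  refine (h.summable_abs ht).tsum_le_tsum (fun p => ?_) (h.2 1 (by simp)).summable
  rw [abs_mul, abs_of_nonneg (h.1 p), abs_pow, one_pow, mul_one]
  exact mul_le_of_le_one_right (h.1 p) (pow_le_one₀ (abs_nonneg _) ht)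

lemma abs_le (h : HasNonnegSeries a f) {t : ℝ} (ht : |t| ≤ 1) : |f t| ≤ f 1 := by
  refine le_trans ?_ (h.tsum_abs_le ht)
  rw [← (h.2 t ht).tsum_eq]
  simpa only [Real.norm_eq_abs] using norm_tsum_le_tsum_norm (h.summable_norm ht)

lemma add (h : HasNonnegSeries a f) (h' : HasNonnegSeries b g) :
    HasNonnegSeries (fun p => a p + b p) (fun t => f t + g t) :=
  ⟨fun p => add_nonneg (h.1 p) (h'.1 p), fun t ht => by
    simpa only [add_mul] using (h.2 t ht).add (h'.2 t ht)⟩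

lemma mul (h : HasNonnegSeries a f) (h' : HasNonnegSeries b g) :
    HasNonnegSeries (fun p => ∑ q ∈ Finset.range (p + 1), a q * b (p - q))
      (fun t => f t * g t) := by
  refine ⟨fun p => Finset.sum_nonneg fun q _ => mul_nonneg (h.1 _) (h'.1 _), fun t ht => ?_⟩
  have h1 := hasSum_sum_range_mul_of_summable_norm (h.summable_norm ht) (h'.summable_norm ht)
  rw [(h.2 t ht).tsum_eq, (h'.2 t ht).tsum_eq] at h1
  refine h1.congr_fun fun p => ?_
  rw [Finset.sum_mul]
  refine Finset.sum_congr rfl fun q hq => ?_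
  have : p = q + (p - q) := by have := Finset.mem_range.1 hq; omega
  conv_lhs => rw [this, pow_add]
  rw [Nat.add_sub_cancel_left]
  ring

lemma tupleSum (h : HasNonnegSeries a f) (k : ℕ) :
    HasNonnegSeries (fun p => tupleSum p k a) (fun t => f t ^ k) := by
  induction k with
  | zero =>
    refine ⟨fun p => ?_, fun t _ => ?_⟩
    · simp only [tupleSum_zero]; split_ifs <;> norm_num
    · simp only [tupleSum_zero, pow_zero]
      convert hasSum_ite_eq 0 (1 : ℝ) using 2 with p
      split_ifs with hp <;> simp [hp]
  | succ k ih =>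
    have := h.mul ih
    simp only [tupleSum_succ]
    simpa only [pow_succ'] using this

/-- By nonnegativity the inner absolute sum is at most b_k f(1)^k, and f(1) ≤ 1 lies in the domain
of the outer series. This licenses the exchange of sums in `comp`. -/
lemma summable_uncurry (h : HasNonnegSeries a f) (h' : HasNonnegSeries b g) (hf : f 1 ≤ 1)
    {t : ℝ} (ht : |t| ≤ 1) :
    Summable fun x : ℕ × ℕ => |b x.1 * _root_.tupleSum x.2 x.1 a * t ^ x.2| := by
  have hf0 : |f 1| ≤ 1 := (h.abs_le (by simp)).trans hf
  refine (summable_prod_of_nonneg fun _ => abs_nonneg _).2 ⟨fun k => ?_, ?_⟩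
  · have := ((h.tupleSum k).summable_abs ht).mul_left (b k)
    refine this.congr fun p => ?_
    rw [mul_assoc, abs_mul (b k), abs_of_nonneg (h'.1 k)]
  · have := h'.summable_abs hf0
    refine this.of_nonneg_of_le (fun k => tsum_nonneg fun _ => abs_nonneg _) fun k => ?_
    have e : ∀ p, |b k * _root_.tupleSum p k a * t ^ p| =
        b k * |_root_.tupleSum p k a * t ^ p| := fun p => by
      rw [mul_assoc, abs_mul (b k), abs_of_nonneg (h'.1 k)]
    simp only [e]
    rw [tsum_mul_left, abs_mul, abs_of_nonneg (h'.1 k)]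
    refine mul_le_mul_of_nonneg_left ?_ (h'.1 k)
    refine le_trans ?_ (le_abs_self _)
    exact (h.tupleSum k).tsum_abs_le ht

lemma summable_comp (h : HasNonnegSeries a f) (h' : HasNonnegSeries b g) (hf : f 1 ≤ 1) (p : ℕ) :
    Summable fun k => b k * _root_.tupleSum p k a := by
  have h1 := (h.summable_uncurry h' hf (t := 1) (by simp)).of_abs
  simpa using h1.prod_symm.prod_factor p

lemma comp (h : HasNonnegSeries a f) (h' : HasNonnegSeries b g) (hf : f 1 ≤ 1) :
    HasNonnegSeries (fun p => ∑' k, b k * _root_.tupleSum p k a) (fun t => g (f t)) := by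
  refine ⟨fun p => tsum_nonneg fun k => mul_nonneg (h'.1 k) ((h.tupleSum k).1 p),
    fun t ht => ?_⟩
  have hs := (h.summable_uncurry h' hf ht).of_abs
  have h1 : HasSum (fun x : ℕ × ℕ => b x.1 * _root_.tupleSum x.2 x.1 a * t ^ x.2) (g (f t)) := by
    have h2 := h'.2 (f t) ((h.abs_le ht).trans hf)
    have h3 := hs.hasSum.prod_fiberwise (g := fun k => b k * f t ^ k) fun k => by
      have := ((h.tupleSum k).2 t ht).mul_left (b k)
      simpa only [mul_assoc] using this
    rw [← h3.unique h2]
    exact hs.hasSum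
  have h4 := (Equiv.prodComm ℕ ℕ).hasSum_iff.2 h1
  refine h4.prod_fiberwise fun p => ?_
  have := (h.summable_comp h' hf p).hasSum.mul_right (t ^ p)
  simpa [Function.comp_def] using this

end HasNonnegSeries

/-! ### The limiting kernels and their expansions -/

/-- The second moment `E[f(U) f(V)]` of a pair of standard Gaussians with correlation `ρ`. -/
def gaussCov (f : ℝ → ℝ) (ρ : ℝ) : ℝ := ∫ z, f z.1 * f z.2 ∂(corrG ρ)

lemma gaussCov_one {f : ℝ → ℝ} (hf : MemLp f 2 (gaussianReal 0 1)) :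
    gaussCov f 1 = ∫ x, f x ^ 2 ∂(gaussianReal 0 1) := by
  have : ∫ x, f x ^ 2 ∂(gaussianReal 0 1) = ∫ z, f z.1 ^ 2 ∂(corrG 1) := by
    rw [← (corrG_fst 1).map_eq, integral_map (by fun_prop)]
    rw [(corrG_fst 1).map_eq]
    exact hf.1.pow 2
  rw [this, gaussCov]
  refine integral_congr_ae (corrG_one_ae.mono fun z hz => ?_)
  simp only [hz, sq]

namespace Net

variable (N : Net)

/-- The limiting covariance of the preactivations in layer `k` at two inputs on the unit sphere
with inner product `t`. -/
def corr (t : ℝ) : ℕ → ℝ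
  | 0 => 0
  | 1 => N.gammaW ^ 2 * t + N.gammaB ^ 2
  | k + 2 => N.sigmaW ^ 2 * gaussCov N.phi (corr t (k + 1)) + N.sigmaB ^ 2

/-- The limiting neural tangent kernel at layer `k` at two inputs on the unit sphere with inner
product `t`, with `ψ` in the role of the derivative of the activation function. -/
def limitNTK (ψ : ℝ → ℝ) (t : ℝ) : ℕ → ℝ
  | 0 => 0
  | 1 => N.gammaW ^ 2 * t + N.gammaB ^ 2
  | k + 2 => N.corr t (k + 2) +
      limitNTK ψ t (k + 1) * (N.sigmaW ^ 2 * gaussCov ψ (N.corr t (k + 1)))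

lemma hasNonnegSeries_firstCoeff :
    HasNonnegSeries N.firstCoeff fun t => N.gammaW ^ 2 * t + N.gammaB ^ 2 := by
  refine ⟨fun p => ?_, fun t _ => ?_⟩
  · unfold firstCoeff; positivity
  · have h1 := hasSum_ite_eq 0 (N.gammaB ^ 2)
    have h2 := hasSum_ite_eq 1 (N.gammaW ^ 2 * t)
    simp only [add_comm (N.gammaW ^ 2 * t)]
    refine (h1.add h2).congr_fun fun p => ?_
    unfold firstCoeff
    rcases p with _ | _ | p <;> simp

variable {N}

lemma hasNonnegSeries_aCoeff (hphi : MemLp N.phi 2 (gaussianReal 0 1)) :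
    HasNonnegSeries N.aCoeff fun ρ => N.sigmaW ^ 2 * gaussCov N.phi ρ + N.sigmaB ^ 2 := by
  refine ⟨fun p => ?_, fun ρ hρ => ?_⟩
  · unfold aCoeff; positivity
  · have h1 := (hasSum_hermiteCoeff_sq hρ hphi).mul_left (N.sigmaW ^ 2)
    have h2 := hasSum_ite_eq 0 (N.sigmaB ^ 2)
    refine (h1.add h2).congr_fun fun p => ?_
    unfold aCoeff
    rcases p with _ | p <;> simp
    ring

lemma hasNonnegSeries_bCoeff (hd : MemLp (deriv N.phi) 2 (gaussianReal 0 1)) :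
    HasNonnegSeries N.bCoeff fun ρ => N.sigmaW ^ 2 * gaussCov (deriv N.phi) ρ := by
  refine ⟨fun p => ?_, fun ρ hρ => ?_⟩
  · unfold bCoeff; positivity
  · have h1 := (hasSum_hermiteCoeff_sq hρ hd).mul_left (N.sigmaW ^ 2)
    refine h1.congr_fun fun p => ?_
    unfold bCoeff
    ring

/-- The choice of σ_b makes variance one a fixed point of the layer recursion. It supplies the bound
at t = 1 required to compose the series. -/
lemma corr_one (hphi : MemLp N.phi 2 (gaussianReal 0 1))
    (hunit1 : N.gammaW ^ 2 + N.gammaB ^ 2 = 1)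
    (hunit : N.sigmaB ^ 2 = 1 - N.sigmaW ^ 2 * ∫ z, N.phi z ^ 2 ∂(gaussianReal 0 1)) (k : ℕ) :
    N.corr 1 (k + 1) = 1 := by
  induction k with
  | zero => rw [corr, mul_one, hunit1]
  | succ k ih => rw [corr, ih, gaussCov_one hphi, hunit]; ring

lemma hasNonnegSeries_alpha (hphi : MemLp N.phi 2 (gaussianReal 0 1))
    (hunit1 : N.gammaW ^ 2 + N.gammaB ^ 2 = 1)
    (hunit : N.sigmaB ^ 2 = 1 - N.sigmaW ^ 2 * ∫ z, N.phi z ^ 2 ∂(gaussianReal 0 1)) (k : ℕ) :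
    HasNonnegSeries (N.alpha (k + 1)) fun t => N.corr t (k + 1) := by
  induction k with
  | zero => exact N.hasNonnegSeries_firstCoeff
  | succ k ih =>
    exact ih.comp (hasNonnegSeries_aCoeff hphi) (corr_one hphi hunit1 hunit k).le

lemma hasNonnegSeries_upsilon (hphi : MemLp N.phi 2 (gaussianReal 0 1))
    (hd : MemLp (deriv N.phi) 2 (gaussianReal 0 1))
    (hunit1 : N.gammaW ^ 2 + N.gammaB ^ 2 = 1)
    (hunit : N.sigmaB ^ 2 = 1 - N.sigmaW ^ 2 * ∫ z, N.phi z ^ 2 ∂(gaussianReal 0 1)) (k : ℕ) :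
    HasNonnegSeries (N.upsilon (k + 2))
      fun t => N.sigmaW ^ 2 * gaussCov (deriv N.phi) (N.corr t (k + 1)) :=
  (hasNonnegSeries_alpha hphi hunit1 hunit k).comp (hasNonnegSeries_bCoeff hd)
    (corr_one hphi hunit1 hunit k).le

lemma hasNonnegSeries_kappa (hphi : MemLp N.phi 2 (gaussianReal 0 1))
    (hd : MemLp (deriv N.phi) 2 (gaussianReal 0 1))
    (hunit1 : N.gammaW ^ 2 + N.gammaB ^ 2 = 1)
    (hunit : N.sigmaB ^ 2 = 1 - N.sigmaW ^ 2 * ∫ z, N.phi z ^ 2 ∂(gaussianReal 0 1)) (k : ℕ) :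
    HasNonnegSeries (N.kappa (k + 1)) fun t => N.limitNTK (deriv N.phi) t (k + 1) := by
  induction k with
  | zero => exact N.hasNonnegSeries_firstCoeff
  | succ k ih =>
    exact (hasNonnegSeries_alpha hphi hunit1 hunit (k + 1)).add
      (ih.mul (hasNonnegSeries_upsilon hphi hd hunit1 hunit k))

lemma abs_corr_le (hphi : MemLp N.phi 2 (gaussianReal 0 1))
    (hunit1 : N.gammaW ^ 2 + N.gammaB ^ 2 = 1)
    (hunit : N.sigmaB ^ 2 = 1 - N.sigmaW ^ 2 * ∫ z, N.phi z ^ 2 ∂(gaussianReal 0 1))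
    {t : ℝ} (ht : |t| ≤ 1) (k : ℕ) : |N.corr t (k + 1)| ≤ 1 :=
  ((hasNonnegSeries_alpha hphi hunit1 hunit k).abs_le ht).trans
    (corr_one hphi hunit1 hunit k).le

/-- This sequence is the series of t itself, whose k-th power is t^k. -/
lemma tupleSum_single (p k : ℕ) :
    tupleSum p k (fun q => if q = 1 then 1 else 0) = if k = p then 1 else 0 := by
  induction k generalizing p with
  | zero => rw [tupleSum_zero]; simp [eq_comm]
  | succ k ih =>
    rw [tupleSum_succ]
    simp only [ite_mul, one_mul, zero_mul, Finset.sum_ite_eq', Finset.mem_range, ih]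
    rcases p with _ | p <;> simp

lemma alpha_two_of_gammaB_eq_zero (hunit1 : N.gammaW ^ 2 + N.gammaB ^ 2 = 1)
    (h0 : N.gammaB = 0) (p : ℕ) : N.alpha 2 p = N.aCoeff p ∧ N.upsilon 2 p = N.bCoeff p := by
  have h : N.alpha 1 = fun q => if q = 1 then 1 else 0 := by
    ext q
    have : N.gammaW ^ 2 = 1 := by rw [h0] at hunit1; simpa using hunit1
    simp [alpha, firstCoeff, h0, this]
  constructor
  · rw [alpha, h]
    simp [tupleSum_single]
  · rw [upsilon, h]
    simp [tupleSum_single]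

end Net

/-! ### Finite-width gradients and backpropagation -/

/-- The layer to which a parameter belongs. -/
def Param.layer : Param → ℕ
  | Sum.inl (k, _, _) => k
  | Sum.inr (k, _) => k

namespace Net

variable (N : Net) {d : ℕ}

/-- The partial derivative of the preactivations with respect to the parameter `p`, as computed by
the chain rule. -/
def paramGrad (m : ℕ → ℕ) (θ : Param → ℝ) (x : Fin d → ℝ) (p : Param) : ℕ → ℕ → ℝ
  | 0, _ => 0
  | 1, i => N.gammaW * ∑ j : Fin d, (if p = Sum.inl (1, i, (j : ℕ)) then 1 else 0) * x j
      + N.gammaB * (if p = Sum.inr (1, i) then 1 else 0)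
  | k + 2, i => N.sigmaW / √(m (k + 1)) *
        ∑ j ∈ Finset.range (m (k + 1)),
          ((if p = Sum.inl (k + 2, i, j) then 1 else 0) * N.phi (N.preact m θ x (k + 1) j) +
            θ (Sum.inl (k + 2, i, j)) *
              (deriv N.phi (N.preact m θ x (k + 1) j) * paramGrad m θ x p (k + 1) j))
      + N.sigmaB * (if p = Sum.inr (k + 2, i) then 1 else 0)

/-- The neural tangent kernel between the neurons of a layer, computed by backpropagation with
`ψ` in the role of the derivative of the activation function. -/
def ntkRec (ψ : ℝ → ℝ) (m : ℕ → ℕ) (θ : Param → ℝ) (x y : Fin d → ℝ) : ℕ → ℕ → ℕ → ℝ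
  | 0, _, _ => 0
  | 1, i, i' => if i = i' then N.gammaW ^ 2 * ∑ j, x j * y j + N.gammaB ^ 2 else 0
  | k + 2, i, i' =>
      (if i = i' then (N.sigmaW / √(m (k + 1))) ^ 2 * ∑ j ∈ Finset.range (m (k + 1)),
        N.phi (N.preact m θ x (k + 1) j) * N.phi (N.preact m θ y (k + 1) j) + N.sigmaB ^ 2 else 0)
      + (N.sigmaW / √(m (k + 1))) ^ 2 * ∑ j ∈ Finset.range (m (k + 1)),
          ∑ j' ∈ Finset.range (m (k + 1)),
            θ (Sum.inl (k + 2, i, j)) * θ (Sum.inl (k + 2, i', j')) *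
              (ψ (N.preact m θ x (k + 1) j) * ψ (N.preact m θ y (k + 1) j')) *
              ntkRec ψ m θ x y (k + 1) j j'

variable {N} {m : ℕ → ℕ} {θ : Param → ℝ} {x y : Fin d → ℝ}

lemma hasDerivAt_update_apply (p q : Param) :
    HasDerivAt (fun t => Function.update θ p t q) (if p = q then 1 else 0) (θ p) := by
  by_cases h : p = q
  · subst h
    simpa using hasDerivAt_id' (θ p)
  · simp only [Function.update_of_ne (Ne.symm h), h, if_false]
    exact hasDerivAt_const _ _

/-- Differentiability of φ is required only at the hidden preactivations actually attained, since φ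
need not be differentiable everywhere. -/
lemma hasDerivAt_preact (p : Param) (k : ℕ)
    (h : ∀ k' > 0, k' < k → ∀ j < m k', DifferentiableAt ℝ N.phi (N.preact m θ x k' j)) (i : ℕ) :
    HasDerivAt (fun t => N.preact m (Function.update θ p t) x k i) (N.paramGrad m θ x p k i)
      (θ p) := by
  induction k generalizing i with
  | zero => simpa only [preact, paramGrad] using hasDerivAt_const _ _
  | succ k ih =>
    rcases k with _ | k
    · simp only [preact, paramGrad]
      exact ((HasDerivAt.fun_sum fun (j : Fin d) _ =>
        (hasDerivAt_update_apply (θ := θ) p (Sum.inl (1, i, (j : ℕ)))).mul_const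
          (x j)).const_mul _).fun_add ((hasDerivAt_update_apply p _).const_mul _)
    · simp only [preact, paramGrad]
      refine ((HasDerivAt.fun_sum fun j hj => ?_).const_mul _).fun_add
        ((hasDerivAt_update_apply p _).const_mul _)
      have h1 := ih (fun k' h0 hk' => h k' h0 (by omega)) j
      have h2 := (h (k + 1) (by omega) (by omega) j (Finset.mem_range.1 hj)).hasDerivAt
      have h3 := (hasDerivAt_update_apply (θ := θ) p (Sum.inl (k + 2, i, j))).fun_mul
        (HasDerivAt.comp (θ p) (by simpa only [Function.update_eq_self] using h2) h1)
      simpa only [Function.update_eq_self, Function.comp_def] using h3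

lemma paramGrad_eq_zero {p : Param} {k : ℕ} (hp : k < p.layer) (i : ℕ) :
    N.paramGrad m θ x p k i = 0 := by
  induction k generalizing i with
  | zero => rfl
  | succ k ih =>
    have e1 : ∀ a b, p ≠ Sum.inl (k + 1, a, b) := fun a b h => by
      rw [h] at hp; exact lt_irrefl _ hp
    have e2 : ∀ a, p ≠ Sum.inr (k + 1, a) := fun a h => by
      rw [h] at hp; exact lt_irrefl _ hp
    rcases k with _ | k
    · simp only [zero_add] at e1 e2
      simp [paramGrad, e1, e2]
    · simp [paramGrad, e1, e2, ih (by omega)]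

lemma paramGrad_of_layer_le {p : Param} {k : ℕ} (hp : p.layer ≤ k + 1) (i : ℕ) :
    N.paramGrad m θ x p (k + 2) i = N.sigmaW / √(m (k + 1)) *
      ∑ j ∈ Finset.range (m (k + 1)), θ (Sum.inl (k + 2, i, j)) *
        (deriv N.phi (N.preact m θ x (k + 1) j) * N.paramGrad m θ x p (k + 1) j) := by
  have e1 : ∀ a b, p ≠ Sum.inl (k + 2, a, b) := fun a b h => by
    rw [h] at hp; simp [Param.layer] at hp
  have e2 : ∀ a, p ≠ Sum.inr (k + 2, a) := fun a h => by
    rw [h] at hp; simp [Param.layer] at hp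
  simp [paramGrad, e1, e2]

lemma paramGrad_weight (k i i' : ℕ) {j : ℕ} (hj : j < m (k + 1)) :
    N.paramGrad m θ x (Sum.inl (k + 2, i', j)) (k + 2) i =
      if i = i' then N.sigmaW / √(m (k + 1)) * N.phi (N.preact m θ x (k + 1) j) else 0 := by
  simp only [paramGrad, paramGrad_eq_zero (p := Sum.inl (k + 2, i', j)) (k := k + 1)
    (by simp [Param.layer])]
  by_cases h : i = i'
  · subst h
    simp [hj]
  · simp [h, Ne.symm h]

lemma paramGrad_bias (k i i' : ℕ) :
    N.paramGrad m θ x (Sum.inr (k + 2, i')) (k + 2) i = if i = i' then N.sigmaB else 0 := by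
  simp only [paramGrad, paramGrad_eq_zero (p := Sum.inr (k + 2, i')) (k := k + 1)
    (by simp [Param.layer])]
  by_cases h : i = i' <;> simp [h, eq_comm]

/-- The sum over the parameters of the neurons `i < M` in layer `k`. -/
def layerSum (d : ℕ) (m : ℕ → ℕ) (k M : ℕ) : (Param → ℝ) →ₗ[ℝ] ℝ :=
  ∑ i ∈ Finset.range M, (∑ j ∈ Finset.range (fanIn d m k), LinearMap.proj (Sum.inl (k, i, j)) +
    LinearMap.proj (Sum.inr (k, i)))

lemma layerSum_apply (k M : ℕ) (h : Param → ℝ) :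
    layerSum d m k M h = ∑ i ∈ Finset.range M,
      (∑ j ∈ Finset.range (fanIn d m k), h (Sum.inl (k, i, j)) + h (Sum.inr (k, i))) := by
  simp [layerSum, LinearMap.sum_apply]

lemma layerSum_congr {k M : ℕ} {h h' : Param → ℝ} (hh : ∀ p, p.layer = k → h p = h' p) :
    layerSum d m k M h = layerSum d m k M h' := by
  rw [layerSum_apply, layerSum_apply]
  refine Finset.sum_congr rfl fun i _ => ?_
  rw [hh (Sum.inr (k, i)) rfl]
  congr 1
  exact Finset.sum_congr rfl fun j _ => hh _ rfl

lemma layerSum_one {M i i' : ℕ} (hi : i < M) :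
    layerSum d m 1 M (fun p => N.paramGrad m θ x p 1 i * N.paramGrad m θ y p 1 i') =
      N.ntkRec (deriv N.phi) m θ x y 1 i i' := by
  have e1 : ∀ (x : Fin d → ℝ) (i i'' : ℕ) (j : Fin d),
      N.paramGrad m θ x (Sum.inl (1, i'', (j : ℕ))) 1 i = if i = i'' then N.gammaW * x j else 0 := by
    intro x i i'' j
    by_cases h : i = i''
    · subst h
      simp [paramGrad, Fin.val_inj]
    · simp [paramGrad, h, Ne.symm h]
  have e2 : ∀ (x : Fin d → ℝ) (i i'' : ℕ),
      N.paramGrad m θ x (Sum.inr (1, i'')) 1 i = if i = i'' then N.gammaB else 0 := by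
    intro x i i''
    by_cases h : i = i'' <;> simp [paramGrad, h, eq_comm]
  rw [layerSum_apply]
  simp only [fanIn, if_true, e2, Finset.sum_range
    (n := d) (fun j => N.paramGrad m θ x (Sum.inl (1, _, j)) 1 i *
      N.paramGrad m θ y (Sum.inl (1, _, j)) 1 i'), e1]
  rw [Finset.sum_eq_single i (fun b _ hb => by simp [Ne.symm hb])
    (fun h => absurd (Finset.mem_range.2 hi) h)]
  by_cases h : i = i'
  · subst h
    simp only [if_true, ntkRec, Finset.mul_sum]
    congr 1
    · exact Finset.sum_congr rfl fun j _ => by ring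
    · ring
  · simp [ntkRec, h, Ne.symm h]

lemma layerSum_top {M i i' k : ℕ} (hi : i < M) :
    layerSum d m (k + 2) M
      (fun p => N.paramGrad m θ x p (k + 2) i * N.paramGrad m θ y p (k + 2) i') =
      if i = i' then (N.sigmaW / √(m (k + 1))) ^ 2 * ∑ j ∈ Finset.range (m (k + 1)),
        N.phi (N.preact m θ x (k + 1) j) * N.phi (N.preact m θ y (k + 1) j) + N.sigmaB ^ 2
      else 0 := by
  rw [layerSum_apply]
  have hfan : fanIn d m (k + 2) = m (k + 1) := by simp [fanIn]
  simp only [hfan, paramGrad_bias]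
  have e : ∀ i'', ∑ j ∈ Finset.range (m (k + 1)),
      N.paramGrad m θ x (Sum.inl (k + 2, i'', j)) (k + 2) i *
        N.paramGrad m θ y (Sum.inl (k + 2, i'', j)) (k + 2) i' =
      ∑ j ∈ Finset.range (m (k + 1)),
        (if i = i'' then N.sigmaW / √(m (k + 1)) * N.phi (N.preact m θ x (k + 1) j) else 0) *
        (if i' = i'' then N.sigmaW / √(m (k + 1)) * N.phi (N.preact m θ y (k + 1) j) else 0) :=
    fun i'' => Finset.sum_congr rfl fun j hj => by
      rw [paramGrad_weight _ _ _ (Finset.mem_range.1 hj),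
        paramGrad_weight _ _ _ (Finset.mem_range.1 hj)]
  simp only [e]
  rw [Finset.sum_eq_single i (fun b _ hb => by simp [Ne.symm hb])
    (fun h => absurd (Finset.mem_range.2 hi) h)]
  by_cases h : i = i'
  · subst h
    simp only [if_true, Finset.mul_sum]
    congr 1
    · exact Finset.sum_congr rfl fun j _ => by ring
    · ring
  · simp [h, Ne.symm h]

/-- Parameters of the top layer contribute only when i = i'. For lower layers the chain rule makes
each gradient a linear combination of those of the layer below, so the inner product is bilinear in
them. The free number M serves both the single output neuron and, in the induction, a whole hidden
layer. -/
lemma sum_layerSum_eq_ntkRec {M i i' k : ℕ} (hi : i < M) :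
    ∑ k' ∈ Finset.Icc 1 (k + 1), layerSum d m k' (if k' = k + 1 then M else m k')
      (fun p => N.paramGrad m θ x p (k + 1) i * N.paramGrad m θ y p (k + 1) i') =
      N.ntkRec (deriv N.phi) m θ x y (k + 1) i i' := by
  induction k generalizing M i i' with
  | zero => simpa using layerSum_one hi
  | succ k ih =>
    rw [Finset.sum_Icc_succ_top (by omega), if_pos rfl, layerSum_top hi, add_comm, ntkRec]
    congr 1
    have e1 : ∀ k' ∈ Finset.Icc 1 (k + 1), layerSum d m k' (if k' = k + 1 + 1 then M else m k')
        (fun p => N.paramGrad m θ x p (k + 1 + 1) i * N.paramGrad m θ y p (k + 1 + 1) i') =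
        ∑ j ∈ Finset.range (m (k + 1)), ∑ j' ∈ Finset.range (m (k + 1)),
          ((N.sigmaW / √(m (k + 1))) ^ 2 *
            (θ (Sum.inl (k + 2, i, j)) * θ (Sum.inl (k + 2, i', j')) *
              (deriv N.phi (N.preact m θ x (k + 1) j) *
                deriv N.phi (N.preact m θ y (k + 1) j')))) *
          layerSum d m k' (if k' = k + 1 then m (k + 1) else m k')
            (fun p => N.paramGrad m θ x p (k + 1) j * N.paramGrad m θ y p (k + 1) j') := by
      intro k' hk'
      have hk := (Finset.mem_Icc.1 hk').2
      rw [if_neg (by omega), ite_eq_right_iff.2 (fun h => by rw [h])]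
      simp only [← smul_eq_mul (_ * _) (layerSum _ _ _ _ _), ← map_smul, ← map_sum]
      refine layerSum_congr fun p hp => ?_
      rw [paramGrad_of_layer_le (by omega), paramGrad_of_layer_le (by omega),
        mul_mul_mul_comm, Finset.sum_mul_sum]
      simp only [Finset.sum_apply, Pi.smul_apply, smul_eq_mul, Finset.mul_sum]
      exact Finset.sum_congr rfl fun _ _ => Finset.sum_congr rfl fun _ _ => by ring
    rw [Finset.sum_congr rfl e1, Finset.sum_comm, Finset.mul_sum]
    refine Finset.sum_congr rfl fun j hj => ?_
    rw [Finset.sum_comm, Finset.mul_sum]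
    refine Finset.sum_congr rfl fun j' _ => ?_
    rw [← Finset.mul_sum, ih (Finset.mem_range.1 hj)]
    ring

lemma gradExists_of_differentiableAt {l : ℕ}
    (h : ∀ k > 0, k < l → ∀ j < m k, DifferentiableAt ℝ N.phi (N.preact m θ x k j)) :
    N.GradExists m l θ x :=
  fun p => (hasDerivAt_preact p l h 0).differentiableAt

lemma empiricalNTK_eq_ntkRec {l : ℕ}
    (hx : ∀ k > 0, k < l + 1 → ∀ j < m k, DifferentiableAt ℝ N.phi (N.preact m θ x k j))
    (hy : ∀ k > 0, k < l + 1 → ∀ j < m k, DifferentiableAt ℝ N.phi (N.preact m θ y k j)) :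
    N.empiricalNTK m (l + 1) θ x y = N.ntkRec (deriv N.phi) m θ x y (l + 1) 0 0 := by
  rw [← sum_layerSum_eq_ntkRec zero_lt_one, empiricalNTK]
  have ex : ∀ p, N.outputDeriv m (l + 1) θ x p = N.paramGrad m θ x p (l + 1) 0 :=
    fun p => (hasDerivAt_preact p (l + 1) hx 0).deriv
  have ey : ∀ p, N.outputDeriv m (l + 1) θ y p = N.paramGrad m θ y p (l + 1) 0 :=
    fun p => (hasDerivAt_preact p (l + 1) hy 0).deriv
  refine Finset.sum_congr rfl fun k _ => ?_
  rw [layerSum_apply, numNeurons]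
  simp only [ex, ey]

/-! ### Dependence on the widths and on the activation function -/

lemma preact_congr_width {m' : ℕ → ℕ} (k : ℕ) (h : ∀ k' < k, m k' = m' k') (i : ℕ) :
    N.preact m θ x k i = N.preact m' θ x k i := by
  induction k generalizing i with
  | zero => rfl
  | succ k ih =>
    rcases k with _ | k
    · rfl
    · simp only [preact, h (k + 1) (by omega), ih fun k' hk' => h k' (by omega)]

lemma ntkRec_congr_width {m' : ℕ → ℕ} (ψ : ℝ → ℝ) (k : ℕ) (h : ∀ k' < k, m k' = m' k')
    (i i' : ℕ) : N.ntkRec ψ m θ x y k i i' = N.ntkRec ψ m' θ x y k i i' := by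
  induction k generalizing i i' with
  | zero => rfl
  | succ k ih =>
    rcases k with _ | k
    · rfl
    · simp only [ntkRec, h (k + 1) (by omega), ih fun k' hk' => h k' (by omega),
        preact_congr_width (k + 1) fun k' hk' => h k' (by omega)]

/-- The network with another activation function. -/
def withPhi (N : Net) (f : ℝ → ℝ) : Net := { N with phi := f }

/-- Agreement is required only at the points visited by the modified network; by induction on the
layer the two networks then visit the same points. -/
lemma preact_withPhi {f : ℝ → ℝ} (k : ℕ)
    (h : ∀ k' > 0, k' < k → ∀ j < m k', N.phi ((N.withPhi f).preact m θ x k' j) =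
      f ((N.withPhi f).preact m θ x k' j)) (i : ℕ) :
    (N.withPhi f).preact m θ x k i = N.preact m θ x k i := by
  induction k generalizing i with
  | zero => rfl
  | succ k ih =>
    rcases k with _ | k
    · rfl
    · have ih' := ih fun k' h0 hk' => h k' h0 (by omega)
      simp only [preact]
      congr 2
      refine Finset.sum_congr rfl fun j hj => ?_
      have := h (k + 1) (by omega) (by omega) j (Finset.mem_range.1 hj)
      rw [ih'] at this ⊢
      rw [this]
      rfl

lemma ntkRec_withPhi {f ψ : ℝ → ℝ} (k : ℕ)
    (hx : ∀ k' > 0, k' < k → ∀ j < m k', N.phi ((N.withPhi f).preact m θ x k' j) =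
      f ((N.withPhi f).preact m θ x k' j))
    (hy : ∀ k' > 0, k' < k → ∀ j < m k', N.phi ((N.withPhi f).preact m θ y k' j) =
      f ((N.withPhi f).preact m θ y k' j)) (i i' : ℕ) :
    (N.withPhi f).ntkRec ψ m θ x y k i i' = N.ntkRec ψ m θ x y k i i' := by
  induction k generalizing i i' with
  | zero => rfl
  | succ k ih =>
    rcases k with _ | k
    · rfl
    · have ih' := ih (fun k' h0 hk' => hx k' h0 (by omega)) (fun k' h0 hk' => hy k' h0 (by omega))
      have hx' := preact_withPhi (k + 1) fun k' h0 hk' => hx k' h0 (by omega)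
      have hy' := preact_withPhi (k + 1) fun k' h0 hk' => hy k' h0 (by omega)
      have e : ∀ j ∈ Finset.range (m (k + 1)),
          f (N.preact m θ x (k + 1) j) * f (N.preact m θ y (k + 1) j) =
          N.phi (N.preact m θ x (k + 1) j) * N.phi (N.preact m θ y (k + 1) j) := fun j hj => by
        have h1 := hx (k + 1) (by omega) (by omega) j (Finset.mem_range.1 hj)
        have h2 := hy (k + 1) (by omega) (by omega) j (Finset.mem_range.1 hj)
        rw [hx'] at h1
        rw [hy'] at h2
        rw [h1, h2]
      simp only [ntkRec, ih', hx', hy']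
      rw [← Finset.sum_congr rfl e]
      rfl

section Measurability

variable {T : Type*} [MeasurableSpace T] {Θ : T → Param → ℝ}

/-- The σ-algebra on `T` is left free so that it can be the one generated by the layers up to k,
which yields independence from later layers. -/
lemma measurable_preact (hphi : Measurable N.phi) (k : ℕ)
    (hΘ : ∀ p : Param, p.layer ≤ k → Measurable fun ω => Θ ω p) (i : ℕ) :
    Measurable fun ω => N.preact m (Θ ω) x k i := by
  induction k generalizing i with
  | zero => exact measurable_const
  | succ k ih =>
    rcases k with _ | k
    · simp only [preact]
      exact ((Finset.measurable_sum _ fun (j : Fin d) _ =>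
        (hΘ (Sum.inl (1, i, (j : ℕ))) le_rfl).mul_const (x j)).const_mul _).add
        ((hΘ (Sum.inr (1, i)) le_rfl).const_mul _)
    · simp only [preact]
      exact ((Finset.measurable_sum _ fun j _ => (hΘ (Sum.inl (k + 2, i, j)) le_rfl).mul
        (hphi.comp (ih (fun p hp => hΘ p (by omega)) j))).const_mul _).add
        ((hΘ (Sum.inr (k + 2, i)) le_rfl).const_mul _)

end Measurability

end Net

/-! ### The parameter space and the independence of layers -/

/-- The law of independent standard Gaussian parameters. -/
def paramMeasure : Measure (Param → ℝ) := Measure.infinitePi fun _ => gaussianReal 0 1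

instance : IsProbabilityMeasure paramMeasure := by unfold paramMeasure; infer_instance

/-- The standard Gaussian measure on `M` vectors indexed by `ι`. -/
abbrev gaussRows (M : ℕ) (ι : Type*) [Fintype ι] : Measure (Fin M → ι → ℝ) :=
  Measure.pi fun _ => Measure.pi fun _ => gaussianReal 0 1

/-- The parameters of the first `M` neurons of layer `k`, with `w` inputs. -/
def layerRows (k M w : ℕ) (θ : Param → ℝ) (j : Fin M) (o : Option (Fin w)) : ℝ :=
  θ (o.elim (Sum.inr (k, (j : ℕ))) fun i => Sum.inl (k, (j : ℕ), (i : ℕ)))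

lemma measurable_layerRows (k M w : ℕ) : Measurable (layerRows k M w) := by
  unfold layerRows; fun_prop

lemma map_reindex {ι κ : Type*} [Fintype ι] [Fintype κ] {e : ι → κ → Param}
    (he : Function.Injective fun q : ι × κ => e q.1 q.2) :
    paramMeasure.map (fun θ j o => θ (e j o)) =
      Measure.pi fun _ : ι => Measure.pi fun _ : κ => gaussianReal 0 1 := by
  have h1 := Measure.map_infinitePi_infinitePi_of_inj (P := fun _ : Param => gaussianReal 0 1) he
  have h2 := Measure.infinitePi_map_curry (fun (_ : ι) (_ : κ) => gaussianReal 0 1)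
  rw [← h1, Measure.map_map (by fun_prop) (by fun_prop)] at h2
  simp only [Measure.infinitePi_eq_pi] at h2
  exact h2

lemma map_layerRows (k M w : ℕ) :
    paramMeasure.map (layerRows k M w) = gaussRows M (Option (Fin w)) := by
  refine map_reindex (e := fun (j : Fin M) (o : Option (Fin w)) =>
    o.elim (Sum.inr (k, (j : ℕ))) fun i => Sum.inl (k, (j : ℕ), (i : ℕ))) ?_
  rintro ⟨j, _ | i⟩ ⟨j', _ | i'⟩ h <;> simp_all [Fin.ext_iff]

/-- The σ-algebra generated by the parameters in a set. -/
abbrev paramSigma (S : Set Param) : MeasurableSpace (Param → ℝ) :=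
  ⨆ p ∈ S, MeasurableSpace.comap (fun θ : Param → ℝ => θ p) inferInstance

lemma measurable_paramSigma {S : Set Param} {p : Param} (hp : p ∈ S) :
    Measurable[paramSigma S] fun θ : Param → ℝ => θ p :=
  Measurable.mono (comap_measurable _)
    (le_iSup₂_of_le (f := fun p (_ : p ∈ S) =>
      MeasurableSpace.comap (fun θ : Param → ℝ => θ p) inferInstance) p hp le_rfl) le_rfl

lemma indepFun_paramMeasure {S T : Set Param} (hST : Disjoint S T) {α β : Type*}
    [MeasurableSpace α] [MeasurableSpace β] {f : (Param → ℝ) → α} {g : (Param → ℝ) → β}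
    (hf : Measurable[paramSigma S] f) (hg : Measurable[paramSigma T] g) :
    IndepFun f g paramMeasure := by
  have hi : iIndepFun (fun (p : Param) (θ : Param → ℝ) => θ p) paramMeasure :=
    iIndepFun_infinitePi (P := fun _ : Param => gaussianReal 0 1)
      (X := fun _ : Param => (id : ℝ → ℝ)) (fun _ => measurable_id)
  rw [iIndepFun_iff_iIndep] at hi
  have h := indep_iSup_of_disjoint (fun p => (measurable_pi_apply p).comap_le) hi hST
  rw [IndepFun_iff_Indep]
  exact indep_of_indep_of_le h hf.comap_le hg.comap_le

namespace Net

variable (N : Net) {d : ℕ} (m : ℕ → ℕ) (x y : Fin d → ℝ)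

/-- The preactivations of the first `M` neurons of layer `k` at the two inputs. -/
def pairMap (k M : ℕ) (θ : Param → ℝ) (j : Fin M) : ℝ × ℝ :=
  (N.preact m θ x k j, N.preact m θ y k j)

/-- The coefficients of the preactivation of a neuron as a linear function of its parameters. -/
def rowCoeff {w : ℕ} (u : Fin w → ℝ) (o : Option (Fin w)) : ℝ :=
  o.elim N.sigmaB fun i => N.sigmaW / √w * N.phi (u i)

/-- The preactivations of a layer at two inputs as a function of those of the previous layer and
of the parameters of the layer. -/
def layerMap (M w : ℕ) (z : (Fin w → ℝ × ℝ) × (Fin M → Option (Fin w) → ℝ)) (j : Fin M) : ℝ × ℝ :=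
  (∑ o, N.rowCoeff (fun i => (z.1 i).1) o * z.2 j o,
    ∑ o, N.rowCoeff (fun i => (z.1 i).2) o * z.2 j o)

variable {N m x y}

lemma measurable_rowCoeff (hphi : Measurable N.phi) (w : ℕ) (o : Option (Fin w)) :
    Measurable fun u : Fin w → ℝ => N.rowCoeff u o := by
  rcases o with _ | i
  · exact measurable_const
  · exact (hphi.comp (measurable_pi_apply i)).const_mul _

lemma measurable_layerMap (hphi : Measurable N.phi) (M w : ℕ) : Measurable (N.layerMap M w) := by
  have h := measurable_rowCoeff hphi w
  unfold layerMap
  refine measurable_pi_lambda _ fun j => Measurable.prodMk ?_ ?_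
  · refine Finset.measurable_sum _ fun o _ => Measurable.mul ?_ (by fun_prop)
    exact (h o).comp (g := fun u => N.rowCoeff u o)
      (f := fun z : (Fin w → ℝ × ℝ) × (Fin M → Option (Fin w) → ℝ) => fun i => (z.1 i).1)
      (by fun_prop)
  · refine Finset.measurable_sum _ fun o _ => Measurable.mul ?_ (by fun_prop)
    exact (h o).comp (g := fun u => N.rowCoeff u o)
      (f := fun z : (Fin w → ℝ × ℝ) × (Fin M → Option (Fin w) → ℝ) => fun i => (z.1 i).2)
      (by fun_prop)

lemma measurable_pairMap_paramSigma (hphi : Measurable N.phi) (k M : ℕ) :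
    Measurable[paramSigma {p | p.layer ≤ k}] (N.pairMap m x y k M) := by
  refine @measurable_pi_lambda _ _ _ (paramSigma {p | p.layer ≤ k}) _ _ fun j => ?_
  exact Measurable.prodMk
    (@measurable_preact N d m x _ (paramSigma {p | p.layer ≤ k}) id hphi k
      (fun p hp => measurable_paramSigma hp) j)
    (@measurable_preact N d m y _ (paramSigma {p | p.layer ≤ k}) id hphi k
      (fun p hp => measurable_paramSigma hp) j)

lemma measurable_pairMap (hphi : Measurable N.phi) (k M : ℕ) :
    Measurable (N.pairMap m x y k M) :=
  measurable_pi_lambda _ fun j => Measurable.prodMk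
    (measurable_preact (Θ := id) hphi k (fun p _ => measurable_pi_apply p) j)
    (measurable_preact (Θ := id) hphi k (fun p _ => measurable_pi_apply p) j)

lemma measurable_layerRows_paramSigma {k k' : ℕ} (hk : k' < k) (M w : ℕ) :
    Measurable[paramSigma {p | k' < p.layer}] (layerRows k M w) := by
  refine @measurable_pi_lambda _ _ _ (paramSigma {p | k' < p.layer}) _ _ fun j => ?_
  refine @measurable_pi_lambda _ _ _ (paramSigma {p | k' < p.layer}) _ _ fun o => ?_
  refine measurable_paramSigma ?_
  rcases o with _ | i <;> exact hk

lemma disjoint_layer (k : ℕ) : Disjoint {p : Param | p.layer ≤ k} {p | k < p.layer} :=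
  Set.disjoint_left.2 fun p (h1 : p.layer ≤ k) (h2 : k < p.layer) => absurd h1 (not_le.2 h2)

lemma map_pairMap_prod_layerRows (hphi : Measurable N.phi) (k w M w' : ℕ) :
    paramMeasure.map (fun θ => (N.pairMap m x y k w θ, layerRows (k + 1) M w' θ)) =
      (paramMeasure.map (N.pairMap m x y k w)).prod (gaussRows M (Option (Fin w'))) := by
  rw [(indepFun_paramMeasure (disjoint_layer k) (measurable_pairMap_paramSigma hphi k w)
    (measurable_layerRows_paramSigma (Nat.lt_succ_self k) M w')).map_prod_eq_prod_map_map
    (measurable_pairMap hphi k w).aemeasurable (measurable_layerRows _ _ _).aemeasurable,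
    map_layerRows]

lemma pairMap_succ {k w : ℕ} (hw : m (k + 1) = w) (M : ℕ) (θ : Param → ℝ) :
    N.pairMap m x y (k + 2) M θ =
      N.layerMap M w (N.pairMap m x y (k + 1) w θ, layerRows (k + 2) M w θ) := by
  subst hw
  ext j
  · simp only [pairMap, layerMap, preact, Fintype.sum_option, rowCoeff, layerRows, Option.elim,
      Finset.sum_range, Finset.mul_sum]
    rw [add_comm]
    congr 1
    exact Finset.sum_congr rfl fun i _ => by ring
  · simp only [pairMap, layerMap, preact, Fintype.sum_option, rowCoeff, layerRows, Option.elim,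
      Finset.sum_range, Finset.mul_sum]
    rw [add_comm]
    congr 1
    exact Finset.sum_congr rfl fun i _ => by ring

/-- The first layer is exactly Gaussian, which starts the induction with no error. -/
lemma map_pairMap_one {t : ℝ} (ht : |N.gammaW ^ 2 * t + N.gammaB ^ 2| ≤ 1)
    (hunit1 : N.gammaW ^ 2 + N.gammaB ^ 2 = 1) (hx : ∑ j, x j ^ 2 = 1) (hy : ∑ j, y j ^ 2 = 1)
    (hxy : ∑ j, x j * y j = t) (M : ℕ) :
    paramMeasure.map (N.pairMap m x y 1 M) =
      Measure.pi fun _ : Fin M => corrG (N.gammaW ^ 2 * t + N.gammaB ^ 2) := by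
  set c : (Fin d → ℝ) → Option (Fin d) → ℝ :=
    fun x o => o.elim N.gammaB fun i => N.gammaW * x i with hc
  have hdot : ∀ x y : Fin d → ℝ, ∑ o, c x o * c y o =
      N.gammaW ^ 2 * ∑ j, x j * y j + N.gammaB ^ 2 := fun x y => by
    rw [Fintype.sum_option, Finset.mul_sum, add_comm]
    simp only [hc, Option.elim]
    congr 1
    · exact Finset.sum_congr rfl fun i _ => by ring
    · ring
  have h1 := map_pi_gaussian_corrG (c x) (c y) ht
    (by simp only [sq (c x _), hdot]; simp only [← sq, hx, mul_one, hunit1])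
    (by rw [hdot, hxy])
    (by simp only [sq (c y _), hdot]; simp only [← sq, hy, mul_one, hunit1])
  have e : N.pairMap m x y 1 M = (fun r : Fin M → Option (Fin d) → ℝ => fun j =>
      (fun r : Option (Fin d) → ℝ => (∑ o, c x o * r o, ∑ o, c y o * r o)) (r j)) ∘
        layerRows 1 M d := by
    ext θ j
    · simp only [pairMap, preact, Function.comp, Fintype.sum_option, layerRows, hc, Option.elim,
        Finset.mul_sum]
      rw [add_comm]
      congr 1
      exact Finset.sum_congr rfl fun i _ => by ring
    · simp only [pairMap, preact, Function.comp, Fintype.sum_option, layerRows, hc, Option.elim,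
        Finset.mul_sum]
      rw [add_comm]
      congr 1
      exact Finset.sum_congr rfl fun i _ => by ring
  rw [e, ← Measure.map_map (by fun_prop) (measurable_layerRows _ _ _), map_layerRows]
  have : IsProbabilityMeasure ((Measure.pi fun _ : Option (Fin d) => gaussianReal 0 1).map
      fun r => (∑ o, c x o * r o, ∑ o, c y o * r o)) :=
    Measure.isProbabilityMeasure_map (by fun_prop)
  rw [gaussRows, Measure.pi_map_pi (f := fun (_ : Fin M) (r : Option (Fin d) → ℝ) =>
    (∑ o, c x o * r o, ∑ o, c y o * r o)) (fun _ => by fun_prop), h1]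

end Net

/-! ### Gaussian limit of the preactivations -/

namespace Net

variable {N : Net} {d : ℕ} {m : ℕ → ℕ} {x y : Fin d → ℝ}

lemma sum_rowCoeff_mul {w : ℕ} (u v : Fin w → ℝ) :
    ∑ o, N.rowCoeff u o * N.rowCoeff v o =
      N.sigmaW ^ 2 * ((w : ℝ)⁻¹ * ∑ i, N.phi (u i) * N.phi (v i)) + N.sigmaB ^ 2 := by
  rw [Fintype.sum_option, add_comm]
  simp only [rowCoeff, Option.elim]
  congr 1
  · have h : (N.sigmaW / √(w : ℝ)) ^ 2 = N.sigmaW ^ 2 * (w : ℝ)⁻¹ := by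
      rw [div_pow, Real.sq_sqrt (Nat.cast_nonneg w), div_eq_mul_inv]
    rw [← mul_assoc, ← h, Finset.mul_sum]
    exact Finset.sum_congr rfl fun i _ => by ring
  · ring

/-- If the next correlation is `±1` then the activations are almost surely proportional. -/
lemma degenerate_corr (hphi : MemLp N.phi 2 (gaussianReal 0 1)) (hsW : 0 < N.sigmaW)
    (hunit : N.sigmaB ^ 2 = 1 - N.sigmaW ^ 2 * ∫ z, N.phi z ^ 2 ∂(gaussianReal 0 1))
    {ρ ρ' : ℝ} (hρ : |ρ| ≤ 1) (hρ'1 : |ρ'| ≤ 1)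
    (hρ' : ρ' = N.sigmaW ^ 2 * gaussCov N.phi ρ + N.sigmaB ^ 2) (h1 : ρ' ^ 2 = 1) :
    (∀ᵐ z ∂(corrG ρ), N.phi z.2 = ρ' * N.phi z.1) ∧ N.sigmaB ^ 2 = ρ' * N.sigmaB ^ 2 := by
  have hf1 : MemLp (fun z : ℝ × ℝ => N.phi z.1) 2 (corrG ρ) := hphi.comp_corrG_fst
  have hf2 : MemLp (fun z : ℝ × ℝ => N.phi z.2) 2 (corrG ρ) := hphi.comp_corrG_snd hρ
  have i1 : ∫ z, N.phi z.1 ^ 2 ∂(corrG ρ) = ∫ z, N.phi z ^ 2 ∂(gaussianReal 0 1) := by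
    conv_rhs => rw [← (corrG_fst ρ).map_eq]
    rw [integral_map (by fun_prop)]
    rw [(corrG_fst ρ).map_eq]; exact hphi.1.pow 2
  have i2 : ∫ z, N.phi z.2 ^ 2 ∂(corrG ρ) = ∫ z, N.phi z ^ 2 ∂(gaussianReal 0 1) := by
    conv_rhs => rw [← (corrG_snd hρ).map_eq]
    rw [integral_map (by fun_prop)]
    rw [(corrG_snd hρ).map_eq]; exact hphi.1.pow 2
  have hint : Integrable (fun z : ℝ × ℝ => (N.phi z.2 - ρ' * N.phi z.1) ^ 2) (corrG ρ) :=
    (hf2.sub (hf1.const_mul ρ')).integrable_sq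
  have key : ∫ z, (N.phi z.2 - ρ' * N.phi z.1) ^ 2 ∂(corrG ρ) =
      2 * ∫ z, N.phi z ^ 2 ∂(gaussianReal 0 1) - 2 * ρ' * gaussCov N.phi ρ := by
    have e : ∀ z : ℝ × ℝ, (N.phi z.2 - ρ' * N.phi z.1) ^ 2 =
        N.phi z.2 ^ 2 + N.phi z.1 ^ 2 - 2 * ρ' * (N.phi z.1 * N.phi z.2) := fun z => by
      linear_combination N.phi z.1 ^ 2 * h1
    simp_rw [e]
    have hadd : Integrable (fun z : ℝ × ℝ => N.phi z.2 ^ 2 + N.phi z.1 ^ 2) (corrG ρ) :=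
      hf2.integrable_sq.add hf1.integrable_sq
    have hmul : Integrable (fun z : ℝ × ℝ => 2 * ρ' * (N.phi z.1 * N.phi z.2)) (corrG ρ) :=
      (hf1.integrable_mul hf2).const_mul _
    rw [integral_sub hadd hmul, integral_add hf2.integrable_sq hf1.integrable_sq,
      i1, i2, integral_const_mul, gaussCov]
    ring
  have hnn : 0 ≤ ∫ z, (N.phi z.2 - ρ' * N.phi z.1) ^ 2 ∂(corrG ρ) :=
    integral_nonneg fun z => sq_nonneg _
  have hle := (abs_le.1 hρ'1).2
  have hW : 0 < N.sigmaW ^ 2 := by positivity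
  -- The left side is nonnegative and, as ρ' ≤ 1, the right side is nonpositive; so both vanish. In
  -- particular ρ' = -1 forces σ_b = 0.
  have hI : N.sigmaW ^ 2 * ∫ z, (N.phi z.2 - ρ' * N.phi z.1) ^ 2 ∂(corrG ρ) =
      -2 * (N.sigmaB ^ 2 * (1 - ρ')) := by
    rw [key]
    linear_combination 2 * hunit + 2 * ρ' * hρ' - 2 * h1
  have hB : 0 ≤ N.sigmaB ^ 2 * (1 - ρ') := mul_nonneg (sq_nonneg _) (by linarith)
  have hIn := mul_nonneg hW.le hnn
  have hB0 : N.sigmaB ^ 2 * (1 - ρ') = 0 := by linarith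
  refine ⟨?_, by linarith⟩
  have h0 : ∫ z, (N.phi z.2 - ρ' * N.phi z.1) ^ 2 ∂(corrG ρ) = 0 := by
    have : N.sigmaW ^ 2 * ∫ z, (N.phi z.2 - ρ' * N.phi z.1) ^ 2 ∂(corrG ρ) = 0 := by linarith
    exact (mul_eq_zero.1 this).resolve_left hW.ne'
  rw [integral_eq_zero_iff_of_nonneg (fun z => sq_nonneg _) hint] at h0
  filter_upwards [h0] with z hz
  have : (N.phi z.2 - ρ' * N.phi z.1) ^ 2 = 0 := hz
  linarith [pow_eq_zero_iff (two_ne_zero) |>.1 this]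

lemma ae_pi_forall {E : Type*} [MeasurableSpace E] {μ : Measure E} [IsProbabilityMeasure μ]
    {p : E → Prop} (h : ∀ᵐ z ∂μ, p z) (w : ℕ) :
    ∀ᵐ g ∂(Measure.pi fun _ : Fin w => μ), ∀ i, p (g i) :=
  ae_all_iff.2 fun i =>
    (Measure.quasiMeasurePreserving_eval (fun _ : Fin w => μ) i).ae h

/-- The layer map transports the limiting law of one layer approximately to that of the next. -/
lemma eventually_map_layerMap (hm : Measurable N.phi) (hphi : MemLp N.phi 2 (gaussianReal 0 1))
    (hsW : 0 < N.sigmaW)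
    (hunit : N.sigmaB ^ 2 = 1 - N.sigmaW ^ 2 * ∫ z, N.phi z ^ 2 ∂(gaussianReal 0 1))
    {ρ ρ' : ℝ} (hρ : |ρ| ≤ 1) (hρ'1 : |ρ'| ≤ 1)
    (hρ' : ρ' = N.sigmaW ^ 2 * gaussCov N.phi ρ + N.sigmaB ^ 2) (M : ℕ) {δ : ℝ≥0∞} (hδ : δ ≠ 0) :
    ∀ᶠ w in atTop, TVLe δ
      (((Measure.pi fun _ : Fin w => corrG ρ).prod (gaussRows M (Option (Fin w)))).map
        (N.layerMap M w)) (Measure.pi fun _ : Fin M => corrG ρ') := by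
  -- Half of δ pays for the conditional Gaussian law at a good sample; the other half bounds the
  -- probability that one of the three Gram entries is off. The tolerance η does not depend on the
  -- number of inputs w.
  obtain ⟨η, hη, H⟩ := exists_gram_tvLe hρ'1 M (ENNReal.half_pos hδ).ne'
  have hf1 : MemLp (fun z : ℝ × ℝ => N.phi z.1) 2 (corrG ρ) := hphi.comp_corrG_fst
  have hf2 : MemLp (fun z : ℝ × ℝ => N.phi z.2) 2 (corrG ρ) := hphi.comp_corrG_snd hρ
  have i1 : ∫ z, N.phi z.1 * N.phi z.1 ∂(corrG ρ) = ∫ z, N.phi z ^ 2 ∂(gaussianReal 0 1) := by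
    simp only [← sq]
    conv_rhs => rw [← (corrG_fst ρ).map_eq]
    rw [integral_map (by fun_prop) (by fun_prop)]
  have i2 : ∫ z, N.phi z.2 * N.phi z.2 ∂(corrG ρ) = ∫ z, N.phi z ^ 2 ∂(gaussianReal 0 1) := by
    simp only [← sq]
    conv_rhs => rw [← (corrG_snd hρ).map_eq]
    rw [integral_map (by fun_prop) (by fun_prop)]
  have hW : 0 < N.sigmaW ^ 2 := by positivity
  set ε := η / N.sigmaW ^ 2 with hε
  have hε0 : 0 < ε := by positivity
  have hδ6 : 0 < δ / 2 / 3 := ENNReal.div_pos (ENNReal.half_pos hδ).ne' (by finiteness)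
  have l1 := (ENNReal.tendsto_nhds_zero.1 (weak_law_pi (corrG ρ)
    (f := fun z => N.phi z.1 * N.phi z.1) (by fun_prop) (hf1.integrable_mul hf1) hε0)) _ hδ6
  have l2 := (ENNReal.tendsto_nhds_zero.1 (weak_law_pi (corrG ρ)
    (f := fun z => N.phi z.1 * N.phi z.2) (by fun_prop) (hf1.integrable_mul hf2) hε0)) _ hδ6
  have l3 := (ENNReal.tendsto_nhds_zero.1 (weak_law_pi (corrG ρ)
    (f := fun z => N.phi z.2 * N.phi z.2) (by fun_prop) (hf2.integrable_mul hf2) hε0)) _ hδ6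
  filter_upwards [l1, l2, l3] with w h1 h2 h3 B hB
  set ν := Measure.pi fun _ : Fin w => corrG ρ
  set bad := {e : Fin w → ℝ × ℝ | ε ≤ |(w : ℝ)⁻¹ * ∑ i, N.phi (e i).1 * N.phi (e i).1 -
      ∫ z, N.phi z.1 * N.phi z.1 ∂(corrG ρ)|} ∪
    {e | ε ≤ |(w : ℝ)⁻¹ * ∑ i, N.phi (e i).1 * N.phi (e i).2 -
      ∫ z, N.phi z.1 * N.phi z.2 ∂(corrG ρ)|} ∪
    {e | ε ≤ |(w : ℝ)⁻¹ * ∑ i, N.phi (e i).2 * N.phi (e i).2 -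
      ∫ z, N.phi z.2 * N.phi z.2 ∂(corrG ρ)|} with hbad
  have hbadm : ν bad ≤ δ / 2 := by
    calc ν bad ≤ δ / 2 / 3 + δ / 2 / 3 + δ / 2 / 3 :=
          (measure_union_le _ _).trans (add_le_add ((measure_union_le _ _).trans
            (add_le_add h1 h2)) h3)
      _ = δ / 2 := ENNReal.add_thirds _
  have hdeg : ∀ᵐ g ∂ν, ρ' ^ 2 = 1 → ∀ i, N.phi (g i).2 = ρ' * N.phi (g i).1 := by
    by_cases hd : ρ' ^ 2 = 1
    · filter_upwards [ae_pi_forall (degenerate_corr hphi hsW hunit hρ hρ'1 hρ' hd).1 w] with g hg _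
      exact hg
    · exact Eventually.of_forall fun g h => absurd h hd
  have hmap : ∀ g : Fin w → ℝ × ℝ, gaussRows M (Option (Fin w))
      (Prod.mk g ⁻¹' (N.layerMap M w ⁻¹' B)) =
      (Measure.pi fun _ : Fin M => (Measure.pi fun _ : Option (Fin w) => gaussianReal 0 1).map
        fun r => (∑ o, N.rowCoeff (fun i => (g i).1) o * r o,
          ∑ o, N.rowCoeff (fun i => (g i).2) o * r o)) B := fun g => by
    have : IsProbabilityMeasure ((Measure.pi fun _ : Option (Fin w) => gaussianReal 0 1).map
        fun r => (∑ o, N.rowCoeff (fun i => (g i).1) o * r o,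
          ∑ o, N.rowCoeff (fun i => (g i).2) o * r o)) :=
      Measure.isProbabilityMeasure_map (by fun_prop)
    rw [← Measure.pi_map_pi (f := fun (_ : Fin M) (r : Option (Fin w) → ℝ) =>
      (∑ o, N.rowCoeff (fun i => (g i).1) o * r o,
        ∑ o, N.rowCoeff (fun i => (g i).2) o * r o)) (fun _ => by fun_prop),
      Measure.map_apply (by fun_prop) hB]
    rfl
  rw [Measure.map_apply (measurable_layerMap hm M w) hB,
    Measure.prod_apply (measurable_layerMap hm M w hB)]
  calc ∫⁻ g, gaussRows M (Option (Fin w)) (Prod.mk g ⁻¹' (N.layerMap M w ⁻¹' B)) ∂ν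
      ≤ ∫⁻ g, (((Measure.pi fun _ : Fin M => corrG ρ') B + δ / 2) +
          (toMeasurable ν bad).indicator 1 g) ∂ν := by
        refine lintegral_mono_ae ?_
        filter_upwards [hdeg] with g hg
        by_cases hgb : g ∈ toMeasurable ν bad
        · refine (prob_le_one).trans ?_
          simp [hgb]
        · have hgb' : g ∉ bad := fun h => hgb (subset_toMeasurable _ _ h)
          simp only [hbad, Set.mem_union, Set.mem_ofPred_eq, not_or, not_le] at hgb'
          obtain ⟨⟨g1, g2⟩, g3⟩ := hgb'
          rw [hmap]
          refine le_trans ?_ le_self_add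
          have hb : ∀ {s I c : ℝ}, |s - I| < ε → c = N.sigmaW ^ 2 * I + N.sigmaB ^ 2 →
              |N.sigmaW ^ 2 * s + N.sigmaB ^ 2 - c| < η := fun {s I c} h hc => by
            have : N.sigmaW ^ 2 * s + N.sigmaB ^ 2 - c = N.sigmaW ^ 2 * (s - I) := by
              rw [hc]; ring
            rw [this, abs_mul, abs_of_pos hW]
            rw [hε, lt_div_iff₀ hW] at h
            linarith
          refine H _ _ ?_ ?_ ?_ ?_ B hB
          · simp only [sq (N.rowCoeff _ _), sum_rowCoeff_mul]
            exact hb g1 (by rw [i1, hunit]; ring)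
          · rw [sum_rowCoeff_mul]
            exact hb g2 hρ'
          · simp only [sq (N.rowCoeff _ _), sum_rowCoeff_mul]
            exact hb g3 (by rw [i2, hunit]; ring)
          -- Almost sure proportionality of the activations makes the sampled Gram matrix satisfy
          -- the degenerate relations exactly, not just approximately.
          · intro hd
            have hg' := hg hd
            have hB2 := (degenerate_corr hphi hsW hunit hρ hρ'1 hρ' hd).2
            simp only [sq (N.rowCoeff _ _), sum_rowCoeff_mul, hg']
            have e1 : ∑ i, N.phi (g i).1 * (ρ' * N.phi (g i).1) =
                ρ' * ∑ i, N.phi (g i).1 * N.phi (g i).1 := by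
              rw [Finset.mul_sum]; exact Finset.sum_congr rfl fun i _ => by ring
            have e2 : ∑ i, (ρ' * N.phi (g i).1) * (ρ' * N.phi (g i).1) =
                ∑ i, N.phi (g i).1 * N.phi (g i).1 :=
              Finset.sum_congr rfl fun i _ => by
                linear_combination N.phi (g i).1 ^ 2 * hd
            rw [e1, e2]
            refine ⟨?_, rfl⟩
            linear_combination hB2
    _ = (Measure.pi fun _ : Fin M => corrG ρ') B + δ / 2 + ν bad := by
        rw [lintegral_add_left measurable_const, lintegral_const, measure_univ, mul_one,
          lintegral_indicator_one (measurableSet_toMeasurable _ _), measure_toMeasurable]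
    _ ≤ _ := by
        rw [add_assoc]
        gcongr
        calc δ / 2 + ν bad ≤ δ / 2 + δ / 2 := by gcongr
          _ = δ := ENNReal.add_halves δ

/-- In the sequential limit the preactivations at two inputs of finitely many neurons converge in
total variation to independent pairs of correlated Gaussians. -/
theorem eventually_map_pairMap (hm : Measurable N.phi)
    (hphi : MemLp N.phi 2 (gaussianReal 0 1)) (hsW : 0 < N.sigmaW)
    (hunit1 : N.gammaW ^ 2 + N.gammaB ^ 2 = 1)
    (hunit : N.sigmaB ^ 2 = 1 - N.sigmaW ^ 2 * ∫ z, N.phi z ^ 2 ∂(gaussianReal 0 1))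
    {t : ℝ} (ht : |t| ≤ 1) (hx : ∑ j, x j ^ 2 = 1) (hy : ∑ j, y j ^ 2 = 1)
    (hxy : ∑ j, x j * y j = t) (k M : ℕ) {δ : ℝ≥0∞} (hδ : δ ≠ 0) :
    ∀ᶠ m in seqWidths k, TVLe δ (paramMeasure.map (N.pairMap m x y (k + 1) M))
      (Measure.pi fun _ : Fin M => corrG (N.corr t (k + 1))) := by
  have hρ := abs_corr_le hphi hunit1 hunit ht
  induction k generalizing M δ with
  | zero =>
    refine Eventually.of_forall fun m => ?_
    rw [map_pairMap_one (hρ 0) hunit1 hx hy hxy]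
    exact TVLe.refl _
  | succ k ih =>
    rw [eventually_seqWidths_succ]
    -- The width w is chosen for the layer map alone; the induction hypothesis is then used for all
    -- w neurons that feed it.
    filter_upwards [eventually_map_layerMap hm hphi hsW hunit (hρ k) (hρ (k + 1)) rfl M
      (ENNReal.half_pos hδ).ne'] with w hw
    filter_upwards [ih w (ENNReal.half_pos hδ).ne'] with m hmw
    have hpm := Measure.isProbabilityMeasure_map (μ := paramMeasure)
      (measurable_pairMap (m := m) (x := x) (y := y) hm (k + 1) w).aemeasurable
    have e : N.pairMap (Function.update m (k + 1) w) x y (k + 1 + 1) M = N.layerMap M w ∘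
        fun θ => (N.pairMap m x y (k + 1) w θ, layerRows (k + 2) M w θ) := by
      ext1 θ
      rw [pairMap_succ (Function.update_self _ _ _), Function.comp]
      congr 2
      ext1 j
      have hc : ∀ k' < k + 1, Function.update m (k + 1) w k' = m k' := fun k' hk' =>
        Function.update_of_ne hk'.ne _ _
      simp only [pairMap, preact_congr_width (k + 1) hc]
    rw [e, ← Measure.map_map (measurable_layerMap hm M w)
      ((measurable_pairMap hm _ _).prodMk (measurable_layerRows _ _ _)),
      map_pairMap_prod_layerRows hm]
    have h2 := (hmw.prod (TVLe.refl (δ := 0) (gaussRows M (Option (Fin w))))).map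
      (measurable_layerMap hm M w)
    exact (h2.trans hw).mono (by rw [add_zero, ENNReal.add_halves])

end Net

/-! ### Convergence of the neural tangent kernel -/

lemma integral_mul_corrG {s : ℝ} (hs : |s| ≤ 1) : ∫ z, z.1 * z.2 ∂(corrG s) = s := by
  have := integral_hermite_corrG hs 1 1
  simpa [hermiteR] using this

/-- A real random variable is tight. -/
lemma exists_measure_gt_le {α : Type*} [MeasurableSpace α] (μ : Measure α)
    [IsFiniteMeasure μ] {f : α → ℝ} (hf : Measurable f) {δ : ℝ≥0∞} (hδ : 0 < δ) :
    ∃ r : ℝ, 0 ≤ r ∧ μ {a | r < f a} ≤ δ := by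
  have h := tendsto_measure_iInter_atTop (μ := μ) (s := fun n : ℕ => {a | (n : ℝ) < f a})
    (fun n => (measurableSet_lt measurable_const hf).nullMeasurableSet)
    (fun n n' hn a (ha : (n' : ℝ) < f a) => lt_of_le_of_lt (by exact_mod_cast hn) ha)
    ⟨0, measure_ne_top _ _⟩
  have h0 : ⋂ n : ℕ, {a | (n : ℝ) < f a} = ∅ := by
    ext a
    simp only [Set.mem_iInter, Set.mem_ofPred_eq, Set.mem_empty_iff_false, iff_false, not_forall,
      not_lt]
    exact exists_nat_ge (f a)
  rw [h0, measure_empty] at h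
  obtain ⟨n, hn⟩ := ((ENNReal.tendsto_nhds_zero.1 h) δ hδ).exists
  exact ⟨n, Nat.cast_nonneg n, hn⟩

/-- The weak law of large numbers for a product of two sample spaces. -/
lemma weak_law_pi_prod {E F : Type*} [MeasurableSpace E] [MeasurableSpace F] (μ : Measure E)
    (ν : Measure F) [IsProbabilityMeasure μ] [IsProbabilityMeasure ν]
    {f : E × F → ℝ} (hf : Measurable f) (hfi : Integrable f (μ.prod ν)) {ε : ℝ} (hε : 0 < ε) :
    Tendsto (fun w : ℕ => ((Measure.pi fun _ : Fin w => μ).prod (Measure.pi fun _ : Fin w => ν))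
      {e | ε ≤ |(w : ℝ)⁻¹ * ∑ i, f (e.1 i, e.2 i) - ∫ x, f x ∂(μ.prod ν)|}) atTop (𝓝 0) := by
  refine (weak_law_pi (μ.prod ν) hf hfi hε).congr fun w => ?_
  have h := measurePreserving_arrowProdEquivProdArrow E F (Fin w) (fun _ => μ) (fun _ => ν)
  rw [← h.map_eq, Measure.map_apply h.measurable]
  · rfl
  · refine measurableSet_le measurable_const ?_
    refine Measurable.abs (Measurable.sub_const (Measurable.const_mul ?_ _) _)
    exact Finset.measurable_sum _ fun i _ => hf.comp (by fun_prop)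

namespace Net

variable {N : Net} {d : ℕ} {m : ℕ → ℕ} {x y : Fin d → ℝ}

/-- The incoming weights of two neurons of layer `k`. -/
def weightPair (k i i' w : ℕ) (θ : Param → ℝ) (j : Fin w) : ℝ × ℝ :=
  (θ (Sum.inl (k, i, (j : ℕ))), θ (Sum.inl (k, i', (j : ℕ))))

/-- Weights into one neuron give a repeated coordinate and weights into two neurons an independent
pair. Both are instances of `corrG`, so diagonal and off-diagonal kernels share one argument. -/
lemma map_weightPair (k i i' w : ℕ) : paramMeasure.map (weightPair k i i' w) =
    Measure.pi fun _ : Fin w => corrG (if i = i' then 1 else 0) := by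
  by_cases h : i = i'
  · subst h
    have h1 := map_reindex (e := fun (j : Fin w) (_ : Fin 1) => Sum.inl (k, i, (j : ℕ))) (by
      rintro ⟨j, o⟩ ⟨j', o'⟩ h
      simpa [Fin.ext_iff, Subsingleton.elim o o'] using h)
    have h2 := map_pi_gaussian_corrG (ι := Fin 1) (fun _ => 1) (fun _ => 1) (ρ := 1)
      (by simp) (by simp) (by simp) (by simp)
    have : IsProbabilityMeasure ((Measure.pi fun _ : Fin 1 => gaussianReal 0 1).map
        fun r => (∑ i, (1 : ℝ) * r i, ∑ i, (1 : ℝ) * r i)) := by rw [h2]; infer_instance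
    have h3 := Measure.pi_map_pi (μ := fun _ : Fin w => Measure.pi fun _ : Fin 1 => gaussianReal 0 1)
      (f := fun (_ : Fin w) (r : Fin 1 → ℝ) => (∑ i, (1 : ℝ) * r i, ∑ i, (1 : ℝ) * r i))
      (fun _ => by fun_prop)
    rw [h2, ← h1, Measure.map_map (by fun_prop) (by fun_prop)] at h3
    rw [if_pos rfl, ← h3]
    congr 1
    ext θ j <;> simp [weightPair]
  · have h1 := map_reindex (e := fun (j : Fin w) (o : Fin 2) =>
      Sum.inl (k, ![i, i'] o, (j : ℕ))) (by
      rintro ⟨j, o⟩ ⟨j', o'⟩ h'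
      fin_cases o <;> fin_cases o' <;> simp_all [Fin.ext_iff, eq_comm])
    have h2 := map_pi_gaussian_corrG (ι := Fin 2) ![1, 0] ![0, 1] (ρ := 0)
      (by simp) (by simp) (by simp) (by simp)
    have : IsProbabilityMeasure ((Measure.pi fun _ : Fin 2 => gaussianReal 0 1).map
        fun r => (∑ i, (![1, 0] : Fin 2 → ℝ) i * r i, ∑ i, (![0, 1] : Fin 2 → ℝ) i * r i)) := by
      rw [h2]; infer_instance
    have h3 := Measure.pi_map_pi (μ := fun _ : Fin w => Measure.pi fun _ : Fin 2 => gaussianReal 0 1)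
      (f := fun (_ : Fin w) (r : Fin 2 → ℝ) =>
        (∑ i, (![1, 0] : Fin 2 → ℝ) i * r i, ∑ i, (![0, 1] : Fin 2 → ℝ) i * r i))
      (fun _ => by fun_prop)
    rw [h2, ← h1, Measure.map_map (by fun_prop) (by fun_prop)] at h3
    rw [if_neg h, ← h3]
    congr 1
    ext θ j <;> simp [weightPair]

lemma measurable_weightPair (k i i' w : ℕ) : Measurable (weightPair k i i' w) := by
  unfold weightPair; fun_prop

lemma measurable_weightPair_paramSigma {k k' : ℕ} (hk : k' < k) (i i' w : ℕ) :
    Measurable[paramSigma {p | k' < p.layer}] (weightPair k i i' w) := by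
  refine @measurable_pi_lambda _ _ _ (paramSigma {p | k' < p.layer}) _ _ fun j => ?_
  exact Measurable.prodMk (measurable_paramSigma (p := Sum.inl (k, i, (j : ℕ))) hk)
    (measurable_paramSigma (p := Sum.inl (k, i', (j : ℕ))) hk)

lemma map_pairMap_prod_weightPair (hphi : Measurable N.phi) (k w i i' : ℕ) :
    paramMeasure.map (fun θ => (N.pairMap m x y k w θ, weightPair (k + 1) i i' w θ)) =
      (paramMeasure.map (N.pairMap m x y k w)).prod
        (Measure.pi fun _ : Fin w => corrG (if i = i' then 1 else 0)) := by
  rw [(indepFun_paramMeasure (disjoint_layer k) (measurable_pairMap_paramSigma hphi k w)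
    (measurable_weightPair_paramSigma (Nat.lt_succ_self k) i i' w)).map_prod_eq_prod_map_map
    (measurable_pairMap hphi k w).aemeasurable (measurable_weightPair _ _ _ _).aemeasurable,
    map_weightPair]

/-- The weight in the neural tangent kernel of a layer of the kernel between the neurons `j` and
`j'` of the previous layer. -/
def backCoeff {w : ℕ} (ψ : ℝ → ℝ) (e : (Fin w → ℝ × ℝ) × (Fin w → ℝ × ℝ)) (j j' : Fin w) : ℝ :=
  (e.2 j).1 * (e.2 j').2 * (ψ (e.1 j).1 * ψ (e.1 j').2)

lemma ntkRec_succ {ψ : ℝ → ℝ} {k w : ℕ} (hw : m (k + 1) = w) (θ : Param → ℝ) (i i' : ℕ) :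
    N.ntkRec ψ m θ x y (k + 2) i i' =
      (if i = i' then N.sigmaW ^ 2 * ((w : ℝ)⁻¹ * ∑ j : Fin w,
        N.phi (N.pairMap m x y (k + 1) w θ j).1 * N.phi (N.pairMap m x y (k + 1) w θ j).2) +
          N.sigmaB ^ 2 else 0) +
      N.sigmaW ^ 2 * ((w : ℝ)⁻¹ * ∑ j : Fin w, ∑ j' : Fin w,
        backCoeff ψ (N.pairMap m x y (k + 1) w θ, weightPair (k + 2) i i' w θ) j j' *
          N.ntkRec ψ m θ x y (k + 1) j j') := by
  subst hw
  have h : (N.sigmaW / √(m (k + 1) : ℝ)) ^ 2 = N.sigmaW ^ 2 * (m (k + 1) : ℝ)⁻¹ := by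
    rw [div_pow, Real.sq_sqrt (Nat.cast_nonneg _), div_eq_mul_inv]
  simp only [ntkRec, h, Finset.sum_range, mul_assoc, pairMap, weightPair, backCoeff]

/-- In the sequential limit the neural tangent kernel between the neurons of a layer converges in
probability to a deterministic multiple of the identity. -/
theorem tendsto_ntkRec (hm : Measurable N.phi)
    (hphi : MemLp N.phi 2 (gaussianReal 0 1)) (hsW : 0 < N.sigmaW)
    (hunit1 : N.gammaW ^ 2 + N.gammaB ^ 2 = 1)
    (hunit : N.sigmaB ^ 2 = 1 - N.sigmaW ^ 2 * ∫ z, N.phi z ^ 2 ∂(gaussianReal 0 1))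
    {ψ : ℝ → ℝ} (hψm : Measurable ψ) (hψ : MemLp ψ 2 (gaussianReal 0 1))
    {t : ℝ} (ht : |t| ≤ 1) (hx : ∑ j, x j ^ 2 = 1) (hy : ∑ j, y j ^ 2 = 1)
    (hxy : ∑ j, x j * y j = t) (k i i' : ℕ) {ε : ℝ} (hε : 0 < ε) :
    Tendsto (fun m => paramMeasure {θ | ε ≤ |N.ntkRec ψ m θ x y (k + 1) i i' -
      if i = i' then N.limitNTK ψ t (k + 1) else 0|}) (seqWidths k) (𝓝 0) := by
  induction k generalizing i i' ε with
  | zero =>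
    have : ∀ m : ℕ → ℕ, {θ | ε ≤ |N.ntkRec ψ m θ x y (0 + 1) i i' -
        if i = i' then N.limitNTK ψ t (0 + 1) else 0|} = ∅ := fun m => by
      ext θ
      simp only [ntkRec, limitNTK, hxy, sub_self, abs_zero, Set.mem_ofPred_eq,
        Set.mem_empty_iff_false, iff_false, not_le]
      exact hε
    simp only [this, measure_empty]
    exact tendsto_const_nhds
  | succ k ih =>
    have hρ : |N.corr t (k + 1)| ≤ 1 := abs_corr_le hphi hunit1 hunit ht k
    set ρ := N.corr t (k + 1) with hρdef
    -- The correlation of the incoming weights: it multiplies the mean of the diagonal terms and so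
    -- makes the off-diagonal limit zero.
    set s : ℝ := if i = i' then 1 else 0 with hs
    have hs1 : |s| ≤ 1 := by rw [hs]; split_ifs <;> simp
    set L := N.limitNTK ψ t (k + 1) with hL
    have hW : 0 < N.sigmaW ^ 2 := by positivity
    have hlim : (if i = i' then N.limitNTK ψ t (k + 1 + 1) else 0) =
        (if i = i' then N.sigmaW ^ 2 * gaussCov N.phi ρ + N.sigmaB ^ 2 else 0) +
          N.sigmaW ^ 2 * (L * (s * gaussCov ψ ρ)) := by
      rw [hs]
      split_ifs with h
      · simp only [limitNTK, corr, ← hL, ← hρdef]; ring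
      · simp
    rw [hlim]
    rw [ENNReal.tendsto_nhds_zero]
    intro δ hδ
    rw [eventually_seqWidths_succ]
    -- Three bad events under the limit law, the total variation error, and the failure of the
    -- kernels below to be near their limits.
    set δ1 := δ / 5 with hδ1
    have hδ10 : 0 < δ1 := ENNReal.div_pos hδ.ne' (by finiteness)
    have hphi2 : Integrable (fun z : (ℝ × ℝ) × (ℝ × ℝ) => N.phi z.1.1 * N.phi z.1.2)
        ((corrG ρ).prod (corrG s)) := (integrable_mul_corrG hρ hphi hphi).comp_fst _
    have hid : Integrable (fun z : ℝ × ℝ => z.1 * z.2) (corrG s) :=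
      integrable_mul_corrG hs1 (f := id) (g := id) (memLp_id_gaussianReal' 2 (by finiteness))
        (memLp_id_gaussianReal' 2 (by finiteness))
    have hback : Integrable (fun z : (ℝ × ℝ) × (ℝ × ℝ) => z.2.1 * z.2.2 * (ψ z.1.1 * ψ z.1.2))
        ((corrG ρ).prod (corrG s)) := by
      have := (integrable_mul_corrG hρ hψ hψ).mul_prod hid
      exact this.congr (Eventually.of_forall fun z => mul_comm _ _)
    have I1 : ∫ z : (ℝ × ℝ) × (ℝ × ℝ), N.phi z.1.1 * N.phi z.1.2 ∂((corrG ρ).prod (corrG s)) =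
        gaussCov N.phi ρ := by
      have := integral_prod_mul (μ := corrG ρ) (ν := corrG s)
        (fun z : ℝ × ℝ => N.phi z.1 * N.phi z.2) (fun _ => (1 : ℝ))
      simpa [gaussCov] using this
    have I2 : ∫ z : (ℝ × ℝ) × (ℝ × ℝ), z.2.1 * z.2.2 * (ψ z.1.1 * ψ z.1.2)
        ∂((corrG ρ).prod (corrG s)) = s * gaussCov ψ ρ := by
      have := integral_prod_mul (μ := corrG ρ) (ν := corrG s)
        (fun z : ℝ × ℝ => ψ z.1 * ψ z.2) (fun z => z.1 * z.2)
      rw [integral_mul_corrG hs1] at this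
      rw [mul_comm s, gaussCov, ← this]
      exact integral_congr_ae (Eventually.of_forall fun z => mul_comm _ _)
    set ε1 := ε / (3 * N.sigmaW ^ 2) with hε1
    set ε2 := ε / (3 * N.sigmaW ^ 2 * (|L| + 1)) with hε2
    have hε10 : 0 < ε1 := by positivity
    have hε20 : 0 < ε2 := by positivity
    have l1 := ENNReal.tendsto_nhds_zero.1 (weak_law_pi_prod (corrG ρ) (corrG s)
      (f := fun z => N.phi z.1.1 * N.phi z.1.2) (by fun_prop) hphi2 hε10) _ hδ10
    have l2 := ENNReal.tendsto_nhds_zero.1 (weak_law_pi_prod (corrG ρ) (corrG s)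
      (f := fun z => z.2.1 * z.2.2 * (ψ z.1.1 * ψ z.1.2)) (by fun_prop) hback hε20) _ hδ10
    rw [I1] at l1
    rw [I2] at l2
    filter_upwards [l1, l2] with w hw1 hw2
    set Q := (Measure.pi fun _ : Fin w => corrG ρ).prod (Measure.pi fun _ : Fin w => corrG s)
    -- The sum over w² terms is only tight. Its bound r may depend on w, because the accuracy `ε3`
    -- of the kernels below is chosen afterwards, when the lower widths grow.
    obtain ⟨r, hr0, hr⟩ := exists_measure_gt_le Q
      (f := fun e => N.sigmaW ^ 2 * ((w : ℝ)⁻¹ * ∑ j : Fin w, ∑ j' : Fin w, |backCoeff ψ e j j'|))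
      (by unfold backCoeff; fun_prop) hδ10
    set bad := {e : (Fin w → ℝ × ℝ) × (Fin w → ℝ × ℝ) | ε1 ≤ |(w : ℝ)⁻¹ * ∑ j,
        N.phi (e.1 j).1 * N.phi (e.1 j).2 - gaussCov N.phi ρ|} ∪
      {e | ε2 ≤ |(w : ℝ)⁻¹ * ∑ j, (e.2 j).1 * (e.2 j).2 * (ψ (e.1 j).1 * ψ (e.1 j).2) -
        s * gaussCov ψ ρ|} ∪
      {e | r < N.sigmaW ^ 2 * ((w : ℝ)⁻¹ * ∑ j : Fin w, ∑ j' : Fin w, |backCoeff ψ e j j'|)}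
      with hbad
    have hQbad : Q bad ≤ δ1 + δ1 + δ1 :=
      (measure_union_le _ _).trans (add_le_add ((measure_union_le _ _).trans
        (add_le_add hw1 hw2)) hr)
    set ε3 := ε / (3 * (r + 1)) with hε3
    have hε30 : 0 < ε3 := by positivity
    have hK : Tendsto (fun m => ∑ q : Fin w × Fin w, paramMeasure {θ | ε3 ≤
        |N.ntkRec ψ m θ x y (k + 1) q.1 q.2 - if (q.1 : ℕ) = q.2 then L else 0|})
        (seqWidths k) (𝓝 0) := by
      have := tendsto_finsetSum (Finset.univ : Finset (Fin w × Fin w))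
        fun q _ => ih (q.1 : ℕ) (q.2 : ℕ) hε30
      simpa using this
    filter_upwards [ENNReal.tendsto_nhds_zero.1 hK δ1 hδ10,
      eventually_map_pairMap hm hphi hsW hunit1 hunit ht hx hy hxy k w hδ10.ne'] with m hmK hmC
    set m' := Function.update m (k + 1) w with hm'
    have hc : ∀ k' < k + 1, m' k' = m k' := fun k' hk' => Function.update_of_ne hk'.ne _ _
    set J := fun θ => (N.pairMap m x y (k + 1) w θ, weightPair (k + 2) i i' w θ) with hJ
    have hJm : Measurable J := (measurable_pairMap hm _ _).prodMk (measurable_weightPair _ _ _ _)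
    have hpm := Measure.isProbabilityMeasure_map (μ := paramMeasure)
      (measurable_pairMap (m := m) (x := x) (y := y) hm (k + 1) w).aemeasurable
    have hJbad : paramMeasure (J ⁻¹' bad) ≤ δ1 + δ1 + δ1 + δ1 := by
      refine (Measure.le_map_apply hJm.aemeasurable _).trans ?_
      rw [hJ, map_pairMap_prod_weightPair hm]
      have h2 := hmC.prod (TVLe.refl (δ := 0) (Measure.pi fun _ : Fin w => corrG s))
      rw [add_zero] at h2
      exact (h2.apply_le bad).trans (by gcongr)
    have hsub : {θ | ε ≤ |N.ntkRec ψ m' θ x y (k + 1 + 1) i i' -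
        ((if i = i' then N.sigmaW ^ 2 * gaussCov N.phi ρ + N.sigmaB ^ 2 else 0) +
          N.sigmaW ^ 2 * (L * (s * gaussCov ψ ρ)))|} ⊆ J ⁻¹' bad ∪
        ⋃ q : Fin w × Fin w, {θ | ε3 ≤ |N.ntkRec ψ m θ x y (k + 1) q.1 q.2 -
          if (q.1 : ℕ) = q.2 then L else 0|} := by
      intro θ hθ
      by_contra hcon
      simp only [Set.mem_union, Set.mem_iUnion, not_or, not_exists, Set.mem_preimage, hbad,
        Set.mem_ofPred_eq, not_le, not_lt] at hcon
      obtain ⟨⟨⟨c1, c2⟩, c3⟩, c4⟩ := hcon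
      have hp : N.pairMap m' x y (k + 1) w θ = N.pairMap m x y (k + 1) w θ := by
        ext1 j
        simp only [pairMap, preact_congr_width (k + 1) hc]
      rw [Set.mem_ofPred_eq] at hθ
      refine absurd hθ (not_le.2 ?_)
      rw [ntkRec_succ (m := m') (w := w) (Function.update_self _ _ _), hp]
      have hN : ∀ j j' : ℕ, N.ntkRec ψ m' θ x y (k + 1) j j' = N.ntkRec ψ m θ x y (k + 1) j j' :=
        ntkRec_congr_width ψ (k + 1) hc
      simp only [hN]
      set e := J θ with he
      -- The limit L times the identity keeps only the diagonal, an average to which the weak law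
      -- applies; the rest is an error weighted by `backCoeff`.
      have hsplit : ∑ j : Fin w, ∑ j' : Fin w, backCoeff ψ e j j' *
          N.ntkRec ψ m θ x y (k + 1) j j' =
          L * ∑ j, (e.2 j).1 * (e.2 j).2 * (ψ (e.1 j).1 * ψ (e.1 j).2) +
          ∑ j : Fin w, ∑ j' : Fin w, backCoeff ψ e j j' *
            (N.ntkRec ψ m θ x y (k + 1) j j' - if (j : ℕ) = j' then L else 0) := by
        rw [Finset.mul_sum, ← Finset.sum_add_distrib]
        refine Finset.sum_congr rfl fun j _ => ?_
        simp only [mul_sub, Finset.sum_sub_distrib, Fin.val_inj, mul_ite, mul_zero,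
          Finset.sum_ite_eq, Finset.mem_univ, if_true, backCoeff]
        ring
      have herr : |N.sigmaW ^ 2 * ((w : ℝ)⁻¹ * ∑ j : Fin w, ∑ j' : Fin w, backCoeff ψ e j j' *
          (N.ntkRec ψ m θ x y (k + 1) j j' - if (j : ℕ) = j' then L else 0))| ≤ r * ε3 := by
        have hb : |∑ j : Fin w, ∑ j' : Fin w, backCoeff ψ e j j' *
          (N.ntkRec ψ m θ x y (k + 1) j j' - if (j : ℕ) = j' then L else 0)| ≤
            (∑ j : Fin w, ∑ j' : Fin w, |backCoeff ψ e j j'|) * ε3 := by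
          rw [Finset.sum_mul]
          refine (Finset.abs_sum_le_sum_abs _ _).trans (Finset.sum_le_sum fun j _ => ?_)
          rw [Finset.sum_mul]
          refine (Finset.abs_sum_le_sum_abs _ _).trans (Finset.sum_le_sum fun j' _ => ?_)
          rw [abs_mul]
          exact mul_le_mul_of_nonneg_left (c4 (j, j')).le (abs_nonneg _)
        have hw0 : (0 : ℝ) ≤ (w : ℝ)⁻¹ := by positivity
        rw [abs_mul, abs_mul, abs_of_pos hW, abs_of_nonneg hw0]
        calc N.sigmaW ^ 2 * ((w : ℝ)⁻¹ * |_|)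
            ≤ N.sigmaW ^ 2 * ((w : ℝ)⁻¹ *
              ((∑ j : Fin w, ∑ j' : Fin w, |backCoeff ψ e j j'|) * ε3)) := by gcongr
          _ = N.sigmaW ^ 2 * ((w : ℝ)⁻¹ *
              ∑ j : Fin w, ∑ j' : Fin w, |backCoeff ψ e j j'|) * ε3 := by ring
          _ ≤ r * ε3 := by gcongr
      have hr3 : r * ε3 < ε / 3 := by
        rw [hε3, mul_div_assoc', div_lt_div_iff₀ (by positivity) (by norm_num)]
        nlinarith
      rw [hsplit]
      set S1 := (w : ℝ)⁻¹ * ∑ j, N.phi (e.1 j).1 * N.phi (e.1 j).2 with hS1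
      set S2 := ∑ j, (e.2 j).1 * (e.2 j).2 * (ψ (e.1 j).1 * ψ (e.1 j).2) with hS2
      set Er := ∑ j : Fin w, ∑ j' : Fin w, backCoeff ψ e j j' *
            (N.ntkRec ψ m θ x y (k + 1) j j' - if (j : ℕ) = j' then L else 0) with hEr
      have a1 : |(if i = i' then N.sigmaW ^ 2 * S1 + N.sigmaB ^ 2 else 0) -
          (if i = i' then N.sigmaW ^ 2 * gaussCov N.phi ρ + N.sigmaB ^ 2 else 0)| < ε / 3 := by
        split_ifs
        · have : N.sigmaW ^ 2 * S1 + N.sigmaB ^ 2 -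
              (N.sigmaW ^ 2 * gaussCov N.phi ρ + N.sigmaB ^ 2) =
              N.sigmaW ^ 2 * (S1 - gaussCov N.phi ρ) := by ring
          rw [this, abs_mul, abs_of_pos hW]
          rw [hε1, lt_div_iff₀ (by positivity)] at c1
          linarith
        · simpa using hε
      have a2 : |N.sigmaW ^ 2 * (L * ((w : ℝ)⁻¹ * S2 - s * gaussCov ψ ρ))| < ε / 3 := by
        rw [abs_mul, abs_mul, abs_of_pos hW]
        rw [hε2, lt_div_iff₀ (by positivity)] at c2
        have hLn := abs_nonneg ((w : ℝ)⁻¹ * S2 - s * gaussCov ψ ρ)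
        nlinarith [mul_nonneg hW.le hLn]
      have hfin : (if i = i' then N.sigmaW ^ 2 * S1 + N.sigmaB ^ 2 else 0) +
          N.sigmaW ^ 2 * ((w : ℝ)⁻¹ * (L * S2 + Er)) -
          ((if i = i' then N.sigmaW ^ 2 * gaussCov N.phi ρ + N.sigmaB ^ 2 else 0) +
            N.sigmaW ^ 2 * (L * (s * gaussCov ψ ρ))) =
          ((if i = i' then N.sigmaW ^ 2 * S1 + N.sigmaB ^ 2 else 0) -
            (if i = i' then N.sigmaW ^ 2 * gaussCov N.phi ρ + N.sigmaB ^ 2 else 0)) +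
          N.sigmaW ^ 2 * (L * ((w : ℝ)⁻¹ * S2 - s * gaussCov ψ ρ)) +
          N.sigmaW ^ 2 * ((w : ℝ)⁻¹ * Er) := by ring
      rw [hfin]
      refine (abs_add_three _ _ _).trans_lt ?_
      linarith
    calc _ ≤ paramMeasure (J ⁻¹' bad) + ∑ q : Fin w × Fin w, paramMeasure {θ | ε3 ≤
            |N.ntkRec ψ m θ x y (k + 1) q.1 q.2 - if (q.1 : ℕ) = q.2 then L else 0|} :=
          (measure_mono hsub).trans ((measure_union_le _ _).trans
            (add_le_add le_rfl (measure_iUnion_fintype_le _ _)))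
      _ ≤ δ1 + δ1 + δ1 + δ1 + δ1 := add_le_add hJbad hmK
      _ = 5 * δ1 := by ring
      _ ≤ δ := by rw [hδ1]; exact ENNReal.mul_div_le

end Net

/-! ### Uniqueness, null sets and transfer to the given network -/

/-- Limits in probability that are constants are unique. -/
lemma TendstoInMeasure.const_unique {α ι : Type*} [MeasurableSpace α] {μ : Measure α}
    [IsProbabilityMeasure μ] {l : Filter ι} [l.NeBot] {f : ι → α → ℝ} {a b : ℝ}
    (ha : TendstoInMeasure μ f l fun _ => a) (hb : TendstoInMeasure μ f l fun _ => b) : a = b := by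
  by_contra hab
  have hε : 0 < |a - b| / 2 := by
    have := abs_pos.2 (sub_ne_zero.2 hab)
    positivity
  have h := (tendstoInMeasure_iff_norm.1 ha _ hε).add (tendstoInMeasure_iff_norm.1 hb _ hε)
  rw [add_zero] at h
  have h1 : ∀ i, (1 : ℝ≥0∞) ≤ μ {x | |a - b| / 2 ≤ ‖f i x - a‖} +
      μ {x | |a - b| / 2 ≤ ‖f i x - b‖} := fun i => by
    rw [← measure_univ (μ := μ)]
    refine (measure_mono fun x _ => ?_).trans (measure_union_le _ _)
    by_contra hx
    simp only [Set.mem_union, Set.mem_ofPred_eq, not_or, not_le, Real.norm_eq_abs] at hx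
    have := abs_sub_le a (f i x) b
    rw [abs_sub_comm a (f i x)] at this
    linarith [hx.1, hx.2]
  have := ge_of_tendsto' h h1
  simp at this

namespace Net

variable {N : Net} {d : ℕ} {m : ℕ → ℕ} {x y : Fin d → ℝ}

/-- The event that a preactivation in the hidden layers `1, …, L` lies in the set `S`. -/
def hiddenHits (N : Net) (m : ℕ → ℕ) (x : Fin d → ℝ) (S : Set ℝ) (L : ℕ) : Set (Param → ℝ) :=
  {θ | ∃ k > 0, k < L + 1 ∧ ∃ j < m k, N.preact m θ x k j ∈ S}

/-- At finite width the preactivations may have atoms, so a null set can be hit with positive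
probability. Total variation convergence to a Gaussian law makes this probability vanish in the
limit. -/
lemma tendsto_hiddenHits (hm : Measurable N.phi)
    (hphi : MemLp N.phi 2 (gaussianReal 0 1)) (hsW : 0 < N.sigmaW)
    (hunit1 : N.gammaW ^ 2 + N.gammaB ^ 2 = 1)
    (hunit : N.sigmaB ^ 2 = 1 - N.sigmaW ^ 2 * ∫ z, N.phi z ^ 2 ∂(gaussianReal 0 1))
    (hx : ∑ j, x j ^ 2 = 1) {S : Set ℝ} (hS : gaussianReal 0 1 S = 0) (L : ℕ) :
    Tendsto (fun m => paramMeasure (N.hiddenHits m x S L)) (seqWidths L) (𝓝 0) := by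
  induction L with
  | zero =>
    have : ∀ m : ℕ → ℕ, N.hiddenHits m x S 0 = ∅ := fun m => by
      ext θ
      simp only [hiddenHits, Set.mem_ofPred_eq, Set.mem_empty_iff_false, iff_false]
      rintro ⟨k, hk, hk', _⟩
      omega
    simp only [this, measure_empty]
    exact tendsto_const_nhds
  | succ L ih =>
    rw [ENNReal.tendsto_nhds_zero] at ih ⊢
    intro δ hδ
    have hδ2 := ENNReal.half_pos hδ.ne'
    rw [eventually_seqWidths_succ]
    -- Any w works: the limit law gives the event probability zero however many neurons there are.
    refine Eventually.of_forall fun w => ?_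
    filter_upwards [ih _ hδ2, eventually_map_pairMap (x := x) (y := x) (t := 1) hm hphi hsW hunit1
      hunit (by simp) hx hx (by simpa only [← sq] using hx) L w hδ2.ne'] with m h1 h2
    set m' := Function.update m (L + 1) w with hm'
    have hc : ∀ k' < L + 1, m' k' = m k' := fun k' hk' => Function.update_of_ne hk'.ne _ _
    set B := {g : Fin w → ℝ × ℝ | ∃ j, (g j).1 ∈ S} with hB
    have hB0 : (Measure.pi fun _ : Fin w => corrG (N.corr 1 (L + 1))) B = 0 := by
      have h0 : ∀ᵐ z ∂(corrG (N.corr 1 (L + 1))), z.1 ∉ S := by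
        have := (corrG_fst (N.corr 1 (L + 1))).quasiMeasurePreserving.ae
          (p := fun z => z ∉ S) (by simpa [ae_iff] using hS)
        exact this
      have := ae_pi_forall h0 w
      rw [ae_iff] at this
      simpa [hB] using this
    have hsub : N.hiddenHits m' x S (L + 1) ⊆
        N.hiddenHits m x S L ∪ (N.pairMap m x x (L + 1) w) ⁻¹' B := by
      rintro θ ⟨k, hk0, hk, j, hj, hjS⟩
      rw [preact_congr_width (m' := m) k (fun k' hk' => hc k' (by omega))] at hjS
      rcases Nat.lt_succ_iff_lt_or_eq.1 hk with h | h
      · exact Or.inl ⟨k, hk0, h, j, by rwa [← hc k h], hjS⟩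
      · subst h
        rw [hm', Function.update_self] at hj
        exact Or.inr ⟨⟨j, hj⟩, hjS⟩
    calc _ ≤ paramMeasure (N.hiddenHits m x S L) +
          paramMeasure ((N.pairMap m x x (L + 1) w) ⁻¹' B) :=
          (measure_mono hsub).trans (measure_union_le _ _)
      _ ≤ δ / 2 + (0 + δ / 2) := by
          refine add_le_add h1 ((Measure.le_map_apply
            (measurable_pairMap hm _ _).aemeasurable _).trans ?_)
          rw [← hB0]
          exact h2.apply_le B
      _ = δ := by rw [zero_add, ENNReal.add_halves]

lemma gaussCov_congr {f g : ℝ → ℝ} (h : f =ᵐ[gaussianReal 0 1] g) {ρ : ℝ} (hρ : |ρ| ≤ 1) :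
    gaussCov f ρ = gaussCov g ρ := by
  refine integral_congr_ae ?_
  filter_upwards [(corrG_fst ρ).quasiMeasurePreserving.ae h,
    (corrG_snd hρ).quasiMeasurePreserving.ae h] with z h1 h2
  rw [h1, h2]

lemma corr_withPhi (hphi : MemLp N.phi 2 (gaussianReal 0 1))
    (hunit1 : N.gammaW ^ 2 + N.gammaB ^ 2 = 1)
    (hunit : N.sigmaB ^ 2 = 1 - N.sigmaW ^ 2 * ∫ z, N.phi z ^ 2 ∂(gaussianReal 0 1))
    {f : ℝ → ℝ} (hf : f =ᵐ[gaussianReal 0 1] N.phi) {t : ℝ} (ht : |t| ≤ 1) (k : ℕ) :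
    (N.withPhi f).corr t (k + 1) = N.corr t (k + 1) := by
  induction k with
  | zero => rfl
  | succ k ih =>
    rw [corr, corr, ih, ← gaussCov_congr hf (abs_corr_le hphi hunit1 hunit ht k)]
    rfl

lemma limitNTK_withPhi (hphi : MemLp N.phi 2 (gaussianReal 0 1))
    (hunit1 : N.gammaW ^ 2 + N.gammaB ^ 2 = 1)
    (hunit : N.sigmaB ^ 2 = 1 - N.sigmaW ^ 2 * ∫ z, N.phi z ^ 2 ∂(gaussianReal 0 1))
    {f : ℝ → ℝ} (hf : f =ᵐ[gaussianReal 0 1] N.phi) (ψ : ℝ → ℝ) {t : ℝ} (ht : |t| ≤ 1) (k : ℕ) :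
    (N.withPhi f).limitNTK ψ t (k + 1) = N.limitNTK ψ t (k + 1) := by
  induction k with
  | zero => rfl
  | succ k ih =>
    rw [limitNTK, limitNTK, ih, corr_withPhi hphi hunit1 hunit hf ht,
      corr_withPhi hphi hunit1 hunit hf ht]
    rfl

end Net

lemma abs_sum_mul_le_one {d : ℕ} {x y : Fin d → ℝ} (hx : ∑ j, x j ^ 2 = 1)
    (hy : ∑ j, y j ^ 2 = 1) : |∑ j, x j * y j| ≤ 1 := by
  have := Finset.sum_mul_sq_le_sq_mul_sq Finset.univ x y
  rw [hx, hy, one_mul] at this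
  exact (sq_le_one_iff_abs_le_one _).1 this

/-- Only upper bounds on probabilities are needed, so an inequality suffices and the events may be
nonmeasurable. -/
lemma measure_preimage_le_paramMeasure {Ω : Type*} [MeasurableSpace Ω] {P : Measure Ω}
    [IsProbabilityMeasure P] {θ : Param → Ω → ℝ}
    (hlaw : ∀ p, HasLaw (θ p) (gaussianReal 0 1) P) (hindep : iIndepFun θ P)
    (S : Set (Param → ℝ)) : P {ω | (fun p => θ p ω) ∈ S} ≤ paramMeasure S := by
  have hm : AEMeasurable (fun ω p => θ p ω) P :=
    aemeasurable_pi_iff.2 fun p => (hlaw p).aemeasurable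
  have := (hindep.hasLaw_infinitePi hlaw hm).map_eq
  rw [paramMeasure, ← this]
  exact Measure.le_map_apply hm S

namespace Net

variable {N : Net} {d : ℕ} {x y : Fin d → ℝ}

/-- The points where a measurable version of the activation function differs from it, or where it
is not differentiable. -/
def exceptionalSet (N : Net) (f : ℝ → ℝ) : Set ℝ :=
  {z | N.phi z ≠ f z} ∪ {z | ¬ DifferentiableAt ℝ N.phi z}

lemma exceptionalSet_null (hdiff : ∀ᵐ z : ℝ, DifferentiableAt ℝ N.phi z) {f : ℝ → ℝ}
    (hf : N.phi =ᵐ[gaussianReal 0 1] f) : gaussianReal 0 1 (N.exceptionalSet f) = 0 := by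
  refine measure_union_null hf ?_
  exact gaussianReal_absolutelyContinuous 0 one_ne_zero hdiff

lemma preact_eq_of_notMem {m : ℕ → ℕ} {f : ℝ → ℝ} {L : ℕ} {θ : Param → ℝ}
    (h : θ ∉ (N.withPhi f).hiddenHits m x (N.exceptionalSet f) L) {k : ℕ} (hk0 : 0 < k)
    (hk : k < L + 1) {j : ℕ} (hj : j < m k) :
    N.phi ((N.withPhi f).preact m θ x k j) = f ((N.withPhi f).preact m θ x k j) ∧
      DifferentiableAt ℝ N.phi ((N.withPhi f).preact m θ x k j) := by
  have : (N.withPhi f).preact m θ x k j ∉ N.exceptionalSet f := fun hS =>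
    h ⟨k, hk0, hk, j, hj, hS⟩
  simpa [exceptionalSet, not_or] using this

lemma differentiableAt_preact_of_notMem {m : ℕ → ℕ} {f : ℝ → ℝ} {L : ℕ} {θ : Param → ℝ}
    (h : θ ∉ (N.withPhi f).hiddenHits m x (N.exceptionalSet f) L) :
    ∀ k > 0, k < L + 1 → ∀ j < m k, DifferentiableAt ℝ N.phi (N.preact m θ x k j) := by
  intro k hk0 hk j hj
  have h1 := (preact_eq_of_notMem h hk0 hk hj).2
  rwa [preact_withPhi k fun k' h0 hk' j hj => (preact_eq_of_notMem h h0 (by omega) hj).1] at h1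

lemma empiricalNTK_eq_of_notMem {m : ℕ → ℕ} {f : ℝ → ℝ} {L : ℕ} {θ : Param → ℝ}
    (hx : θ ∉ (N.withPhi f).hiddenHits m x (N.exceptionalSet f) L)
    (hy : θ ∉ (N.withPhi f).hiddenHits m y (N.exceptionalSet f) L) :
    N.empiricalNTK m (L + 1) θ x y =
      (N.withPhi f).ntkRec (deriv N.phi) m θ x y (L + 1) 0 0 := by
  rw [empiricalNTK_eq_ntkRec (differentiableAt_preact_of_notMem hx)
    (differentiableAt_preact_of_notMem hy), ntkRec_withPhi (L + 1)
    (fun k h0 hk j hj => (preact_eq_of_notMem hx h0 hk hj).1)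
    (fun k h0 hk j hj => (preact_eq_of_notMem hy h0 hk hj).1)]

section Limit

variable {Ω : Type*} [MeasurableSpace Ω] {P : Measure Ω} [IsProbabilityMeasure P]
  (hsW : 0 < N.sigmaW) (hphi : MemLp N.phi 2 (gaussianReal 0 1))
  (hdiff : ∀ᵐ z : ℝ, DifferentiableAt ℝ N.phi z) {θ : Param → Ω → ℝ}
  (hlaw : ∀ p, HasLaw (θ p) (gaussianReal 0 1) P) (hindep : iIndepFun θ P)
  (hunit1 : N.gammaW ^ 2 + N.gammaB ^ 2 = 1)
  (hunit : N.sigmaB ^ 2 = 1 - N.sigmaW ^ 2 * ∫ z, N.phi z ^ 2 ∂(gaussianReal 0 1))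
  (hx : ∑ j, x j ^ 2 = 1)

include hsW hphi hdiff hunit1 hunit hx

lemma tendsto_hiddenHits_exceptionalSet (L : ℕ) :
    Tendsto (fun m => paramMeasure ((N.withPhi (hphi.1.mk N.phi)).hiddenHits m x
      (N.exceptionalSet (hphi.1.mk N.phi)) L)) (seqWidths L) (𝓝 0) := by
  have hae := hphi.1.ae_eq_mk
  refine tendsto_hiddenHits (N := N.withPhi (hphi.1.mk N.phi)) hphi.1.measurable_mk
    (hphi.ae_eq hae) hsW hunit1 ?_ hx (exceptionalSet_null hdiff hae) L
  refine hunit.trans ?_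
  congr 2
  exact integral_congr_ae (hae.mono fun z hz => by
    change N.phi z ^ 2 = hphi.1.mk N.phi z ^ 2
    rw [hz])

include hlaw hindep

lemma tendsto_not_gradExists (L : ℕ) :
    Tendsto (fun m : ℕ → ℕ => P {ω | ¬ N.GradExists m (L + 1) (fun p => θ p ω) x})
      (seqWidths L) (𝓝 0) := by
  refine tendsto_of_tendsto_of_tendsto_of_le_of_le tendsto_const_nhds
    (tendsto_hiddenHits_exceptionalSet hsW hphi hdiff hunit1 hunit hx L)
    (fun _ => zero_le) fun m => ?_
  refine (measure_mono fun ω hω => ?_).trans (measure_preimage_le_paramMeasure hlaw hindep _)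
  by_contra hcon
  exact hω (gradExists_of_differentiableAt (differentiableAt_preact_of_notMem hcon))

/-- Off the exceptional events the kernel equals `ntkRec` for a measurable version of φ but with the
derivative of φ itself, since a version may have a different derivative. This is why ψ is separate
from the activation there. -/
lemma tendstoInMeasure_empiricalNTK (hd : MemLp (deriv N.phi) 2 (gaussianReal 0 1))
    (hy : ∑ j, y j ^ 2 = 1) (L : ℕ) :
    TendstoInMeasure P (fun (m : ℕ → ℕ) ω => N.empiricalNTK m (L + 1) (fun p => θ p ω) x y)
      (seqWidths L) fun _ => N.limitNTK (deriv N.phi) (∑ j, x j * y j) (L + 1) := by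
  have hae := hphi.1.ae_eq_mk
  have ht := abs_sum_mul_le_one hx hy
  have hunit' : N.sigmaB ^ 2 =
      1 - N.sigmaW ^ 2 * ∫ z, hphi.1.mk N.phi z ^ 2 ∂(gaussianReal 0 1) := by
    rw [hunit]
    congr 2
    exact integral_congr_ae (hae.mono fun z hz => by simp only [hz])
  rw [tendstoInMeasure_iff_norm]
  intro ε hε
  have h1 := tendsto_hiddenHits_exceptionalSet hsW hphi hdiff hunit1 hunit hx L
  have h2 := tendsto_hiddenHits_exceptionalSet hsW hphi hdiff hunit1 hunit hy L
  have h3 := tendsto_ntkRec (N := N.withPhi (hphi.1.mk N.phi)) hphi.1.measurable_mk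
    (hphi.ae_eq hae) hsW hunit1 hunit' (measurable_deriv N.phi) hd ht hx hy rfl L 0 0 hε
  simp only [if_true, limitNTK_withPhi hphi hunit1 hunit hae.symm (deriv N.phi) ht] at h3
  have h := (h1.add h2).add h3
  simp only [add_zero] at h
  refine tendsto_of_tendsto_of_tendsto_of_le_of_le tendsto_const_nhds h
    (fun _ => zero_le) fun m => ?_
  refine le_trans ?_ ((measure_union_le _ _).trans (add_le_add (measure_union_le _ _) le_rfl))
  refine (measure_mono fun ω hω => ?_).trans (measure_preimage_le_paramMeasure hlaw hindep _)
  by_contra hcon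
  simp only [Set.mem_ofPred_eq, Set.mem_union, not_or] at hcon
  obtain ⟨⟨c1, c2⟩, c3⟩ := hcon
  simp only [Set.mem_ofPred_eq, empiricalNTK_eq_of_notMem c1 c2, Real.norm_eq_abs] at hω
  exact c3 hω

end Limit

end Net

end

/-! ### Assembly of the theorem -/

theorem mainTheorem1 {Ω : Type*} [MeasurableSpace Ω] (P : Measure Ω) [IsProbabilityMeasure P]
    (N : Net)
    -- hyperparameters
    (hgW : 0 < N.gammaW) (hgB : 0 ≤ N.gammaB) (hsW : 0 < N.sigmaW) (hsB : 0 ≤ N.sigmaB)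
    -- activation function
    (hphi : MemLp N.phi 2 (gaussianReal 0 1))
    (hdiff : ∀ᵐ z : ℝ, DifferentiableAt ℝ N.phi z)
    (hderiv : MemLp (deriv N.phi) 2 (gaussianReal 0 1))
    -- independent standard Gaussian parameters
    (θ : Param → Ω → ℝ)
    (hlaw : ∀ p, HasLaw (θ p) (gaussianReal 0 1) P)
    (hindep : iIndepFun θ P)
    -- unit variance initialization
    (hunit1 : N.gammaW ^ 2 + N.gammaB ^ 2 = 1)
    (hunit : N.sigmaB ^ 2 = 1 - N.sigmaW ^ 2 * ∫ z, N.phi z ^ 2 ∂(gaussianReal 0 1))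
    -- data on the unit sphere
    (n d : ℕ) (X : Matrix (Fin n) (Fin d) ℝ) (hX : ∀ i, ∑ j, X i j ^ 2 = 1)
    (l : ℕ) (hl : 1 ≤ l) :
    -- the gradients exist with probability tending to one
    (∀ i, Tendsto (fun m : ℕ → ℕ => P {ω | ¬ N.GradExists m l (fun p => θ p ω) (X i)})
      (seqWidths (l - 1)) (𝓝 0)) ∧
    -- the limiting NTK matrix exists, is unique, and is given by the power series
    (∃! K : Matrix (Fin n) (Fin n) ℝ, IsNTKMatrix P θ N X l K) ∧
    (∀ K : Matrix (Fin n) (Fin n) ℝ, IsNTKMatrix P θ N X l K →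
      HasSum (fun p : ℕ => N.kappa l p • hadamardPow (X * X.transpose) p) ((n : ℝ) • K) ∧
      ∀ i j, Summable fun p : ℕ => |N.kappa l p * (X * X.transpose) i j ^ p|) ∧
    -- the coefficients are nonnegative
    (∀ p, 0 ≤ N.kappa l p) ∧ (∀ p, 0 ≤ N.alpha l p) ∧ (2 ≤ l → ∀ p, 0 ≤ N.upsilon l p) ∧
    -- the series that define them converge
    (2 ≤ l → ∀ p,
      Summable (fun k : ℕ => N.aCoeff k * tupleSum p k (N.alpha (l - 1))) ∧
      Summable (fun k : ℕ => N.bCoeff k * tupleSum p k (N.alpha (l - 1)))) ∧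
    -- without bias in the first layer, the coefficients at layer 2 are the Hermite ones
    (N.gammaB = 0 → ∀ p, N.alpha 2 p = N.aCoeff p ∧ N.upsilon 2 p = N.bCoeff p) := by
  obtain ⟨k, rfl⟩ : ∃ k, l = k + 1 := ⟨l - 1, by omega⟩
  have hlim : IsNTKMatrix P θ N X (k + 1)
      (Matrix.of fun i j => N.limitNTK (deriv N.phi) (∑ q, X i q * X j q) (k + 1) / n) := by
    intro i j
    -- The index `i` itself shows that n is positive, so dividing by n is harmless.
    have hn : (n : ℝ) ≠ 0 := Nat.cast_ne_zero.2 (Fin.pos i).ne'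
    simp only [Matrix.of_apply, mul_div_cancel₀ _ hn]
    exact Net.tendstoInMeasure_empiricalNTK hsW hphi hdiff hlaw hindep hunit1 hunit (hX i)
      hderiv (hX j) k
  have huniq : ∀ K : Matrix (Fin n) (Fin n) ℝ, IsNTKMatrix P θ N X (k + 1) K → ∀ i j,
      (n : ℝ) * K i j = N.limitNTK (deriv N.phi) (∑ q, X i q * X j q) (k + 1) := by
    intro K hK i j
    have : (seqWidths (k + 1 - 1)).NeBot := seqWidths_neBot k
    exact TendstoInMeasure.const_unique (hK i j) (Net.tendstoInMeasure_empiricalNTK hsW hphi hdiff hlaw hindep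
      hunit1 hunit (hX i) hderiv (hX j) k)
  have hkappa := Net.hasNonnegSeries_kappa hphi hderiv hunit1 hunit k
  have hgram : ∀ i j, |(X * X.transpose) i j| ≤ 1 := fun i j => by
    simpa only [Matrix.mul_apply, Matrix.transpose_apply] using abs_sum_mul_le_one (hX i) (hX j)
  refine ⟨fun i => Net.tendsto_not_gradExists hsW hphi hdiff hlaw hindep hunit1 hunit (hX i) k,
    ⟨_, hlim, fun K hK => ?_⟩, fun K hK => ⟨?_, fun i j => hkappa.summable_abs (hgram i j)⟩,
    hkappa.1, (Net.hasNonnegSeries_alpha hphi hunit1 hunit k).1, fun h2 => ?_, fun h2 => ?_,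
    Net.alpha_two_of_gammaB_eq_zero hunit1⟩
  · ext i j
    have hn : (n : ℝ) ≠ 0 := Nat.cast_ne_zero.2 (Fin.pos i).ne'
    rw [Matrix.of_apply, eq_div_iff hn, mul_comm]
    exact huniq K hK i j
  · refine Pi.hasSum.2 fun i => Pi.hasSum.2 fun j => ?_
    have h := hkappa.2 _ (hgram i j)
    simp only [Matrix.mul_apply, Matrix.transpose_apply, ← huniq K hK i j] at h
    simpa only [Matrix.smul_apply, smul_eq_mul, hadamardPow, Matrix.of_apply, Matrix.mul_apply,
      Matrix.transpose_apply] using h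
  · obtain ⟨k, rfl⟩ : ∃ q, k = q + 1 := ⟨k - 1, by omega⟩
    exact (Net.hasNonnegSeries_upsilon hphi hderiv hunit1 hunit k).1
  · obtain ⟨k, rfl⟩ : ∃ q, k = q + 1 := ⟨k - 1, by omega⟩
    have ha := Net.hasNonnegSeries_alpha hphi hunit1 hunit k
    have h1 := (Net.corr_one hphi hunit1 hunit k).le
    exact fun p => ⟨ha.summable_comp (Net.hasNonnegSeries_aCoeff hphi) h1 p,
      ha.summable_comp (Net.hasNonnegSeries_bCoeff hderiv) h1 p⟩
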